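/- Let $d\in\mathbb N$ and $\|u\|=\sum_i|u_i|$ for vectors $u$ and multi-indices, and $\|Q\|=\max_j\sum_i|Q_{ij}|$ for $d\times d$ matrices. For $\rho,r>0$ let $$\mathcal D_{\rho,r}=\{(x,y)\in\mathbb C^d\times\mathbb C^d:\ \|\operatorname{Im}x\|<\rho/2\pi,\ \|y\|<r\}.$$ Let $\mathcal A_{\rho,r}$ be the Banach space of Hamiltonians $$H(x,y)=\sum_{(k,\nu)\in\mathbb Z^d\times\mathbb N_0^d}H_{k,\nu}\,y^\nu e^{2\pi i k\cdot x}\quad\text{with}\quad \|H\|_{\rho,r}=\sum_{k,\nu}|H_{k,\nu}|\,r^{\|\nu\|}e^{\rho\|k\|}<\infty ,$$ let $\mathcal A_{\rho,r}^{2d}$ carry the norm $\sum_j\|H_j\|_{\rho,r}$, and let $\mathcal A'_{\rho,r}$ be the space of $H\in\mathcal A_{\rho,r}$ with $\|H\|'_{\rho,r}=\|H\|_{\rho,r}+\sum_{i=1}^{2d}\|\partial_iH\|_{\rho,r}<\infty$; on $2d$-tuples $\|\cdot\|'_{\rho,r}$ is again the sum over the components. A map between complex Banach spaces, defined on an open set,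 is called analytic if it is locally bounded and Gâteaux differentiable. Let $\omega_n\in\mathbb R^d\setminus\{0\}$, let $Q_n$ be a symmetric complex $d\times d$ matrix, and put $H_n^0(x,y)=\omega_n\cdot y+\frac12\,{}^{\top}\!y\,Q_n\,y$, whose norm $\|H_n^0\|_{\rho,r'}$ does not depend on $\rho$ and is written $\|H_n^0\|_{r'}$. For $\sigma_n,\tau_n>0$ let $$I_n^-=\{(k,\nu):\ |\omega_n\cdot k|>\sigma_n\|k\|,\ \|\nu\|<\tau_n\|k\|\},$$ and let $\mathbb I_n^-$ be the projection that keeps only the Taylor–Fourier modes with indices in $I_n^-$ (the far from resonance modes); let $\mathbb I_n^+=\mathbb I-\mathbb I_n^-$. Let $\rho_n,\nu>0$, $0<r<r'$, $\sigma_n>2r'\|Q_n\|$, and $$\varepsilon_n=\frac{\sigma_n^2\,\min\{1,\frac{\nu}{2\pi},r'-r\}^2}{48\,\|H_n^0\|_{r'}\,(2\pi+1)^2\,\bigl(1+2\pi+\frac{\tau_n+1}{r'}\bigr)^2},$$ and let $\mathcal V$ be the open ball in $\mathcal A'_{\rho_n+\nu,r'}$ with centre $H_n^0$ and radius $\varepsilon_n$.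 Then for every $H\in\mathcal V$ there is an analytic map $g:\mathcal D_{\rho_n,r}\to\mathcal D_{\rho_n+\nu,r'}$ which is a symplectomorphism onto its image with respect to $\sum_i dy_i\wedge dx_i$, with $g-\mathrm{id}\in\mathcal A_{\rho_n,r}^{2d}$ (even with $\|g-\mathrm{id}\|'_{\rho_n,r}<\infty$) and $H\circ g\in\mathcal A_{\rho_n,r}$, such that $$\mathbb I_n^-(H\circ g)=0 .$$ These $g$ can be chosen such that the maps $\mathfrak G:H\mapsto g$, from $\mathcal V$ to $\mathrm{id}+\mathcal A_{\rho_n,r}^{2d}$, and $\mathcal U:H\mapsto H\circ g$, from $\mathcal V$ to $\mathbb I_n^+\mathcal A_{\rho_n,r}$, are analytic and, for all $H\in\mathcal V$, $$\|\mathfrak G(H)-\mathrm{id}\|'_{\rho_n,r}\le\frac1{\varepsilon_n}\,\|\mathbb I_n^-H\|_{\rho_n+\nu,r'},$$ $$\|\mathcal U(H)-H_n^0\|_{\rho_n,r}\le\Bigl(1+\sqrt{\tfrac{12\|H_n^0\|_{r'}}{\varepsilon_n}}\Bigr)\,\|H-H_n^0\|'_{\rho_n+\nu,r'},$$ and such that,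 if $H$ is real-analytic (real at the real points of its domain), then $\mathfrak G(H)$ maps the real points of $\mathcal D_{\rho_n,r}$ to real points. -/

import Mathlib

open Filter Topology Set

/- Taylor-Fourier Hamiltonians on complex neighbourhoods of `𝕋ᵈ × {0}`. -/
namespace TFHam

/-- The index set `I = ℤᵈ × ℕ₀ᵈ` of the Taylor-Fourier modes. -/
abbrev Idx (d : ℕ) : Type := (Fin d → ℤ) × (Fin d → ℕ)

/-- Points `(x, y)` of `ℂᵈ × ℂᵈ = ℂ²ᵈ`. -/
abbrev Phase (d : ℕ) : Type := (Fin d → ℂ) × (Fin d → ℂ)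

/-- The norm `‖k‖ = ∑ |k_i|` of an integer vector. -/
def kNorm {d : ℕ} (k : Fin d → ℤ) : ℝ := ∑ i, |(k i : ℝ)|

/-- The norm `‖ν‖ = ∑ ν_i` of a multi-index. -/
def deg {d : ℕ} (ν : Fin d → ℕ) : ℕ := ∑ i, ν i

/-- The weight `r ^ ‖ν‖ * exp (ρ ‖k‖)` of the mode `(k, ν)`. -/
noncomputable def weight {d : ℕ} (ρ r : ℝ) (i : Idx d) : ℝ :=
  r ^ deg i.2 * Real.exp (ρ * kNorm i.1)

/-- `∑ |c_{k,ν}| r ^ ‖ν‖ exp (ρ ‖k‖) < ∞`. -/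
def MemA {d : ℕ} (ρ r : ℝ) (c : Idx d → ℂ) : Prop :=
  Summable fun i => ‖c i‖ * weight ρ r i

/-- The norm `‖c‖_{ρ,r} = ∑ |c_{k,ν}| r ^ ‖ν‖ exp (ρ ‖k‖)`. -/
noncomputable def normA {d : ℕ} (ρ r : ℝ) (c : Idx d → ℂ) : ℝ :=
  ∑' i, ‖c i‖ * weight ρ r i

/-- Taylor-Fourier coefficients of the derivative with respect to `x_j`. -/
noncomputable def coeffDx {d : ℕ} (j : Fin d) (c : Idx d → ℂ) : Idx d → ℂ :=
  fun i => 2 * (Real.pi : ℂ) * Complex.I * (i.1 j : ℂ) * c i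

/-- Taylor-Fourier coefficients of the derivative with respect to `y_j`. -/
noncomputable def coeffDy {d : ℕ} (j : Fin d) (c : Idx d → ℂ) : Idx d → ℂ :=
  fun i => ((i.2 j : ℂ) + 1) * c (i.1, i.2 + Pi.single j 1)

/-- `c` and all its first partial derivatives have finite norm. -/
def MemC1 {d : ℕ} (ρ r : ℝ) (c : Idx d → ℂ) : Prop :=
  MemA ρ r c ∧ (∀ j, MemA ρ r (coeffDx j c)) ∧ ∀ j, MemA ρ r (coeffDy j c)

/-- The norm of the gradient: the sum of the norms of the `2d` partial derivatives. -/
noncomputable def normGrad {d : ℕ} (ρ r : ℝ) (c : Idx d → ℂ) : ℝ :=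
  ∑ j, normA ρ r (coeffDx j c) + ∑ j, normA ρ r (coeffDy j c)

/-- The primed norm `‖c‖'_{ρ,r} = ‖c‖_{ρ,r} + ‖∇c‖_{ρ,r}`. -/
noncomputable def normC1 {d : ℕ} (ρ r : ℝ) (c : Idx d → ℂ) : ℝ :=
  normA ρ r c + normGrad ρ r c

/-- The Taylor-Fourier series
`∑ c_{k,ν} y ^ ν exp (2 π i k · x)` with coefficients `c`, at the point `p = (x, y)`. -/
noncomputable def evalTF {d : ℕ} (c : Idx d → ℂ) (p : Phase d) : ℂ :=
  ∑' i : Idx d, c i * (∏ j, p.2 j ^ i.2 j) *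
    Complex.exp (2 * (Real.pi : ℂ) * Complex.I * ∑ j, (i.1 j : ℂ) * p.1 j)

/-- The domain `𝒟_{ρ,r} = {‖Im x‖ < ρ / 2π} × {‖y‖ < r}`, for the norm `‖u‖ = ∑ |u_i|`. -/
def dom (d : ℕ) (ρ r : ℝ) : Set (Phase d) :=
  {p | ∑ j, |(p.1 j).im| < ρ / (2 * Real.pi) ∧ ∑ j, ‖p.2 j‖ < r}

section Lemmas

variable {d : ℕ} {ρ r : ℝ} {a b : Idx d → ℂ}

theorem weight_pos (ρ : ℝ) (hr : 0 < r) (i : Idx d) : 0 < weight ρ r i :=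
  mul_pos (pow_pos hr _) (Real.exp_pos _)

theorem MemA.add (hr : 0 < r) (ha : MemA ρ r a) (hb : MemA ρ r b) : MemA ρ r (a + b) := by
  refine Summable.of_nonneg_of_le
    (fun i => mul_nonneg (norm_nonneg _) (weight_pos ρ hr i).le) (fun i => ?_)
    (Summable.add ha hb)
  rw [← add_mul]
  exact mul_le_mul_of_nonneg_right (norm_add_le _ _) (weight_pos ρ hr i).le

theorem MemA.zero : MemA ρ r (0 : Idx d → ℂ) := by
  simp [MemA, summable_zero]

theorem MemA.smul (z : ℂ) (ha : MemA ρ r a) : MemA ρ r (z • a) := by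
  have := Summable.mul_left ‖z‖ ha
  simpa [MemA, mul_assoc] using this

theorem normA_nonneg (hr : 0 < r) : 0 ≤ normA ρ r a :=
  tsum_nonneg fun i => mul_nonneg (norm_nonneg _) (weight_pos ρ hr i).le

theorem normA_smul (z : ℂ) : normA ρ r (z • a) = ‖z‖ * normA ρ r a := by
  simp only [normA, Pi.smul_apply, norm_smul, mul_assoc, tsum_mul_left]

theorem normA_add_le (hr : 0 < r) (ha : MemA ρ r a) (hb : MemA ρ r b) :
    normA ρ r (a + b) ≤ normA ρ r a + normA ρ r b := by
  rw [normA, normA, normA, ← Summable.tsum_add ha hb]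
  refine Summable.tsum_le_tsum (fun i => ?_) (MemA.add hr ha hb) (Summable.add ha hb)
  rw [← add_mul]
  exact mul_le_mul_of_nonneg_right (norm_add_le _ _) (weight_pos ρ hr i).le

theorem eq_zero_of_normA (hr : 0 < r) (ha : MemA ρ r a) (h : normA ρ r a = 0) : a = 0 := by
  have hs : HasSum (fun i => ‖a i‖ * weight ρ r i) 0 := by
    have := ha.hasSum
    rwa [show ∑' i, ‖a i‖ * weight ρ r i = 0 from h] at this
  have h0 := (hasSum_zero_iff_of_nonneg
    (fun i => mul_nonneg (norm_nonneg (a i)) (weight_pos ρ hr i).le)).1 hs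
  funext i
  have := congrFun h0 i
  simpa [(weight_pos ρ hr i).ne'] using this

theorem coeffDx_add (j : Fin d) : coeffDx j (a + b) = coeffDx j a + coeffDx j b := by
  funext i; simp [coeffDx, mul_add]

theorem coeffDy_add (j : Fin d) : coeffDy j (a + b) = coeffDy j a + coeffDy j b := by
  funext i; simp [coeffDy, mul_add]

theorem coeffDx_smul (j : Fin d) (z : ℂ) : coeffDx j (z • a) = z • coeffDx j a := by
  funext i; simp [coeffDx]; ring

theorem coeffDy_smul (j : Fin d) (z : ℂ) : coeffDy j (z • a) = z • coeffDy j a := by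
  funext i; simp [coeffDy]; ring

theorem MemA.of_finite (h : (Function.support a).Finite) : MemA ρ r a := by
  refine summable_of_hasFiniteSupport (h.subset fun i hi => ?_)
  simp only [Function.mem_support] at hi ⊢
  exact fun h0 => hi (by simp [h0])

theorem MemC1.of_finite (h : (Function.support a).Finite) : MemC1 ρ r a := by
  refine ⟨MemA.of_finite h, fun j => MemA.of_finite (h.subset fun i hi => ?_),
    fun j => MemA.of_finite ?_⟩
  · simp only [Function.mem_support, coeffDx] at hi ⊢
    exact fun h0 => hi (by simp [h0])
  · have hinj : Function.Injective
        (fun i : Idx d => ((i.1, i.2 + Pi.single j 1) : Idx d)) := by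
      intro i i2 h2
      simp only [Prod.mk.injEq, add_left_inj] at h2
      exact Prod.ext h2.1 h2.2
    refine (h.preimage hinj.injOn).subset fun i hi => ?_
    simp only [Function.mem_support, coeffDy, Set.mem_preimage] at hi ⊢
    exact fun h0 => hi (by simp [h0])

theorem normC1_add_le (hr : 0 < r) (ha : MemC1 ρ r a) (hb : MemC1 ρ r b) :
    normC1 ρ r (a + b) ≤ normC1 ρ r a + normC1 ρ r b := by
  have h1 := normA_add_le hr ha.1 hb.1
  have h2 : ∑ j, normA ρ r (coeffDx j (a + b)) ≤
      ∑ j, normA ρ r (coeffDx j a) + ∑ j, normA ρ r (coeffDx j b) := by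
    rw [← Finset.sum_add_distrib]
    refine Finset.sum_le_sum fun j _ => ?_
    rw [coeffDx_add]
    exact normA_add_le hr (ha.2.1 j) (hb.2.1 j)
  have h3 : ∑ j, normA ρ r (coeffDy j (a + b)) ≤
      ∑ j, normA ρ r (coeffDy j a) + ∑ j, normA ρ r (coeffDy j b) := by
    rw [← Finset.sum_add_distrib]
    refine Finset.sum_le_sum fun j _ => ?_
    rw [coeffDy_add]
    exact normA_add_le hr (ha.2.2 j) (hb.2.2 j)
  simp only [normC1, normGrad]
  linarith

theorem normGrad_nonneg (hr : 0 < r) : 0 ≤ normGrad ρ r a :=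
  add_nonneg (Finset.sum_nonneg fun _ _ => normA_nonneg hr)
    (Finset.sum_nonneg fun _ _ => normA_nonneg hr)

theorem normC1_smul (z : ℂ) : normC1 ρ r (z • a) = ‖z‖ * normC1 ρ r a := by
  simp only [normC1, normGrad, coeffDx_smul, coeffDy_smul, normA_smul, ← Finset.mul_sum,
    ← mul_add]

end Lemmas

/-- The coefficient families of finite norm. -/
def submoduleA (d : ℕ) (ρ r : ℝ) (hr : 0 < r) : Submodule ℂ (Idx d → ℂ) where
  carrier := {c | MemA ρ r c}
  add_mem' ha hb := MemA.add hr ha hb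
  zero_mem' := MemA.zero
  smul_mem' z _ ha := MemA.smul z ha

/-- The coefficient families of finite primed norm. -/
def submoduleC1 (d : ℕ) (ρ r : ℝ) (hr : 0 < r) : Submodule ℂ (Idx d → ℂ) where
  carrier := {c | MemC1 ρ r c}
  add_mem' ha hb := ⟨ha.1.add hr hb.1,
    fun j => coeffDx_add (d := d) j ▸ (ha.2.1 j).add hr (hb.2.1 j),
    fun j => coeffDy_add (d := d) j ▸ (ha.2.2 j).add hr (hb.2.2 j)⟩
  zero_mem' := MemC1.of_finite (by simp)
  smul_mem' z _ ha := ⟨ha.1.smul z,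
    fun j => coeffDx_smul (d := d) j z ▸ (ha.2.1 j).smul z,
    fun j => coeffDy_smul (d := d) j z ▸ (ha.2.2 j).smul z⟩

/-- The Banach space `𝒜_{ρ,r}`. A Hamiltonian is represented by its Taylor-Fourier
coefficients; the function on `𝒟_{ρ,r}` is `Ham.eval`. -/
def Ham (d : ℕ) (ρ r : ℝ) (hr : 0 < r) : Type := submoduleA d ρ r hr

/-- The Banach space `𝒜'_{ρ,r}` of Hamiltonians with finite norm
`‖H‖' = ‖H‖ + ‖∇H‖`. -/
def HamC1 (d : ℕ) (ρ r : ℝ) (hr : 0 < r) : Type := submoduleC1 d ρ r hr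

section Instances

variable {d : ℕ} {ρ r : ℝ} {hr : 0 < r}

instance : AddCommGroup (Ham d ρ r hr) := inferInstanceAs (AddCommGroup (submoduleA d ρ r hr))
instance : Module ℂ (Ham d ρ r hr) := inferInstanceAs (Module ℂ (submoduleA d ρ r hr))
instance : AddCommGroup (HamC1 d ρ r hr) :=
  inferInstanceAs (AddCommGroup (submoduleC1 d ρ r hr))
instance : Module ℂ (HamC1 d ρ r hr) := inferInstanceAs (Module ℂ (submoduleC1 d ρ r hr))

/-- The Taylor-Fourier coefficients `H_{k,ν}`. -/
def Ham.coeff (H : Ham d ρ r hr) : Idx d → ℂ := Subtype.val H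

/-- The Taylor-Fourier coefficients `H_{k,ν}`. -/
def HamC1.coeff (H : HamC1 d ρ r hr) : Idx d → ℂ := Subtype.val H

/-- The Hamiltonian as a function. -/
noncomputable def Ham.eval (H : Ham d ρ r hr) (p : Phase d) : ℂ := evalTF H.coeff p

/-- The Hamiltonian as a function. -/
noncomputable def HamC1.eval (H : HamC1 d ρ r hr) (p : Phase d) : ℂ := evalTF H.coeff p

noncomputable instance : Norm (Ham d ρ r hr) := ⟨fun H => normA ρ r H.coeff⟩
noncomputable instance : Norm (HamC1 d ρ r hr) := ⟨fun H => normC1 ρ r H.coeff⟩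

theorem Ham.core (d : ℕ) (ρ r : ℝ) (hr : 0 < r) : NormedSpace.Core ℂ (Ham d ρ r hr) where
  norm_nonneg _ := normA_nonneg hr
  norm_smul z _ := normA_smul z
  norm_triangle x y := normA_add_le hr x.2 y.2
  norm_eq_zero_iff x := by
    constructor
    · exact fun h => Subtype.ext (eq_zero_of_normA hr x.2 h)
    · rintro rfl
      have : normA ρ r (0 : Idx d → ℂ) = 0 := by simp [normA]
      exact this

theorem HamC1.core (d : ℕ) (ρ r : ℝ) (hr : 0 < r) :
    NormedSpace.Core ℂ (HamC1 d ρ r hr) where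
  norm_nonneg _ := add_nonneg (normA_nonneg hr) (normGrad_nonneg hr)
  norm_smul z _ := normC1_smul z
  norm_triangle x y := normC1_add_le hr x.2 y.2
  norm_eq_zero_iff x := by
    constructor
    · intro h
      have h1 : 0 ≤ normA ρ r x.coeff := normA_nonneg hr
      have h2 : 0 ≤ normGrad ρ r x.coeff := normGrad_nonneg hr
      have h3 : normA ρ r x.coeff + normGrad ρ r x.coeff = 0 := h
      have h4 : normA ρ r x.coeff = 0 := by linarith
      exact Subtype.ext (eq_zero_of_normA hr x.2.1 h4)
    · rintro rfl
      have : normC1 ρ r (0 : Idx d → ℂ) = 0 := by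
        simpa using normC1_smul (ρ := ρ) (r := r) (a := (0 : Idx d → ℂ)) 0
      exact this

noncomputable instance : NormedAddCommGroup (Ham d ρ r hr) :=
  NormedAddCommGroup.ofCore (Ham.core d ρ r hr)
noncomputable instance : NormedSpace ℂ (Ham d ρ r hr) :=
  NormedSpace.ofCore (Ham.core d ρ r hr)
noncomputable instance : NormedAddCommGroup (HamC1 d ρ r hr) :=
  NormedAddCommGroup.ofCore (HamC1.core d ρ r hr)
noncomputable instance : NormedSpace ℂ (HamC1 d ρ r hr) :=
  NormedSpace.ofCore (HamC1.core d ρ r hr)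

end Instances

/-- The Banach space `𝒜_{ρ,r}²ᵈ`, with the norm `∑ ‖u_j‖`. The component `Sum.inl j` belongs
to `x_j` and the component `Sum.inr j` to `y_j`. -/
abbrev HamVec (d : ℕ) (ρ r : ℝ) (hr : 0 < r) : Type :=
  PiLp 1 (fun _ : Fin d ⊕ Fin d => Ham d ρ r hr)

/-- The map `g = id + u`. -/
noncomputable def idPlus {d : ℕ} {ρ r : ℝ} {hr : 0 < r} (u : HamVec d ρ r hr)
    (p : Phase d) : Phase d :=
  (fun j => p.1 j + (u (Sum.inl j)).eval p, fun j => p.2 j + (u (Sum.inr j)).eval p)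

/-- The far from resonance modes `I⁻` with respect to `ω`: those `(k, ν)` with
`|ω · k| > σ ‖k‖` and `‖ν‖ < τ ‖k‖`. -/
def farModes {d : ℕ} (ω : Fin d → ℝ) (σ τ : ℝ) : Set (Idx d) :=
  {i | σ * kNorm i.1 < |∑ j, ω j * (i.1 j : ℝ)| ∧ (deg i.2 : ℝ) < τ * kNorm i.1}

/-- The projection `𝕀⁻` onto the far from resonance modes. -/
noncomputable def projFar {d : ℕ} (ω : Fin d → ℝ) (σ τ : ℝ) (c : Idx d → ℂ) : Idx d → ℂ :=
  (farModes ω σ τ).indicator c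

/-- The Taylor-Fourier coefficients of `ω · y + (1/2) yᵀ Q y`. -/
noncomputable def h0Coeff {d : ℕ} (ω : Fin d → ℝ) (Q : Matrix (Fin d) (Fin d) ℂ) :
    Idx d → ℂ :=
  ∑ j, Pi.single ((0, Pi.single j 1) : Idx d) (ω j : ℂ) +
    ∑ i, ∑ j, Pi.single ((0, Pi.single i 1 + Pi.single j 1) : Idx d) ((1 / 2 : ℂ) * Q i j)

theorem h0Coeff_support {d : ℕ} (ω : Fin d → ℝ) (Q : Matrix (Fin d) (Fin d) ℂ) :
    (Function.support (h0Coeff ω Q)).Finite := by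
  have hs : ∀ (i : Idx d) (z : ℂ), (Function.support (Pi.single i z : Idx d → ℂ)).Finite :=
    fun i z => (Set.finite_singleton i).subset (Pi.support_single_subset)
  have hsum : ∀ (f : Fin d → Idx d → ℂ), (∀ j, (Function.support (f j)).Finite) →
      (Function.support (∑ j, f j)).Finite := by
    intro f hf
    refine (Set.finite_iUnion hf).subset fun i hi => ?_
    rw [Function.mem_support, Finset.sum_apply] at hi
    obtain ⟨j, -, hj⟩ := Finset.exists_ne_zero_of_sum_ne_zero hi
    exact Set.mem_iUnion.2 ⟨j, hj⟩
  refine Set.Finite.subset ((hsum _ fun j => hs _ _).union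
    (hsum _ fun i => hsum _ fun j => hs _ _)) (Function.support_add _ _)

/-- The integrable Hamiltonian `H⁰(x, y) = ω · y + (1/2) yᵀ Q y`, as an element of `𝒜'_{ρ,r}`. -/
noncomputable def h0 {d : ℕ} (ρ r : ℝ) (hr : 0 < r) (ω : Fin d → ℝ)
    (Q : Matrix (Fin d) (Fin d) ℂ) : HamC1 d ρ r hr :=
  (⟨h0Coeff ω Q, MemC1.of_finite (h0Coeff_support ω Q)⟩ : submoduleC1 d ρ r hr)

theorem evalTF_add_of_finite {d : ℕ} {a b : Idx d → ℂ} (ha : (Function.support a).Finite)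
    (hb : (Function.support b).Finite) (p : Phase d) :
    evalTF (a + b) p = evalTF a p + evalTF b p := by
  have hs : ∀ {c : Idx d → ℂ}, (Function.support c).Finite →
      Summable (fun i : Idx d => c i * (∏ j, p.2 j ^ i.2 j) *
        Complex.exp (2 * (Real.pi : ℂ) * Complex.I * ∑ j, (i.1 j : ℂ) * p.1 j)) :=
    fun hc => summable_of_hasFiniteSupport (hc.subset fun i hi => by
      simp only [Function.mem_support] at hi ⊢
      exact fun h0 => hi (by simp [h0]))
  rw [evalTF, evalTF, evalTF, ← Summable.tsum_add (hs ha) (hs hb)]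
  exact tsum_congr fun i => by simp only [Pi.add_apply]; ring

theorem evalTF_single {d : ℕ} (i : Idx d) (z : ℂ) (p : Phase d) :
    evalTF (Pi.single i z) p = z * (∏ j, p.2 j ^ i.2 j) *
      Complex.exp (2 * (Real.pi : ℂ) * Complex.I * ∑ j, (i.1 j : ℂ) * p.1 j) := by
  rw [evalTF, tsum_eq_single i (fun i2 h => by simp [h])]
  simp

theorem evalTF_sum {d : ℕ} (f : Fin d → Idx d → ℂ)
    (hf : ∀ j, (Function.support (f j)).Finite) (p : Phase d) (s : Finset (Fin d)) :
    (Function.support (∑ j ∈ s, f j)).Finite ∧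
      evalTF (∑ j ∈ s, f j) p = ∑ j ∈ s, evalTF (f j) p := by
  classical
  induction s using Finset.induction_on with
  | empty => simp [evalTF]
  | insert a s ha ih =>
    rw [Finset.sum_insert ha, Finset.sum_insert ha, evalTF_add_of_finite (hf a) ih.1, ih.2]
    exact ⟨((hf a).union ih.1).subset (Function.support_add _ _), rfl⟩

/-- `h0` is the function `ω · y + (1/2) yᵀ Q y`. -/
theorem h0_eval {d : ℕ} (ρ r : ℝ) (hr : 0 < r) (ω : Fin d → ℝ)
    (Q : Matrix (Fin d) (Fin d) ℂ) (p : Phase d) :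
    (h0 ρ r hr ω Q).eval p =
      ∑ j, (ω j : ℂ) * p.2 j + (1 / 2 : ℂ) * ∑ i, ∑ j, p.2 i * Q i j * p.2 j := by
  have hs : ∀ (i : Idx d) (z : ℂ), (Function.support (Pi.single i z : Idx d → ℂ)).Finite :=
    fun i z => (Set.finite_singleton i).subset (Pi.support_single_subset)
  have hp : ∀ j : Fin d, ∏ l, p.2 l ^ (Pi.single j 1 : Fin d → ℕ) l = p.2 j := fun j => by
    rw [Finset.prod_eq_single j] <;> simp +contextual
  change evalTF (h0Coeff ω Q) p = _
  have h1 := evalTF_sum (fun j => Pi.single ((0, Pi.single j 1) : Idx d) (ω j : ℂ))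
    (fun j => hs _ _) p Finset.univ
  have h2 := fun i => evalTF_sum (fun j => Pi.single
    ((0, Pi.single i 1 + Pi.single j 1) : Idx d) ((1 / 2 : ℂ) * Q i j))
    (fun j => hs _ _) p Finset.univ
  have h3 := evalTF_sum (fun i => ∑ j, Pi.single
    ((0, Pi.single i 1 + Pi.single j 1) : Idx d) ((1 / 2 : ℂ) * Q i j))
    (fun i => (h2 i).1) p Finset.univ
  rw [h0Coeff, evalTF_add_of_finite h1.1 h3.1, h1.2, h3.2]
  simp only [(h2 _).2, evalTF_single, Pi.zero_apply, Int.cast_zero, zero_mul,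
    Finset.sum_const_zero, mul_zero, Complex.exp_zero, mul_one, hp, Pi.add_apply, pow_add,
    Finset.prod_mul_distrib, Finset.mul_sum]
  congr 1
  exact Finset.sum_congr rfl fun i _ => Finset.sum_congr rfl fun j _ => by ring

/-- The matrix norm `‖Q‖ = max_j ∑_i |Q_{i,j}|`. -/
noncomputable def matNorm {d : ℕ} (Q : Matrix (Fin d) (Fin d) ℂ) : ℝ := ⨆ j, ∑ i, ‖Q i j‖

/-- The radius
`σ² min{1, ν/2π, r'-r}² / (48 ‖H⁰‖_{r'} (2π+1)² (1 + 2π + (τ+1)/r')²)`.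
The norm of `H⁰`, which has no modes with `k ≠ 0`, does not depend on `ρ`; it is taken at
`ρ = 0`. -/
noncomputable def epsRadius {d : ℕ} (ω : Fin d → ℝ) (Q : Matrix (Fin d) (Fin d) ℂ)
    (σ τ ν r r' : ℝ) : ℝ :=
  σ ^ 2 * (min 1 (min (ν / (2 * Real.pi)) (r' - r))) ^ 2 /
    (48 * normA 0 r' (h0Coeff ω Q) * (2 * Real.pi + 1) ^ 2 *
      (1 + 2 * Real.pi + (τ + 1) / r') ^ 2)

/-- The canonical (complex) symplectic form `∑ dy_i ∧ dx_i` on `ℂ²ᵈ`. -/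
def sympForm {d : ℕ} (v w : Phase d) : ℂ := ∑ j, (v.2 j * w.1 j - v.1 j * w.2 j)

/-- `g` is an analytic symplectomorphism from the open set `D` onto its image, which lies in
`E`. (Since `g` is injective and its derivative, preserving the symplectic form, is invertible,
the image is open and the inverse is analytic.) -/
def IsAnalyticSymplecto {d : ℕ} (g : Phase d → Phase d) (D E : Set (Phase d)) : Prop :=
  AnalyticOnNhd ℂ g D ∧ MapsTo g D E ∧ InjOn g D ∧
    ∀ p ∈ D, ∀ v w : Phase d,
      sympForm (fderiv ℂ g p v) (fderiv ℂ g p w) = sympForm v w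

/-- Analyticity of maps between complex Banach spaces on an open set `V`: locally bounded and
Gateaux differentiable at every point of `V`. -/
def IsAnalyticMapOn {E F : Type*} [NormedAddCommGroup E] [NormedSpace ℂ E]
    [NormedAddCommGroup F] [NormedSpace ℂ F] (f : E → F) (V : Set E) : Prop :=
  (∀ x ∈ V, ∃ C : ℝ, ∀ᶠ y in 𝓝 x, ‖f y‖ ≤ C) ∧
    ∀ x ∈ V, ∀ h : E, DifferentiableAt ℂ (fun z : ℂ => f (x + z • h)) 0

/-- The point of `ℂ²ᵈ` with real coordinates `(x, y)`. -/
def realPoint {d : ℕ} (x y : Fin d → ℝ) : Phase d := (fun j => (x j : ℂ), fun j => (y j : ℂ))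

/-- `H` takes real values at the real points of its domain. -/
def HamC1.IsReal {d : ℕ} {ρ r : ℝ} {hr : 0 < r} (H : HamC1 d ρ r hr) : Prop :=
  ∀ x y : Fin d → ℝ, realPoint x y ∈ dom d ρ r → (H.eval (realPoint x y)).im = 0

end TFHam

open TFHam

/-! The transformation g is the limit of compositions of symplectic maps. Each of them removes the
far modes to leading order, on domains that shrink geometrically.

One step. Let K be the current Hamiltonian and let G have far modes only. The generating function
x·Y + G(x,Y) defines the map (x,y) ↦ (x + ∂_yG(x,y+w), y+w), where w solves w = -∂_xG(x,y+w); it is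
symplectic (`genStep`, `isSympAt_genStep`). Because H⁰ is a quadratic polynomial in y, it changes by
exactly (ω+Qy)·w + ½ w·Qw, and w = -∂_xG up to second order. Hence the far modes disappear to first
order if 𝕀⁻((ω+Qy)·∂_xG) = 𝕀⁻K. On far modes there are no small divisors: |ω·k| > σ‖k‖ pays for a
derivative in x and ‖ν‖ < τ‖k‖ for a derivative in y, so the gradient of G is bounded by 𝕀⁻K without
loss of domain (`normGrad_genCoeff_le`). The term Qy·∂_x is a perturbation of relative size r‖Q‖/σ ≤
1/2 and is absorbed by inverting 1 + `quadOp` (`farL_homological`, `norm_solveL_le`).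

Convergence. After one step the far part consists of terms quadratic in the old far part and of a
product D·S, where D bounds the gradient of K - H⁰ and S the displacement (`elimStep_estimate`). The
product is only linear in the far part, since the other modes of the perturbation are not removed;
the radius ε makes its coefficient small instead. Altogether the far part shrinks by the factor 8 in
each step while the room between the domains is halved (`ElimData.Small.estimate`), so that all
displacements are summable and D stays bounded (`ElimData.Small.inv`). The iteration spends half of
the room min{1, ν/2π, r'-r}. The other half yields, by Cauchy's estimate, the primed norm of g - id
and a small derivative, hence injectivity.

Composition. 𝒜 is a weighted ℓ¹ space with submultiplicative weights, hence a Banach algebra, and a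
Taylor-Fourier series composed with id + u is a convergent series in that algebra. Its norm is
bounded by the norm on a larger domain (`norm_comp_le`), it is Lipschitz in u with the gradient norm
as constant (`norm_comp_sub_le`), and it depends holomorphically on both arguments
(`differentiableOn_comp`). Identities are checked by evaluating at points, because the values
determine the coefficients (`coeff_eq_zero_of_evalTF_real`). Along complex lines every stage of the
construction is holomorphic and the limits are uniform, which gives the analyticity of 𝔊 and 𝒰.

Reality. The matrix Q may be complex, and then the iteration need not preserve reality. If the ball
contains a real Hamiltonian, Re Q can replace Q in the iteration at the price of a factor 2 in the
distance (`exists_quadraticPart`). Finally, if there are no far modes then g = id works, and if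
there is one then σ < ‖ω‖, which the estimates need. -/

namespace TFHam

/-! ### Modes, their bounds and the evaluation of series. -/

/-- The Taylor-Fourier mode `y ^ ν exp (2 π i k · x)`. -/
noncomputable def mode {d : ℕ} (i : Idx d) (p : Phase d) : ℂ :=
  (∏ j, p.2 j ^ i.2 j) *
    Complex.exp (2 * (Real.pi : ℂ) * Complex.I * ∑ j, (i.1 j : ℂ) * p.1 j)

/-- The polydomain `{|Im x_j| ≤ ρ / 2π, |y_j| ≤ r}`, which contains `𝒟_{ρ,r}`. -/
def polydom (d : ℕ) (ρ r : ℝ) : Set (Phase d) :=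
  {p | ∀ j, |(p.1 j).im| ≤ ρ / (2 * Real.pi) ∧ ‖p.2 j‖ ≤ r}

section Eval

variable {d : ℕ} {ρ r : ℝ}

theorem dom_subset_polydom (ρ r : ℝ) : dom d ρ r ⊆ polydom d ρ r := by
  rintro p ⟨h1, h2⟩ j
  exact ⟨(Finset.single_le_sum (f := fun j => |(p.1 j).im|) (fun _ _ => abs_nonneg _)
      (Finset.mem_univ j)).trans h1.le,
    (Finset.single_le_sum (f := fun j => ‖p.2 j‖) (fun _ _ => norm_nonneg _)
      (Finset.mem_univ j)).trans h2.le⟩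

theorem kNorm_nonneg (k : Fin d → ℤ) : 0 ≤ kNorm k :=
  Finset.sum_nonneg fun _ _ => abs_nonneg _

theorem kNorm_add_le (k l : Fin d → ℤ) : kNorm (k + l) ≤ kNorm k + kNorm l := by
  rw [kNorm, kNorm, kNorm, ← Finset.sum_add_distrib]
  refine Finset.sum_le_sum fun j _ => ?_
  simpa using abs_add_le (k j : ℝ) (l j)

theorem deg_add (a b : Fin d → ℕ) : deg (a + b) = deg a + deg b := by
  simp [deg, Finset.sum_add_distrib]

/-- The weight contains the sums ‖k‖ and ‖ν‖, so bounds for the single coordinates of Im x and y are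
enough. This is why the whole analysis can be done on the polydomain, which is larger than 𝒟. -/
theorem norm_mode_le (hr : 0 ≤ r) {p : Phase d} (hp : p ∈ polydom d ρ r) (i : Idx d) :
    ‖mode i p‖ ≤ weight ρ r i := by
  rw [mode, weight, norm_mul, Complex.norm_exp]
  refine mul_le_mul ?_ ?_ (Real.exp_pos _).le ?_
  · rw [norm_prod, deg, ← Finset.prod_pow_eq_pow_sum]
    refine Finset.prod_le_prod (fun _ _ => norm_nonneg _) fun j _ => ?_
    rw [norm_pow]
    exact pow_le_pow_left₀ (norm_nonneg _) (hp j).2 _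
  · refine Real.exp_le_exp.2 ?_
    have : (2 * (Real.pi : ℂ) * Complex.I * ∑ j, (i.1 j : ℂ) * p.1 j).re =
        ∑ j, -(2 * Real.pi) * ((i.1 j : ℝ) * (p.1 j).im) := by
      simp [Complex.mul_re, Complex.mul_im, Finset.mul_sum]
    rw [this, kNorm, Finset.mul_sum]
    refine Finset.sum_le_sum fun j _ => ?_
    have h2 := (hp j).1
    rw [le_div_iff₀ (by positivity)] at h2
    have h3 : |(i.1 j : ℝ) * (p.1 j).im| ≤ |(i.1 j : ℝ)| * |(p.1 j).im| := (abs_mul _ _).le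
    have h4 := neg_abs_le ((i.1 j : ℝ) * (p.1 j).im)
    have h5 := mul_le_mul_of_nonneg_left h2 (abs_nonneg (i.1 j : ℝ))
    nlinarith [Real.pi_pos, abs_nonneg (i.1 j : ℝ), abs_nonneg (p.1 j).im]
  · exact pow_nonneg hr _

theorem evalTF_eq (c : Idx d → ℂ) (p : Phase d) : evalTF c p = ∑' i, c i * mode i p := by
  simp only [evalTF, mode, mul_assoc]

theorem MemA.summable_mode (hr : 0 ≤ r) {c : Idx d → ℂ} (hc : MemA ρ r c) {p : Phase d}
    (hp : p ∈ polydom d ρ r) : Summable fun i => ‖c i * mode i p‖ := by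
  refine Summable.of_nonneg_of_le (fun _ => norm_nonneg _) (fun i => ?_) hc
  rw [norm_mul]
  exact mul_le_mul_of_nonneg_left (norm_mode_le hr hp i) (norm_nonneg _)

theorem norm_evalTF_le (hr : 0 ≤ r) {c : Idx d → ℂ} (hc : MemA ρ r c) {p : Phase d}
    (hp : p ∈ polydom d ρ r) : ‖evalTF c p‖ ≤ normA ρ r c := by
  rw [evalTF_eq]
  refine (norm_tsum_le_tsum_norm (hc.summable_mode hr hp)).trans ?_
  refine (hc.summable_mode hr hp).tsum_le_tsum (fun i => ?_) hc
  rw [norm_mul]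
  exact mul_le_mul_of_nonneg_left (norm_mode_le hr hp i) (norm_nonneg _)

theorem evalTF_add (hr : 0 ≤ r) {a b : Idx d → ℂ} (ha : MemA ρ r a) (hb : MemA ρ r b)
    {p : Phase d} (hp : p ∈ polydom d ρ r) : evalTF (a + b) p = evalTF a p + evalTF b p := by
  rw [evalTF_eq, evalTF_eq, evalTF_eq,
    ← (ha.summable_mode hr hp).of_norm.tsum_add (hb.summable_mode hr hp).of_norm]
  exact tsum_congr fun i => by simp [add_mul]

theorem evalTF_smul (z : ℂ) (a : Idx d → ℂ) (p : Phase d) :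
    evalTF (z • a) p = z * evalTF a p := by
  rw [evalTF_eq, evalTF_eq, ← tsum_mul_left]
  exact tsum_congr fun i => by simp [mul_assoc]

theorem mode_add (i j : Idx d) (p : Phase d) : mode (i + j) p = mode i p * mode j p := by
  have h : ∀ a b x y : ℂ, a * b * (x * y) = a * x * (b * y) := fun a b x y => by ring
  simp only [mode, Prod.snd_add, Pi.add_apply, pow_add, Finset.prod_mul_distrib, Prod.fst_add,
    Int.cast_add, add_mul, Finset.sum_add_distrib, mul_add, Complex.exp_add]
  exact h _ _ _ _

/-- Submultiplicativity of the weights is what turns the norm into an algebra norm. It is the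
triangle inequality for ‖k‖, hence the sign condition on ρ. -/
theorem weight_add_le (hρ : 0 ≤ ρ) (hr : 0 ≤ r) (i j : Idx d) :
    weight ρ r (i + j) ≤ weight ρ r i * weight ρ r j := by
  rw [weight, weight, weight, mul_mul_mul_comm, ← pow_add, ← Real.exp_add, Prod.snd_add, deg_add]
  refine mul_le_mul_of_nonneg_left (Real.exp_le_exp.2 ?_) (pow_nonneg hr _)
  rw [← mul_add]
  exact mul_le_mul_of_nonneg_left (kNorm_add_le _ _) hρ

end Eval

/-! ### Uniqueness of Taylor-Fourier coefficients. -/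

section Uniqueness

theorem powerSeries_coeff_eq_zero {s : ℝ} (hs : 0 < s) {b : ℕ → ℂ}
    (hb : Summable fun n => ‖b n‖ * s ^ n)
    (h : ∀ y : ℝ, |y| ≤ s → ∑' n, b n * (y : ℂ) ^ n = 0) : b = 0 := by
  let p : FormalMultilinearSeries ℝ ℝ ℂ := fun n => ContinuousMultilinearMap.mkPiRing ℝ (Fin n) (b n)
  have hp : HasFPowerSeriesAt (0 : ℝ → ℂ) p 0 := by
    rw [hasFPowerSeriesAt_iff]
    filter_upwards [Metric.ball_mem_nhds (0 : ℝ) hs] with y hy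
    have hy' : |y| ≤ s := by simpa using (Metric.mem_ball.1 hy).le
    have hsum : Summable fun n => b n * (y : ℂ) ^ n := by
      refine Summable.of_norm (Summable.of_nonneg_of_le (fun _ => norm_nonneg _) (fun n => ?_) hb)
      rw [norm_mul, norm_pow, Complex.norm_real]
      exact mul_le_mul_of_nonneg_left (pow_le_pow_left₀ (norm_nonneg _) hy' _) (norm_nonneg _)
    have h2 := hsum.hasSum
    rw [h y hy'] at h2
    refine h2.congr_fun ?_
    intro n
    simp [p, FormalMultilinearSeries.coeff, mul_comm]
  have h0 := hp.eq_zero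
  funext n
  have := congrArg (fun q => FormalMultilinearSeries.coeff q n) h0
  simpa [p, FormalMultilinearSeries.coeff] using this

/-- Induction on the number of variables: with the last d variables fixed, the series is a power
series in the first one, whose coefficients are series in d variables and vanish by the one-variable
case. -/
theorem taylor_coeff_eq_zero {s : ℝ} (hs : 0 < s) : ∀ (d : ℕ) (c : (Fin d → ℕ) → ℂ),
    (Summable fun ν => ‖c ν‖ * s ^ deg ν) →
    (∀ y : Fin d → ℝ, (∀ j, |y j| ≤ s) → ∑' ν, c ν * ∏ j, (y j : ℂ) ^ ν j = 0) → c = 0 := by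
  intro d
  induction d with
  | zero =>
    intro c _ h
    have := h 0 (fun j => j.elim0)
    funext ν
    rw [tsum_eq_single ν (fun ν' hν' => absurd (Subsingleton.elim _ _) hν')] at this
    simpa using this
  | succ d ih =>
    intro c hc h
    let e : ℕ × (Fin d → ℕ) ≃ (Fin (d + 1) → ℕ) := Fin.consEquiv (fun _ => ℕ)
    have hdeg : ∀ q : ℕ × (Fin d → ℕ), deg (e q) = q.1 + deg q.2 := fun q => by
      simp [e, deg, Fin.sum_univ_succ, Fin.consEquiv]
    have hc2 : Summable fun q : ℕ × (Fin d → ℕ) => ‖c (e q)‖ * s ^ (q.1 + deg q.2) := by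
      have := (e.summable_iff).2 hc
      refine this.congr fun q => ?_
      simp [hdeg]
    have hc3 : ∀ y : Fin d → ℝ, (∀ j, |y j| ≤ s) → ∀ q : ℕ × (Fin d → ℕ),
        ‖c (e q) * ∏ j, (y j : ℂ) ^ q.2 j‖ * s ^ q.1 ≤ ‖c (e q)‖ * s ^ (q.1 + deg q.2) := by
      intro y hy q
      rw [norm_mul, norm_prod, pow_add, mul_assoc]
      refine mul_le_mul_of_nonneg_left ?_ (norm_nonneg _)
      rw [mul_comm]
      refine mul_le_mul_of_nonneg_left ?_ (by positivity)
      rw [deg, ← Finset.prod_pow_eq_pow_sum]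
      refine Finset.prod_le_prod (fun _ _ => norm_nonneg _) fun j _ => ?_
      rw [norm_pow, Complex.norm_real]
      exact pow_le_pow_left₀ (norm_nonneg _) (hy j) _
    have key : ∀ n, (fun ν => c (e (n, ν))) = 0 := by
      intro n
      refine ih _ ?_ ?_
      · have := (hc2.prod_factor n).mul_left (s ^ n)⁻¹
        refine this.congr fun ν => ?_
        rw [pow_add]
        field_simp
      · intro y hy
        have hS : Summable fun q : ℕ × (Fin d → ℕ) =>
            ‖c (e q) * ∏ j, (y j : ℂ) ^ q.2 j‖ * s ^ q.1 :=
          Summable.of_nonneg_of_le (fun _ => by positivity) (hc3 y hy) hc2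
        have hin : ∀ m, Summable fun ν => ‖c (e (m, ν)) * ∏ j, (y j : ℂ) ^ ν j‖ := fun m => by
          have := (hS.prod_factor m).mul_left (s ^ m)⁻¹
          refine this.congr fun ν => ?_
          field_simp
        have := powerSeries_coeff_eq_zero hs
          (b := fun m => ∑' ν, c (e (m, ν)) * ∏ j, (y j : ℂ) ^ ν j) ?_ ?_
        · exact congrFun this n
        · refine Summable.of_nonneg_of_le (fun _ => by positivity) (fun m => ?_) hS.prod
          simp only [tsum_mul_right]
          exact mul_le_mul_of_nonneg_right (norm_tsum_le_tsum_norm (hin m)) (by positivity)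
        · intro y0 hy0
          have h1 := h (Fin.cons y0 y) (fun j => by
            refine Fin.cases ?_ (fun j => ?_) j <;> simp [hy0, hy])
          rw [← e.tsum_eq] at h1
          have hterm : ∀ q : ℕ × (Fin d → ℕ),
              c (e q) * ∏ j, (((Fin.cons y0 y : Fin (d + 1) → ℝ) j : ℝ) : ℂ) ^ (e q) j =
              (c (e q) * ∏ j, (y j : ℂ) ^ q.2 j) * (y0 : ℂ) ^ q.1 := fun q => by
            simp [e, Fin.prod_univ_succ, Fin.consEquiv]
            ring
          rw [tsum_congr hterm, Summable.tsum_prod] at h1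
          · rw [← h1]
            exact tsum_congr fun m => tsum_mul_right.symm
          · refine Summable.of_norm (Summable.of_nonneg_of_le (fun _ => norm_nonneg _)
              (fun q => ?_) hS)
            rw [norm_mul, norm_pow, Complex.norm_real]
            exact mul_le_mul_of_nonneg_left (pow_le_pow_left₀ (norm_nonneg _) hy0 _)
              (norm_nonneg _)
    funext ν
    obtain ⟨q, rfl⟩ := e.surjective ν
    exact congrFun (key q.1) q.2

/-- The series converges uniformly to zero on the torus, hence also in L², and pairing it with a
character isolates one coefficient. -/
theorem fourier_coeff_eq_zero {d : ℕ} {a : (Fin d → ℤ) → ℂ} (ha : Summable fun k => ‖a k‖)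
    (h : ∀ x : Fin d → ℝ, ∑' k, a k *
      Complex.exp (2 * (Real.pi : ℂ) * Complex.I * ∑ j, (k j : ℂ) * (x j : ℂ)) = 0) : a = 0 := by
  have hs : Summable fun k : Fin d → ℤ => a k • UnitAddTorus.mFourier k :=
    Summable.of_norm (by simpa [norm_smul, UnitAddTorus.mFourier_norm] using ha)
  have h0 : ∑' k : Fin d → ℤ, a k • UnitAddTorus.mFourier k = 0 := by
    ext x
    obtain ⟨y, rfl⟩ : ∃ y : Fin d → ℝ, (fun j => (y j : UnitAddCircle)) = x :=
      ⟨fun j => Quotient.out (x j), funext fun j => QuotientAddGroup.out_eq' (x j)⟩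
    rw [← (ContinuousMap.hasSum_apply hs.hasSum _).tsum_eq]
    rw [ContinuousMap.zero_apply, ← h y]
    refine tsum_congr fun k => ?_
    simp only [ContinuousMap.smul_apply, UnitAddTorus.mFourier, ContinuousMap.coe_mk, smul_eq_mul,
      fourier_coe_apply, ← Complex.exp_sum, Finset.mul_sum]
    congr 2
    refine Finset.sum_congr rfl fun j _ => ?_
    push_cast
    ring
  have h1 : HasSum (fun k : Fin d → ℤ => a k • UnitAddTorus.mFourier k) 0 := h0 ▸ hs.hasSum
  -- The characters are orthonormal for normalised Haar measure, so this has to be the volume on the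
  -- circle.
  let : MeasureTheory.MeasureSpace UnitAddCircle := ⟨AddCircle.haarAddCircle⟩
  have : MeasureTheory.IsProbabilityMeasure
      (MeasureTheory.volume : MeasureTheory.Measure UnitAddCircle) :=
    inferInstanceAs (MeasureTheory.IsProbabilityMeasure AddCircle.haarAddCircle)
  have h2 : HasSum (fun k : Fin d → ℤ => a k • UnitAddTorus.mFourierLp 2 k) 0 := by
    have := h1.mapL (ContinuousMap.toLp (E := ℂ) 2 MeasureTheory.volume ℂ)
    rw [map_zero] at this
    exact this.congr_fun fun k => (map_smul _ _ _).symm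
  funext n
  have h3 := h2.mapL (innerSL ℂ (UnitAddTorus.mFourierLp (d := Fin d) 2 n))
  have horth := orthonormal_iff_ite.1 (UnitAddTorus.orthonormal_mFourier (d := Fin d))
  have h4 : HasSum (fun k : Fin d → ℤ => if n = k then a k else 0) (0 : ℂ) := by
    rw [map_zero] at h3
    refine (h3.congr_fun fun k => ?_)
    rw [innerSL_apply_apply, inner_smul_right, horth]
    simp
  have h5 : HasSum (fun k : Fin d → ℤ => if n = k then a k else 0) (a n) := by
    have := hasSum_ite_eq n (a n)
    refine this.congr_fun fun k => ?_
    by_cases hk : k = n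
    · simp [hk]
    · simp [hk, Ne.symm hk]
  exact h5.unique h4

/-- A Taylor-Fourier series is determined by its values at the real points near `y = 0`. -/
theorem coeff_eq_zero_of_evalTF_real {d : ℕ} {ρ r s : ℝ} (hρ : 0 ≤ ρ) (hs : 0 < s) (hsr : s ≤ r)
    {c : Idx d → ℂ} (hc : MemA ρ r c)
    (h : ∀ x y : Fin d → ℝ, (∀ j, |y j| ≤ s) → evalTF c (realPoint x y) = 0) : c = 0 := by
  have hc1 : Summable fun i : (Fin d → ℤ) × (Fin d → ℕ) => ‖c i‖ * s ^ deg i.2 := by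
    refine Summable.of_nonneg_of_le (fun _ => by positivity) (fun i => ?_) hc
    refine mul_le_mul_of_nonneg_left ?_ (norm_nonneg _)
    rw [weight, ← mul_one (s ^ deg i.2)]
    exact mul_le_mul (pow_le_pow_left₀ hs.le hsr _)
      (Real.one_le_exp (mul_nonneg hρ (kNorm_nonneg _))) zero_le_one
      (pow_nonneg (hs.le.trans hsr) _)
  have key : ∀ k, (fun ν => c (k, ν)) = 0 := by
    intro k
    refine taylor_coeff_eq_zero hs d _ (hc1.prod_factor k) fun y hy => ?_
    have hS : Summable fun i : (Fin d → ℤ) × (Fin d → ℕ) => ‖c i * ∏ j, (y j : ℂ) ^ i.2 j‖ := by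
      refine Summable.of_nonneg_of_le (fun _ => norm_nonneg _) (fun i => ?_) hc1
      rw [norm_mul, norm_prod, deg, ← Finset.prod_pow_eq_pow_sum]
      refine mul_le_mul_of_nonneg_left (Finset.prod_le_prod (fun _ _ => norm_nonneg _)
        fun j _ => ?_) (norm_nonneg _)
      rw [norm_pow, Complex.norm_real]
      exact pow_le_pow_left₀ (norm_nonneg _) (hy j) _
    -- For fixed y the sum over ν is taken first. What remains is an absolutely convergent Fourier
    -- series in x.
    refine congrFun (fourier_coeff_eq_zero
      (a := fun k => ∑' ν, c (k, ν) * ∏ j, (y j : ℂ) ^ ν j) ?_ fun x => ?_) k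
    · exact Summable.of_nonneg_of_le (fun _ => norm_nonneg _)
        (fun m => norm_tsum_le_tsum_norm (hS.prod_factor m)) hS.prod
    · rw [← h x y hy, evalTF, Summable.tsum_prod]
      · exact tsum_congr fun m => by simp [realPoint, tsum_mul_right]
      · refine Summable.of_norm (hS.congr fun i => ?_)
        rw [norm_mul, norm_mul, norm_mul, Complex.norm_exp]
        simp [realPoint, Complex.mul_re, Complex.mul_im]
  funext i
  exact congrFun (key i.1) i.2

end Uniqueness

/-! ### The Banach algebra of Hamiltonians and its point evaluations. -/

section Algebra

variable {d : ℕ} {ρ r : ℝ} {hr : 0 < r}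

theorem norm_def (H : Ham d ρ r hr) : ‖H‖ = normA ρ r H.coeff := rfl

theorem Ham.mem (H : Ham d ρ r hr) : MemA ρ r H.coeff := H.2

/-- The element of `𝒜_{ρ,r}` with given coefficients. -/
def Ham.mk (c : Idx d → ℂ) (hc : MemA ρ r c) : Ham d ρ r hr := (⟨c, hc⟩ : submoduleA d ρ r hr)

@[simp] theorem Ham.coeff_mk (c : Idx d → ℂ) (hc : MemA ρ r c) :
    (Ham.mk c hc : Ham d ρ r hr).coeff = c := rfl

@[ext] theorem Ham.ext {a b : Ham d ρ r hr} (h : a.coeff = b.coeff) : a = b := Subtype.ext h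

@[simp] theorem Ham.coeff_add (a b : Ham d ρ r hr) : (a + b).coeff = a.coeff + b.coeff := rfl
@[simp] theorem Ham.coeff_sub (a b : Ham d ρ r hr) : (a - b).coeff = a.coeff - b.coeff := rfl
@[simp] theorem Ham.coeff_neg (a : Ham d ρ r hr) : (-a).coeff = -a.coeff := rfl
@[simp] theorem Ham.coeff_zero : (0 : Ham d ρ r hr).coeff = 0 := rfl
@[simp] theorem Ham.coeff_smul (z : ℂ) (a : Ham d ρ r hr) : (z • a).coeff = z • a.coeff := rfl

theorem norm_coeff_mul_weight_le (a : Ham d ρ r hr) (i : Idx d) :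
    ‖a.coeff i‖ * weight ρ r i ≤ ‖a‖ :=
  a.mem.le_tsum i fun j _ => mul_nonneg (norm_nonneg _) (weight_pos ρ hr j).le

/-- The isometry of `𝒜_{ρ,r}` with `ℓ¹`. -/
noncomputable def Ham.toLp (d : ℕ) (ρ r : ℝ) (hr : 0 < r) :
    Ham d ρ r hr ≃ₗᵢ[ℂ] lp (fun _ : Idx d => ℂ) 1 where
  toFun a := ⟨fun i => (weight ρ r i : ℂ) * a.coeff i, by
    refine memℓp_gen ?_
    refine a.mem.congr fun i => ?_
    simp [abs_of_pos (weight_pos ρ hr i), mul_comm]⟩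
  map_add' a b := by ext i; exact mul_add _ _ _
  map_smul' z a := by ext i; exact mul_left_comm _ _ _
  invFun f := Ham.mk (fun i => (weight ρ r i : ℂ)⁻¹ * f i) (by
    have := lp.memℓp f
    rw [memℓp_gen_iff (by simp)] at this
    refine this.congr fun i => ?_
    have := (weight_pos ρ hr i).ne'
    simp [abs_of_pos (weight_pos ρ hr i)]
    field_simp)
  left_inv a := by
    ext i
    have : (weight ρ r i : ℂ) ≠ 0 := by exact_mod_cast (weight_pos ρ hr i).ne'
    exact inv_mul_cancel_left₀ this _
  right_inv f := by
    ext i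
    have : (weight ρ r i : ℂ) ≠ 0 := by exact_mod_cast (weight_pos ρ hr i).ne'
    exact mul_inv_cancel_left₀ this _
  norm_map' a := by
    rw [lp.norm_eq_tsum_rpow (by simp), norm_def, normA]
    simp only [ENNReal.toReal_one, Real.rpow_one, div_one]
    refine tsum_congr fun i => ?_
    simp [abs_of_pos (weight_pos ρ hr i), mul_comm]

instance : CompleteSpace (Ham d ρ r hr) :=
  (Ham.toLp d ρ r hr).toIsometryEquiv.completeSpace

/-- Coefficients of the product. -/
noncomputable def mulCoeff (a b : Idx d → ℂ) (m : Idx d) : ℂ :=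
  ∑' p : (fun q : Idx d × Idx d => q.1 + q.2) ⁻¹' {m}, a p.1.1 * b p.1.2

theorem summable_mul_weight (hr : 0 < r) {a b : Idx d → ℂ} (ha : MemA ρ r a) (hb : MemA ρ r b) :
    Summable fun q : Idx d × Idx d => ‖a q.1‖ * weight ρ r q.1 * (‖b q.2‖ * weight ρ r q.2) :=
  Summable.mul_of_nonneg ha hb (fun i => mul_nonneg (norm_nonneg _) (weight_pos ρ hr i).le)
    (fun i => mul_nonneg (norm_nonneg _) (weight_pos ρ hr i).le)

/-- The double series of the weighted norms is summed along the fibres of (i, j) ↦ i + j, where the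
weight of the sum is at most the product of the weights. The fibres are infinite because k runs
through ℤᵈ. -/
theorem mulCoeff_bound (hρ : 0 ≤ ρ) (hr : 0 < r) {a b : Idx d → ℂ} (ha : MemA ρ r a)
    (hb : MemA ρ r b) :
    MemA ρ r (mulCoeff a b) ∧ normA ρ r (mulCoeff a b) ≤ normA ρ r a * normA ρ r b := by
  have hS := (summable_mul_weight hr ha hb).hasSum
  have hF := hS.tsum_fiberwise fun q : Idx d × Idx d => q.1 + q.2
  have hle : ∀ m, ‖mulCoeff a b m‖ * weight ρ r m ≤
      ∑' p : (fun q : Idx d × Idx d => q.1 + q.2) ⁻¹' {m},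
        ‖a p.1.1‖ * weight ρ r p.1.1 * (‖b p.1.2‖ * weight ρ r p.1.2) := by
    intro m
    have hs := hS.summable.subtype ((fun q : Idx d × Idx d => q.1 + q.2) ⁻¹' {m})
    have hle : ∀ p : (fun q : Idx d × Idx d => q.1 + q.2) ⁻¹' {m},
        ‖a p.1.1 * b p.1.2‖ * weight ρ r m ≤
          ‖a p.1.1‖ * weight ρ r p.1.1 * (‖b p.1.2‖ * weight ρ r p.1.2) := by
      rintro ⟨p, hp⟩
      have hp : p.1 + p.2 = m := hp
      have hw := weight_add_le hρ hr.le p.1 p.2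
      rw [hp] at hw
      rw [norm_mul, mul_mul_mul_comm]
      exact mul_le_mul_of_nonneg_left hw (by positivity)
    have hs2 : Summable fun p : (fun q : Idx d × Idx d => q.1 + q.2) ⁻¹' {m} =>
        ‖a p.1.1 * b p.1.2‖ * weight ρ r m :=
      Summable.of_nonneg_of_le
        (fun _ => mul_nonneg (norm_nonneg _) (weight_pos ρ hr m).le) hle hs
    have hs3 : Summable fun p : (fun q : Idx d × Idx d => q.1 + q.2) ⁻¹' {m} =>
        ‖a p.1.1 * b p.1.2‖ := (summable_mul_right_iff (weight_pos ρ hr m).ne').1 hs2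
    refine le_trans ?_ (hs2.tsum_le_tsum hle hs)
    rw [tsum_mul_right]
    exact mul_le_mul_of_nonneg_right (norm_tsum_le_tsum_norm hs3) (weight_pos ρ hr m).le
  have h1 : MemA ρ r (mulCoeff a b) := Summable.of_nonneg_of_le
    (fun m => mul_nonneg (norm_nonneg _) (weight_pos ρ hr m).le) hle hF.summable
  refine ⟨h1, (h1.tsum_le_tsum hle hF.summable).trans_eq ?_⟩
  rw [hF.tsum_eq, normA, normA]
  exact (Summable.tsum_mul_tsum ha hb hS.summable).symm

theorem evalTF_mulCoeff (hr : 0 < r) {a b : Idx d → ℂ} (ha : MemA ρ r a)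
    (hb : MemA ρ r b) {p : Phase d} (hp : p ∈ polydom d ρ r) :
    evalTF (mulCoeff a b) p = evalTF a p * evalTF b p := by
  have h1 := ha.summable_mode hr.le hp
  have h2 := hb.summable_mode hr.le hp
  have h3 := (summable_mul_of_summable_norm h1 h2).hasSum
  have h4 := (h3.tsum_fiberwise fun q : Idx d × Idx d => q.1 + q.2).tsum_eq
  rw [evalTF_eq, evalTF_eq, evalTF_eq, Summable.tsum_mul_tsum h1.of_norm h2.of_norm h3.summable,
    ← h4]
  refine tsum_congr fun m => ?_
  rw [mulCoeff, ← tsum_mul_right]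
  refine tsum_congr fun q => ?_
  have hq : q.1.1 + q.1.2 = m := q.2
  have hm := mode_add q.1.1 q.1.2 p
  rw [hq] at hm
  rw [hm]
  exact mul_mul_mul_comm _ _ _ _

/-- The Hamiltonian consisting of a single mode. -/
noncomputable def Ham.single (i : Idx d) (z : ℂ) : Ham d ρ r hr :=
  Ham.mk (Pi.single i z) (MemA.of_finite
    ((Set.finite_singleton i).subset (Pi.support_single_subset)))

theorem Ham.eval_single (i : Idx d) (z : ℂ) (p : Phase d) :
    (Ham.single i z : Ham d ρ r hr).eval p = z * mode i p := by
  rw [Ham.eval, Ham.single, Ham.coeff_mk, evalTF_single, mode, mul_assoc]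

theorem Ham.norm_single (i : Idx d) (z : ℂ) :
    ‖(Ham.single i z : Ham d ρ r hr)‖ = ‖z‖ * weight ρ r i := by
  rw [norm_def, normA, Ham.single, Ham.coeff_mk, tsum_eq_single i (fun j hj => by simp [hj])]
  simp

theorem mode_zero (p : Phase d) : mode 0 p = 1 := by simp [mode]

theorem realPoint_mem_polydom (hρ : 0 ≤ ρ) {x y : Fin d → ℝ} (hy : ∀ j, |y j| ≤ r) :
    realPoint x y ∈ polydom d ρ r := fun j =>
  ⟨by simp [realPoint]; positivity, by simpa [realPoint] using hy j⟩

/-- This reduces the ring axioms and all later identities between Hamiltonians to identities between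
complex numbers, without rearranging convolutions. -/
theorem Ham.ext_eval (hρ : 0 ≤ ρ) {a b : Ham d ρ r hr}
    (h : ∀ p ∈ polydom d ρ r, a.eval p = b.eval p) : a = b := by
  have : (a - b).coeff = 0 := by
    refine coeff_eq_zero_of_evalTF_real hρ hr le_rfl (a - b).mem fun x y hy => ?_
    have hp := realPoint_mem_polydom hρ (x := x) hy
    have h2 := evalTF_add hr.le a.mem (b.mem.smul (-1)) hp
    rw [evalTF_smul] at h2
    have h3 : (a - b).coeff = a.coeff + (-1 : ℂ) • b.coeff := by
      funext i; simp [sub_eq_add_neg]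
    rw [h3, h2]
    have := h _ hp
    rw [Ham.eval, Ham.eval] at this
    rw [this]; ring
  have h2 : a - b = 0 := Ham.ext this
  exact sub_eq_zero.1 h2

theorem Ham.eval_add (a b : Ham d ρ r hr) {p : Phase d} (hp : p ∈ polydom d ρ r) :
    (a + b).eval p = a.eval p + b.eval p := evalTF_add hr.le a.mem b.mem hp

theorem Ham.eval_smul (z : ℂ) (a : Ham d ρ r hr) (p : Phase d) :
    (z • a).eval p = z * a.eval p := evalTF_smul z a.coeff p

theorem Ham.norm_eval_le (a : Ham d ρ r hr) {p : Phase d} (hp : p ∈ polydom d ρ r) :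
    ‖a.eval p‖ ≤ ‖a‖ := norm_evalTF_le hr.le a.mem hp

theorem Ham.norm_one' : ‖(Ham.single 0 1 : Ham d ρ r hr)‖ = 1 := by
  rw [Ham.norm_single]; simp [weight, deg, kNorm]

noncomputable instance : One (Ham d ρ r hr) := ⟨Ham.single 0 1⟩

theorem Ham.eval_one (p : Phase d) : (1 : Ham d ρ r hr).eval p = 1 := by
  have := Ham.eval_single (ρ := ρ) (hr := hr) (0 : Idx d) 1 p
  rwa [mode_zero, mul_one] at this

theorem Ham.eval_zero (p : Phase d) : (0 : Ham d ρ r hr).eval p = 0 := by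
  have := Ham.eval_smul 0 (0 : Ham d ρ r hr) p
  simpa using this

variable [hρ : Fact (0 < ρ)]

noncomputable instance : Mul (Ham d ρ r hr) :=
  ⟨fun a b => Ham.mk (mulCoeff a.coeff b.coeff) (mulCoeff_bound hρ.out.le hr a.mem b.mem).1⟩

theorem Ham.eval_mul (a b : Ham d ρ r hr) {p : Phase d} (hp : p ∈ polydom d ρ r) :
    (a * b).eval p = a.eval p * b.eval p := evalTF_mulCoeff hr a.mem b.mem hp

theorem Ham.mul_assoc' (a b c : Ham d ρ r hr) : a * b * c = a * (b * c) :=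
  Ham.ext_eval hρ.out.le fun p hp => by simp only [Ham.eval_mul _ _ hp, mul_assoc]

theorem Ham.mul_comm' (a b : Ham d ρ r hr) : a * b = b * a :=
  Ham.ext_eval hρ.out.le fun p hp => by simp only [Ham.eval_mul _ _ hp, mul_comm]

theorem Ham.one_mul' (a : Ham d ρ r hr) : 1 * a = a :=
  Ham.ext_eval hρ.out.le fun p hp => by simp only [Ham.eval_mul _ _ hp, Ham.eval_one, one_mul]

theorem Ham.mul_add' (a b c : Ham d ρ r hr) : a * (b + c) = a * b + a * c :=
  Ham.ext_eval hρ.out.le fun p hp => by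
    simp only [Ham.eval_mul _ _ hp, Ham.eval_add _ _ hp, mul_add]

theorem Ham.norm_mul_le' (a b : Ham d ρ r hr) : ‖a * b‖ ≤ ‖a‖ * ‖b‖ :=
  (mulCoeff_bound hρ.out.le hr a.mem b.mem).2

noncomputable instance : NormedCommRing (Ham d ρ r hr) :=
  { (inferInstance : NormedAddCommGroup (Ham d ρ r hr)) with
    mul := (· * ·)
    one := 1
    mul_assoc := Ham.mul_assoc'
    mul_comm := Ham.mul_comm'
    one_mul := Ham.one_mul'
    mul_one := fun a => by rw [Ham.mul_comm', Ham.one_mul']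
    left_distrib := Ham.mul_add'
    right_distrib := fun a b c => by
      rw [Ham.mul_comm', Ham.mul_add', Ham.mul_comm' c, Ham.mul_comm' c]
    zero_mul := fun a => Ham.ext_eval hρ.out.le fun p hp => by
      simp only [Ham.eval_mul _ _ hp, Ham.eval_zero, zero_mul]
    mul_zero := fun a => Ham.ext_eval hρ.out.le fun p hp => by
      simp only [Ham.eval_mul _ _ hp, Ham.eval_zero, mul_zero]
    norm_mul_le := Ham.norm_mul_le' }

instance : NormOneClass (Ham d ρ r hr) := ⟨Ham.norm_one'⟩

noncomputable instance : NormedAlgebra ℂ (Ham d ρ r hr) :=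
  { Algebra.ofModule
      (fun z a b => Ham.ext_eval hρ.out.le fun p hp => by
        simp only [Ham.eval_mul _ _ hp, Ham.eval_smul, mul_assoc])
      (fun z a b => Ham.ext_eval hρ.out.le fun p hp => by
        simp only [Ham.eval_mul _ _ hp, Ham.eval_smul, mul_left_comm]) with
    norm_smul_le := fun z a => (norm_smul z a).le }

/-- Evaluation at a point, as a continuous homomorphism of algebras. -/
noncomputable def Ham.evalHom (p : Phase d) (hp : p ∈ polydom d ρ r) :
    Ham d ρ r hr →A[ℂ] ℂ where
  toFun a := a.eval p
  map_one' := Ham.eval_one p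
  map_mul' a b := Ham.eval_mul a b hp
  map_zero' := Ham.eval_zero p
  map_add' a b := Ham.eval_add a b hp
  commutes' z := by
    rw [Algebra.algebraMap_eq_smul_one, Ham.eval_smul, Ham.eval_one]; simp
  cont := by
    refine (LinearMap.mkContinuous (σ := RingHom.id ℂ)
      { toFun := fun a : Ham d ρ r hr => a.eval p
        map_add' := fun a b => Ham.eval_add a b hp
        map_smul' := fun z a => Ham.eval_smul z a p } 1 fun a => ?_).continuous
    simpa using Ham.norm_eval_le a hp

theorem Ham.evalHom_apply (p : Phase d) (hp : p ∈ polydom d ρ r) (a : Ham d ρ r hr) :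
    Ham.evalHom p hp a = a.eval p := rfl

end Algebra

/-! ### The gradient norm as a weighted ℓ¹ norm, and Cauchy's estimate. -/

section Weights

variable {d : ℕ} {ρ r ρ' r' : ℝ}

/-- The weight of the mode `(k, ν)` in the norm of the gradient. -/
noncomputable def gradWeight (ρ r : ℝ) (i : Idx d) : ℝ :=
  (2 * Real.pi * kNorm i.1 * r ^ deg i.2 + deg i.2 * r ^ (deg i.2 - 1)) *
    Real.exp (ρ * kNorm i.1)

theorem gradWeight_nonneg (hr : 0 ≤ r) (i : Idx d) : 0 ≤ gradWeight ρ r i := by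
  have := kNorm_nonneg i.1
  have := Real.pi_pos
  unfold gradWeight
  positivity

theorem weight_mono (hρ : ρ ≤ ρ') (hr : 0 ≤ r) (hrr : r ≤ r') (i : Idx d) :
    weight ρ r i ≤ weight ρ' r' i := by
  have := kNorm_nonneg i.1
  have := hr.trans hrr
  unfold weight
  gcongr

theorem gradWeight_mono (hρ : ρ ≤ ρ') (hr : 0 ≤ r) (hrr : r ≤ r') (i : Idx d) :
    gradWeight ρ r i ≤ gradWeight ρ' r' i := by
  have := kNorm_nonneg i.1
  have := hr.trans hrr
  have := Real.pi_pos
  unfold gradWeight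
  gcongr

/-- The left side is a single term of the binomial expansion of the right side. -/
theorem nat_mul_pow_mul_le {a s : ℝ} (ha : 0 ≤ a) (hs : 0 ≤ s) (n : ℕ) :
    n * a ^ (n - 1) * s ≤ (a + s) ^ n := by
  induction n with
  | zero => simp
  | succ n ih =>
    have h1 : a ^ n ≤ (a + s) ^ n := pow_le_pow_left₀ ha (by linarith) _
    have h2 : (n : ℝ) * a ^ (n - 1) * a = n * a ^ n := by
      rcases n with _ | n
      · simp
      · simp [pow_succ, mul_assoc]
    push_cast
    rw [pow_succ]
    have h3 := mul_le_mul_of_nonneg_right ih ha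
    have h4 := mul_le_mul_of_nonneg_right h1 hs
    nlinarith

/-- Cauchy's estimate. -/
theorem gradWeight_le {s : ℝ} (hs : 0 < s) (hr : 0 ≤ r) (hρ : ρ + 2 * Real.pi * s ≤ ρ')
    (hrr : r + s ≤ r') (i : Idx d) : gradWeight ρ r i ≤ 2 / s * weight ρ' r' i := by
  have hk := kNorm_nonneg i.1
  have hπ := Real.pi_pos
  -- The x-part and the y-part of the gradient weight are each at most 1/s times the larger weight,
  -- the first by t ≤ exp t and the second by the binomial expansion. This is the origin of the
  -- constant 2.
  have h1 : 2 * Real.pi * kNorm i.1 * s * Real.exp (ρ * kNorm i.1) ≤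
      Real.exp (ρ' * kNorm i.1) := by
    have ha : 2 * Real.pi * kNorm i.1 * s ≤ Real.exp (2 * Real.pi * s * kNorm i.1) := by
      have := Real.add_one_le_exp (2 * Real.pi * s * kNorm i.1)
      linarith
    calc _ ≤ Real.exp (2 * Real.pi * s * kNorm i.1) * Real.exp (ρ * kNorm i.1) := by gcongr
      _ = Real.exp ((ρ + 2 * Real.pi * s) * kNorm i.1) := by rw [← Real.exp_add]; ring_nf
      _ ≤ _ := by gcongr
  have h2 : (deg i.2 : ℝ) * r ^ (deg i.2 - 1) * s ≤ r' ^ deg i.2 :=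
    (nat_mul_pow_mul_le hr hs.le _).trans (pow_le_pow_left₀ (by linarith) hrr _)
  have h3 : r ^ deg i.2 ≤ r' ^ deg i.2 := pow_le_pow_left₀ hr (by linarith) _
  have h4 : Real.exp (ρ * kNorm i.1) ≤ Real.exp (ρ' * kNorm i.1) := by
    gcongr
    have : 0 < 2 * Real.pi * s := by positivity
    linarith
  rw [div_mul_eq_mul_div, le_div_iff₀ hs, gradWeight, weight]
  have h5 : 2 * Real.pi * kNorm i.1 * s * Real.exp (ρ * kNorm i.1) * r ^ deg i.2 ≤
      Real.exp (ρ' * kNorm i.1) * r' ^ deg i.2 := by gcongr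
  have h6 : (deg i.2 : ℝ) * r ^ (deg i.2 - 1) * s * Real.exp (ρ * kNorm i.1) ≤
      r' ^ deg i.2 * Real.exp (ρ' * kNorm i.1) := by
    have : 0 ≤ r' ^ deg i.2 := (pow_nonneg hr _).trans h3
    gcongr
  linarith

theorem MemA.mono {c : Idx d → ℂ} (hc : MemA ρ' r' c) (hρ : ρ ≤ ρ') (hr : 0 ≤ r) (hrr : r ≤ r') :
    MemA ρ r c :=
  Summable.of_nonneg_of_le
    (fun _ => mul_nonneg (norm_nonneg _) (mul_nonneg (pow_nonneg hr _) (Real.exp_pos _).le))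
    (fun i => mul_le_mul_of_nonneg_left (weight_mono hρ hr hrr i) (norm_nonneg _)) hc

theorem normA_mono {c : Idx d → ℂ} (hc : MemA ρ' r' c) (hρ : ρ ≤ ρ') (hr : 0 ≤ r)
    (hrr : r ≤ r') : normA ρ r c ≤ normA ρ' r' c :=
  (hc.mono hρ hr hrr).tsum_le_tsum
    (fun i => mul_le_mul_of_nonneg_left (weight_mono hρ hr hrr i) (norm_nonneg _)) hc

/-- The gradient of `c` has finite norm. -/
def MemG (ρ r : ℝ) (c : Idx d → ℂ) : Prop := Summable fun i => ‖c i‖ * gradWeight ρ r i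

/-- The norm of the gradient as a weighted sum of coefficients. -/
noncomputable def gradA (ρ r : ℝ) (c : Idx d → ℂ) : ℝ := ∑' i, ‖c i‖ * gradWeight ρ r i

theorem MemG.add (hr : 0 ≤ r) {a b : Idx d → ℂ} (ha : MemG ρ r a) (hb : MemG ρ r b) :
    MemG ρ r (a + b) ∧ gradA ρ r (a + b) ≤ gradA ρ r a + gradA ρ r b := by
  have hle : ∀ i, ‖(a + b) i‖ * gradWeight ρ r i ≤
      ‖a i‖ * gradWeight ρ r i + ‖b i‖ * gradWeight ρ r i := fun i => by
    rw [← add_mul]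
    exact mul_le_mul_of_nonneg_right (norm_add_le _ _) (gradWeight_nonneg hr i)
  have h : MemG ρ r (a + b) := Summable.of_nonneg_of_le
    (fun i => mul_nonneg (norm_nonneg _) (gradWeight_nonneg hr i)) hle (Summable.add ha hb)
  refine ⟨h, ?_⟩
  rw [gradA, gradA, gradA, ← Summable.tsum_add ha hb]
  exact h.tsum_le_tsum hle (Summable.add ha hb)

theorem MemG.mono {c : Idx d → ℂ} (hc : MemG ρ' r' c) (hρ : ρ ≤ ρ') (hr : 0 ≤ r) (hrr : r ≤ r') :
    MemG ρ r c :=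
  Summable.of_nonneg_of_le (fun i => mul_nonneg (norm_nonneg _) (gradWeight_nonneg hr i))
    (fun i => mul_le_mul_of_nonneg_left (gradWeight_mono hρ hr hrr i) (norm_nonneg _)) hc

theorem gradA_mono {c : Idx d → ℂ} (hc : MemG ρ' r' c) (hρ : ρ ≤ ρ') (hr : 0 ≤ r)
    (hrr : r ≤ r') : gradA ρ r c ≤ gradA ρ' r' c :=
  (hc.mono hρ hr hrr).tsum_le_tsum
    (fun i => mul_le_mul_of_nonneg_left (gradWeight_mono hρ hr hrr i) (norm_nonneg _)) hc

theorem MemA.cauchy {s : ℝ} (hs : 0 < s) (hr : 0 ≤ r) (hρ : ρ + 2 * Real.pi * s ≤ ρ')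
    (hrr : r + s ≤ r') {c : Idx d → ℂ} (hc : MemA ρ' r' c) :
    MemG ρ r c ∧ gradA ρ r c ≤ 2 / s * normA ρ' r' c := by
  have hle : ∀ i, ‖c i‖ * gradWeight ρ r i ≤ 2 / s * (‖c i‖ * weight ρ' r' i) := fun i => by
    rw [mul_left_comm]
    exact mul_le_mul_of_nonneg_left (gradWeight_le hs hr hρ hrr i) (norm_nonneg _)
  have h : MemG ρ r c := Summable.of_nonneg_of_le
    (fun i => mul_nonneg (norm_nonneg _) (gradWeight_nonneg hr i)) hle (Summable.mul_left _ hc)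
  refine ⟨h, ?_⟩
  rw [gradA, normA, ← tsum_mul_left]
  exact h.tsum_le_tsum hle (Summable.mul_left _ hc)

theorem coeffDx_term (j : Fin d) (c : Idx d → ℂ) (i : Idx d) :
    ‖coeffDx j c i‖ * weight ρ r i =
      ‖c i‖ * (2 * Real.pi * |(i.1 j : ℝ)| * r ^ deg i.2 * Real.exp (ρ * kNorm i.1)) := by
  have : ‖((i.1 j : ℤ) : ℂ)‖ = |(i.1 j : ℝ)| := by
    rw [← Complex.ofReal_intCast, Complex.norm_real, Real.norm_eq_abs]
  rw [coeffDx, norm_mul, norm_mul, norm_mul, norm_mul, this, weight]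
  simp [abs_of_pos Real.pi_pos]
  ring

/-- The index shift ν ↦ ν + e_j is injective, and the indices that it misses have ν_j = 0, so they
contribute nothing. -/
theorem coeffDy_sum (j : Fin d) (c : Idx d → ℂ) (S : ℝ) :
    HasSum (fun i => ‖coeffDy j c i‖ * weight ρ r i) S ↔
      HasSum (fun i : Idx d =>
        ‖c i‖ * (i.2 j * r ^ (deg i.2 - 1) * Real.exp (ρ * kNorm i.1))) S := by
  have hinj : Function.Injective
      (fun i : Idx d => ((i.1, i.2 + Pi.single j 1) : Idx d)) := by
    intro i i2 h2
    simp only [Prod.mk.injEq, add_left_inj] at h2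
    exact Prod.ext h2.1 h2.2
  rw [← hinj.hasSum_iff (f := fun i : Idx d =>
    ‖c i‖ * (i.2 j * r ^ (deg i.2 - 1) * Real.exp (ρ * kNorm i.1)))]
  · refine iff_of_eq (congrArg (fun f => HasSum f S) (funext fun i => ?_))
    have h1 : ‖((i.2 j : ℂ) + 1)‖ = (i.2 j : ℝ) + 1 := by
      exact_mod_cast Complex.norm_natCast (i.2 j + 1)
    have h2 : deg (i.2 + Pi.single j 1) = deg i.2 + 1 := by
      rw [deg_add]; simp [deg]
    simp only [Function.comp, coeffDy, norm_mul, h1, h2, weight, Pi.add_apply, Pi.single_eq_same]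
    push_cast
    ring
  · intro i hi
    have : i.2 j = 0 := by
      by_contra h
      refine hi ⟨(i.1, i.2 - Pi.single j 1), Prod.ext rfl (funext fun l => ?_)⟩
      by_cases hl : l = j
      · subst hl; simp; omega
      · simp [hl]
    simp [this]

theorem gradWeight_eq (i : Idx d) : gradWeight ρ r i =
    ∑ j, 2 * Real.pi * |(i.1 j : ℝ)| * r ^ deg i.2 * Real.exp (ρ * kNorm i.1) +
      ∑ j, i.2 j * r ^ (deg i.2 - 1) * Real.exp (ρ * kNorm i.1) := by
  rw [← Finset.sum_mul, ← Finset.sum_mul, ← Finset.sum_mul, ← Finset.sum_mul, ← Finset.mul_sum,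
    gradWeight, kNorm, add_mul]
  simp [deg]

theorem memG_iff (hr : 0 ≤ r) (c : Idx d → ℂ) :
    MemG ρ r c ↔ (∀ j, MemA ρ r (coeffDx j c)) ∧ ∀ j, MemA ρ r (coeffDy j c) := by
  have hy : ∀ j, MemA ρ r (coeffDy j c) ↔ Summable (fun i : Idx d =>
        ‖c i‖ * (i.2 j * r ^ (deg i.2 - 1) * Real.exp (ρ * kNorm i.1))) :=
    fun j => exists_congr fun S => coeffDy_sum j c S
  have hx : ∀ j, MemA ρ r (coeffDx j c) ↔ Summable (fun i : Idx d =>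
      ‖c i‖ * (2 * Real.pi * |(i.1 j : ℝ)| * r ^ deg i.2 * Real.exp (ρ * kNorm i.1))) :=
    fun j => by rw [MemA]; simp only [coeffDx_term]
  have hπ := Real.pi_pos
  have hpx : ∀ (i : Idx d) (j : Fin d),
      0 ≤ 2 * Real.pi * |(i.1 j : ℝ)| * r ^ deg i.2 * Real.exp (ρ * kNorm i.1) :=
    fun i j => by positivity
  have hpy : ∀ (i : Idx d) (j : Fin d),
      0 ≤ i.2 j * r ^ (deg i.2 - 1) * Real.exp (ρ * kNorm i.1) := fun i j => by positivity
  simp only [hx, hy]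
  constructor
  · intro h
    refine ⟨fun j => ?_, fun j => ?_⟩
    · refine Summable.of_nonneg_of_le (fun i => mul_nonneg (norm_nonneg _) (hpx i j))
        (fun i => mul_le_mul_of_nonneg_left ?_ (norm_nonneg _)) h
      rw [gradWeight_eq]
      have h1 := Finset.single_le_sum (fun j _ => hpx i j) (Finset.mem_univ j)
      have h2 := Finset.sum_nonneg (fun j (_ : j ∈ Finset.univ) => hpy i j)
      linarith
    · refine Summable.of_nonneg_of_le (fun i => mul_nonneg (norm_nonneg _) (hpy i j))
        (fun i => mul_le_mul_of_nonneg_left ?_ (norm_nonneg _)) h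
      rw [gradWeight_eq]
      have h1 := Finset.single_le_sum (fun j _ => hpy i j) (Finset.mem_univ j)
      have h2 := Finset.sum_nonneg (fun j (_ : j ∈ Finset.univ) => hpx i j)
      linarith
  · rintro ⟨h1, h2⟩
    refine ((summable_sum fun j (_ : j ∈ Finset.univ) => h1 j).add
      (summable_sum fun j (_ : j ∈ Finset.univ) => h2 j)).congr fun i => ?_
    rw [gradWeight_eq, mul_add, Finset.mul_sum, Finset.mul_sum]

/-- With a single weight for the whole gradient, Cauchy and Lipschitz estimates become comparisons
mode by mode. -/
theorem normGrad_eq_gradA (hr : 0 ≤ r) {c : Idx d → ℂ} (hc : MemG ρ r c) :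
    normGrad ρ r c = gradA ρ r c := by
  obtain ⟨h1, h2⟩ := (memG_iff hr c).1 hc
  have hx : ∀ j, HasSum (fun i : Idx d =>
      ‖c i‖ * (2 * Real.pi * |(i.1 j : ℝ)| * r ^ deg i.2 * Real.exp (ρ * kNorm i.1)))
      (normA ρ r (coeffDx j c)) := fun j => by
    have h : HasSum (fun i => ‖coeffDx j c i‖ * weight ρ r i) (normA ρ r (coeffDx j c)) :=
      (h1 j).hasSum
    simpa only [coeffDx_term] using h
  have hy : ∀ j, HasSum (fun i : Idx d =>
      ‖c i‖ * (i.2 j * r ^ (deg i.2 - 1) * Real.exp (ρ * kNorm i.1)))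
      (normA ρ r (coeffDy j c)) := fun j => (coeffDy_sum j c _).1 (h2 j).hasSum
  have := (hasSum_sum fun j (_ : j ∈ Finset.univ) => hx j).add
    (hasSum_sum fun j (_ : j ∈ Finset.univ) => hy j)
  rw [normGrad, ← this.tsum_eq, gradA]
  exact tsum_congr fun i => by rw [gradWeight_eq, mul_add, Finset.mul_sum, Finset.mul_sum]

end Weights

/-! ### Restriction to smaller domains. -/

section Restrict

variable {d : ℕ} {ρ r ρ' r' : ℝ} {hr : 0 < r} {hr' : 0 < r'}

/-- Restriction to a smaller domain, as a linear map. -/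
def Ham.restrictLin (hρ : ρ ≤ ρ') (hrr : r ≤ r') :
    Ham d ρ' r' hr' →ₗ[ℂ] Ham d ρ r hr where
  toFun a := Ham.mk a.coeff (a.mem.mono hρ hr.le hrr)
  map_add' a b := Ham.ext (by simp only [Ham.coeff_mk, Ham.coeff_add])
  map_smul' z a := Ham.ext (by simp only [Ham.coeff_mk, Ham.coeff_smul, RingHom.id_apply])

theorem Ham.coeff_restrictLin (hρ : ρ ≤ ρ') (hrr : r ≤ r') (a : Ham d ρ' r' hr') :
    (Ham.restrictLin hρ hrr a : Ham d ρ r hr).coeff = a.coeff := Ham.coeff_mk _ _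

theorem Ham.norm_restrictLin_le (hρ : ρ ≤ ρ') (hrr : r ≤ r') (a : Ham d ρ' r' hr') :
    ‖(Ham.restrictLin hρ hrr a : Ham d ρ r hr)‖ ≤ 1 * ‖a‖ := by
  rw [one_mul, norm_def, norm_def, Ham.coeff_restrictLin]
  exact normA_mono a.mem hρ hr.le hrr

/-- Restriction to a smaller domain. -/
noncomputable def Ham.restrict (hρ : ρ ≤ ρ') (hrr : r ≤ r') :
    Ham d ρ' r' hr' →L[ℂ] Ham d ρ r hr :=
  LinearMap.mkContinuous (Ham.restrictLin hρ hrr) 1 (Ham.norm_restrictLin_le hρ hrr)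

theorem Ham.coeff_restrict (hρ : ρ ≤ ρ') (hrr : r ≤ r') (a : Ham d ρ' r' hr') :
    (Ham.restrict hρ hrr a : Ham d ρ r hr).coeff = a.coeff := by
  rw [Ham.restrict, LinearMap.mkContinuous_apply, Ham.coeff_restrictLin]

theorem Ham.norm_restrict_le (hρ : ρ ≤ ρ') (hrr : r ≤ r') (a : Ham d ρ' r' hr') :
    ‖(Ham.restrict hρ hrr a : Ham d ρ r hr)‖ ≤ ‖a‖ := by
  rw [norm_def, Ham.coeff_restrict, norm_def]
  exact normA_mono a.mem hρ hr.le hrr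

theorem Ham.eval_restrict (hρ : ρ ≤ ρ') (hrr : r ≤ r') (a : Ham d ρ' r' hr') (p : Phase d) :
    (Ham.restrict hρ hrr a : Ham d ρ r hr).eval p = a.eval p := by
  rw [Ham.eval, Ham.coeff_restrict, Ham.eval]

end Restrict

/-! ### Differences of powers, products and exponentials in a Banach algebra. -/

section BanachAlgebra

theorem norm_pow_sub_pow_le {𝔸 : Type*} [NormedCommRing 𝔸] [NormOneClass 𝔸] {M δ : ℝ} {a b : 𝔸} (ha : ‖a‖ ≤ M) (hb : ‖b‖ ≤ M)
    (hab : ‖a - b‖ ≤ δ) (n : ℕ) : ‖a ^ n - b ^ n‖ ≤ n * M ^ (n - 1) * δ := by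
  have hM : 0 ≤ M := (norm_nonneg _).trans ha
  have hδ : 0 ≤ δ := (norm_nonneg _).trans hab
  induction n with
  | zero => simp
  | succ n ih =>
    have h1 : a ^ (n + 1) - b ^ (n + 1) = a ^ n * (a - b) + (a ^ n - b ^ n) * b := by ring
    have h2 : (n : ℝ) * M ^ (n - 1) * M = n * M ^ n := by
      rcases n with _ | n
      · simp
      · simp [pow_succ, mul_assoc]
    have h3 : ‖a ^ n‖ ≤ M ^ n := (norm_pow_le _ _).trans (pow_le_pow_left₀ (norm_nonneg _) ha _)
    rw [h1, Nat.add_sub_cancel]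
    calc _ ≤ ‖a ^ n‖ * ‖a - b‖ + ‖a ^ n - b ^ n‖ * ‖b‖ :=
          (norm_add_le _ _).trans (add_le_add (norm_mul_le _ _) (norm_mul_le _ _))
      _ ≤ M ^ n * δ + (n * M ^ (n - 1) * δ) * M := by gcongr
      _ = M ^ n * δ + (n * M ^ (n - 1) * M) * δ := by ring
      _ = _ := by rw [h2]; push_cast; ring

/-- Here `a` is a fixed majorant, which has small tails, and `b` a variation that is small in total.
The splitting gives locally uniform convergence of series whose coefficients move with a parameter.
-/
theorem norm_tsum_sub_sum_le {F ι : Type*} [NormedAddCommGroup F] [CompleteSpace F] {f : ι → F}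
    {a b : ι → ℝ} (ha : Summable a) (hb : Summable b) (hb0 : ∀ i, 0 ≤ b i)
    (hf : ∀ i, ‖f i‖ ≤ a i + b i) (A : Finset ι) :
    ‖∑' i, f i - ∑ i ∈ A, f i‖ ≤ ∑' i : {i // i ∉ A}, a i + ∑' i, b i := by
  have hs : Summable fun i => ‖f i‖ :=
    Summable.of_nonneg_of_le (fun _ => norm_nonneg _) hf (ha.add hb)
  have h1 := hs.subtype {i | i ∉ A}
  have h2 := ha.subtype {i | i ∉ A}
  have h3 := hb.subtype {i | i ∉ A}
  rw [← hs.of_norm.sum_add_tsum_subtype_compl A, add_sub_cancel_left]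
  calc _ ≤ ∑' i : {i // i ∉ A}, ‖f i‖ := norm_tsum_le_tsum_norm h1
    _ ≤ ∑' i : {i // i ∉ A}, (a i + b i) := h1.tsum_le_tsum (fun i => hf i) (h2.add h3)
    _ = ∑' i : {i // i ∉ A}, a i + ∑' i : {i // i ∉ A}, b i := h2.tsum_add h3
    _ ≤ _ := add_le_add le_rfl (hb.tsum_subtype_le _ {i | i ∉ A} hb0)

/-- The factors are exchanged one after another, as in the product rule. The bound is the derivative
of M ^ n for the total degree n, which matches the y-part of the gradient weight. -/
theorem norm_prod_pow_sub_le {𝔸 : Type*} [NormedCommRing 𝔸] [NormOneClass 𝔸] {ι : Type*}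
    {M δ : ℝ} (a b : ι → 𝔸) (ha : ∀ i, ‖a i‖ ≤ M)
    (hb : ∀ i, ‖b i‖ ≤ M) (hM : 0 ≤ M) (hδ : 0 ≤ δ) (hab : ∀ i, ‖a i - b i‖ ≤ δ) (n : ι → ℕ)
    (s : Finset ι) :
    ‖∏ i ∈ s, a i ^ n i‖ ≤ M ^ ∑ i ∈ s, n i ∧
    ‖∏ i ∈ s, b i ^ n i‖ ≤ M ^ ∑ i ∈ s, n i ∧
    ‖∏ i ∈ s, a i ^ n i - ∏ i ∈ s, b i ^ n i‖ ≤
      (∑ i ∈ s, n i : ℕ) * M ^ ((∑ i ∈ s, n i) - 1) * δ := by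
  classical
  induction s using Finset.induction_on with
  | empty => simp
  | insert j s hj ih =>
    obtain ⟨h1, h2, h3⟩ := ih
    have ha' : ‖a j ^ n j‖ ≤ M ^ n j :=
      (norm_pow_le _ _).trans (pow_le_pow_left₀ (norm_nonneg _) (ha j) _)
    have hb' : ‖b j ^ n j‖ ≤ M ^ n j :=
      (norm_pow_le _ _).trans (pow_le_pow_left₀ (norm_nonneg _) (hb j) _)
    have hd := norm_pow_sub_pow_le (ha j) (hb j) (hab j) (n j)
    simp only [Finset.prod_insert hj, Finset.sum_insert hj]
    set m := ∑ i ∈ s, n i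
    have hk : ∀ k l : ℕ, (k : ℝ) * M ^ (k - 1) * M ^ l = k * M ^ (k + l - 1) := by
      intro k l
      rcases k with _ | k
      · simp
      · rw [mul_assoc, ← pow_add]; congr 2; omega
    refine ⟨?_, ?_, ?_⟩
    · rw [pow_add]
      exact (norm_mul_le _ _).trans (mul_le_mul ha' h1 (norm_nonneg _) (by positivity))
    · rw [pow_add]
      exact (norm_mul_le _ _).trans (mul_le_mul hb' h2 (norm_nonneg _) (by positivity))
    · have e : a j ^ n j * ∏ i ∈ s, a i ^ n i - b j ^ n j * ∏ i ∈ s, b i ^ n i =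
          a j ^ n j * (∏ i ∈ s, a i ^ n i - ∏ i ∈ s, b i ^ n i) +
            (a j ^ n j - b j ^ n j) * ∏ i ∈ s, b i ^ n i := by ring
      rw [e]
      calc _ ≤ ‖a j ^ n j‖ * ‖∏ i ∈ s, a i ^ n i - ∏ i ∈ s, b i ^ n i‖ +
            ‖a j ^ n j - b j ^ n j‖ * ‖∏ i ∈ s, b i ^ n i‖ :=
            (norm_add_le _ _).trans (add_le_add (norm_mul_le _ _) (norm_mul_le _ _))
        _ ≤ M ^ n j * (m * M ^ (m - 1) * δ) + (n j * M ^ (n j - 1) * δ) * M ^ m := by gcongr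
        _ = (m * M ^ (m - 1) * M ^ n j + n j * M ^ (n j - 1) * M ^ m) * δ := by ring
        _ = _ := by
          rw [hk, hk, add_comm m (n j)]
          push_cast
          ring

variable {𝔸 : Type*} [NormedCommRing 𝔸] [NormedAlgebra ℂ 𝔸] [CompleteSpace 𝔸] [NormOneClass 𝔸]

theorem norm_normedSpace_exp_le (x : 𝔸) : ‖NormedSpace.exp x‖ ≤ Real.exp ‖x‖ := by
  have h1 := NormedSpace.norm_expSeries_summable' (𝕂 := ℂ) x
  have h2 := NormedSpace.exp_series_hasSum_exp' (𝕂 := ℂ) x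
  have h3 := NormedSpace.exp_series_hasSum_exp' (𝕂 := ℝ) ‖x‖
  rw [← h2.tsum_eq, Real.exp_eq_exp_ℝ, ← h3.tsum_eq]
  refine (norm_tsum_le_tsum_norm h1).trans (h1.tsum_le_tsum (fun n => ?_) h3.summable)
  rw [norm_smul, norm_inv, Complex.norm_natCast, smul_eq_mul]
  exact mul_le_mul_of_nonneg_left (norm_pow_le _ _) (by positivity)

/-- Mean value inequality on the ball of radius M, where the derivative of the exponential is
multiplication by an element of norm at most e^M. -/
theorem norm_normedSpace_exp_sub_le {M : ℝ} {x y : 𝔸} (hx : ‖x‖ ≤ M) (hy : ‖y‖ ≤ M) :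
    ‖NormedSpace.exp x - NormedSpace.exp y‖ ≤ Real.exp M * ‖x - y‖ := by
  refine Convex.norm_image_sub_le_of_norm_hasFDerivWithin_le (𝕜 := ℂ)
    (s := Metric.closedBall (0 : 𝔸) M)
    (fun z _ => (hasFDerivAt_exp (𝕂 := ℂ) (x := z)).hasFDerivWithinAt) (fun z hz => ?_)
    (convex_closedBall _ _) (by simpa using hy) (by simpa using hx)
  refine ContinuousLinearMap.opNorm_le_bound _ (Real.exp_pos _).le fun v => ?_
  have hz' : ‖z‖ ≤ M := by simpa using hz
  refine (norm_mul_le _ _).trans (mul_le_mul_of_nonneg_right ?_ (norm_nonneg _))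
  exact (norm_normedSpace_exp_le z).trans (Real.exp_le_exp.2 hz')

end BanachAlgebra

/-! ### Composition with id + u. -/

section Comp

variable {d : ℕ} {ρ r : ℝ} {hr : 0 < r}

theorem norm_single_fst (k : Fin d → ℤ) :
    ‖(Ham.single (k, 0) 1 : Ham d ρ r hr)‖ = Real.exp (ρ * kNorm k) := by
  rw [Ham.norm_single]
  simp [weight, deg]

variable [hρ : Fact (0 < ρ)]

/-- The Hamiltonian `2 π i k · u`. -/
noncomputable def phaseShift (u : Fin d ⊕ Fin d → Ham d ρ r hr) (k : Fin d → ℤ) : Ham d ρ r hr :=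
  ∑ j, (2 * (Real.pi : ℂ) * Complex.I * (k j : ℂ)) • u (Sum.inl j)

/-- The composition of the mode `(k, ν)` with `id + u`. -/
noncomputable def modeComp (u : Fin d ⊕ Fin d → Ham d ρ r hr) (i : Idx d) : Ham d ρ r hr :=
  Ham.single (i.1, 0) 1 * NormedSpace.exp (phaseShift u i.1) *
    ∏ j, (Ham.single (0, Pi.single j 1) 1 + u (Sum.inr j)) ^ i.2 j

/-- The composition `c ∘ (id + u)`. -/
noncomputable def comp (c : Idx d → ℂ) (u : Fin d ⊕ Fin d → Ham d ρ r hr) : Ham d ρ r hr :=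
  ∑' i, c i • modeComp u i

theorem norm_phaseShift_le {s : ℝ} {u : Fin d ⊕ Fin d → Ham d ρ r hr} (hu : ∀ j, ‖u j‖ ≤ s)
    (k : Fin d → ℤ) : ‖phaseShift u k‖ ≤ 2 * Real.pi * kNorm k * s := by
  rw [phaseShift, kNorm, Finset.mul_sum, Finset.sum_mul]
  refine (norm_sum_le _ _).trans (Finset.sum_le_sum fun j _ => ?_)
  have : ‖2 * (Real.pi : ℂ) * Complex.I * (k j : ℂ)‖ = 2 * Real.pi * |(k j : ℝ)| := by
    rw [← Complex.ofReal_intCast]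
    simp [abs_of_pos Real.pi_pos]
  rw [norm_smul, this]
  exact mul_le_mul_of_nonneg_left (hu _) (by have := Real.pi_pos; positivity)

theorem phaseShift_sub (u u' : Fin d ⊕ Fin d → Ham d ρ r hr) (k : Fin d → ℤ) :
    phaseShift u k - phaseShift u' k = phaseShift (fun j => u j - u' j) k := by
  simp only [phaseShift, smul_sub, Finset.sum_sub_distrib]

theorem norm_coord_le {s : ℝ} {u : Fin d ⊕ Fin d → Ham d ρ r hr} (hu : ∀ j, ‖u j‖ ≤ s)
    (j : Fin d) :
    ‖(Ham.single (0, Pi.single j 1) 1 : Ham d ρ r hr) + u (Sum.inr j)‖ ≤ r + s := by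
  refine (norm_add_le _ _).trans (add_le_add (le_of_eq ?_) (hu _))
  rw [Ham.norm_single]
  simp [weight, deg, kNorm]

/-- The factor exp(2πi k·u) costs exp(2π‖k‖s) and each y_j + u_j has norm at most r + s. Together
this is the weight for the domain enlarged by the displacement s. -/
theorem norm_modeComp_le {s : ℝ} (hs : 0 ≤ s) {u : Fin d ⊕ Fin d → Ham d ρ r hr}
    (hu : ∀ j, ‖u j‖ ≤ s) (i : Idx d) :
    ‖modeComp u i‖ ≤ weight (ρ + 2 * Real.pi * s) (r + s) i := by
  have h1 := (norm_normedSpace_exp_le (phaseShift u i.1)).trans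
    (Real.exp_le_exp.2 (norm_phaseShift_le hu i.1))
  have h2 := (norm_prod_pow_sub_le (M := r + s) (δ := 0) _ _ (norm_coord_le hu) (norm_coord_le hu)
    (by linarith) le_rfl (fun j => by simp) i.2 Finset.univ).1
  calc _ ≤ Real.exp (ρ * kNorm i.1) * Real.exp (2 * Real.pi * kNorm i.1 * s) *
        (r + s) ^ (∑ j, i.2 j) := by
        refine (norm_mul_le _ _).trans (mul_le_mul ?_ h2 (norm_nonneg _) (by positivity))
        refine (norm_mul_le _ _).trans ?_
        rw [norm_single_fst]
        exact mul_le_mul_of_nonneg_left h1 (Real.exp_pos _).le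
    _ = _ := by
      rw [weight, ← Real.exp_add, deg, mul_comm]
      ring_nf

/-- Product rule: the difference of the exponentials produces the factor 2π‖k‖ and the difference of
the monomials the factor ‖ν‖, which are the two parts of the gradient weight. -/
theorem norm_modeComp_sub_le {s δ : ℝ} (hs : 0 ≤ s) (hδ : 0 ≤ δ)
    {u u' : Fin d ⊕ Fin d → Ham d ρ r hr} (hu : ∀ j, ‖u j‖ ≤ s) (hu' : ∀ j, ‖u' j‖ ≤ s)
    (huu : ∀ j, ‖u j - u' j‖ ≤ δ) (i : Idx d) :
    ‖modeComp u i - modeComp u' i‖ ≤ gradWeight (ρ + 2 * Real.pi * s) (r + s) i * δ := by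
  have hπ := Real.pi_pos
  have hk := kNorm_nonneg i.1
  obtain ⟨-, h2, h3⟩ := norm_prod_pow_sub_le (M := r + s) (δ := δ) _ _ (norm_coord_le hu)
    (norm_coord_le hu') (by linarith) hδ (fun j => by simpa using huu (Sum.inr j)) i.2 Finset.univ
  have h1 := (norm_normedSpace_exp_le (phaseShift u i.1)).trans
    (Real.exp_le_exp.2 (norm_phaseShift_le hu i.1))
  have h4 := norm_normedSpace_exp_sub_le (norm_phaseShift_le hu i.1) (norm_phaseShift_le hu' i.1)
  rw [phaseShift_sub] at h4
  have h5 := norm_phaseShift_le huu i.1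
  unfold modeComp
  set A := ∏ j, ((Ham.single (0, Pi.single j 1) 1 : Ham d ρ r hr) + u (Sum.inr j)) ^ i.2 j
  set B := ∏ j, ((Ham.single (0, Pi.single j 1) 1 : Ham d ρ r hr) + u' (Sum.inr j)) ^ i.2 j
  set S : Ham d ρ r hr := Ham.single (i.1, 0) 1 with hS
  have hSn : ‖S‖ = Real.exp (ρ * kNorm i.1) := norm_single_fst _
  set X := NormedSpace.exp (phaseShift u i.1)
  set Y := NormedSpace.exp (phaseShift u' i.1)
  have e : S * X * A - S * Y * B = S * (X * (A - B) + (X - Y) * B) := by ring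
  have hX : ‖X - Y‖ ≤ Real.exp (2 * Real.pi * kNorm i.1 * s) * (2 * Real.pi * kNorm i.1 * δ) :=
    h4.trans (mul_le_mul_of_nonneg_left h5 (Real.exp_pos _).le)
  have hrs : 0 ≤ r + s := by linarith
  rw [e]
  calc _ ≤ ‖S‖ * (‖X‖ * ‖A - B‖ + ‖X - Y‖ * ‖B‖) :=
        (norm_mul_le _ _).trans (mul_le_mul_of_nonneg_left
          ((norm_add_le _ _).trans (add_le_add (norm_mul_le _ _) (norm_mul_le _ _)))
          (norm_nonneg _))
    _ ≤ Real.exp (ρ * kNorm i.1) * (Real.exp (2 * Real.pi * kNorm i.1 * s) *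
          ((∑ j, i.2 j : ℕ) * (r + s) ^ ((∑ j, i.2 j) - 1) * δ) +
          Real.exp (2 * Real.pi * kNorm i.1 * s) * (2 * Real.pi * kNorm i.1 * δ) *
          (r + s) ^ (∑ j, i.2 j)) := by
        rw [hSn]
        gcongr
    _ = _ := by
      have : Real.exp ((ρ + 2 * Real.pi * s) * kNorm i.1) =
          Real.exp (ρ * kNorm i.1) * Real.exp (2 * Real.pi * kNorm i.1 * s) := by
        rw [← Real.exp_add]; ring_nf
      rw [gradWeight, this, deg]
      ring

/-- The map `id + u`. -/
noncomputable def shift (u : Fin d ⊕ Fin d → Ham d ρ r hr) (p : Phase d) : Phase d :=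
  (fun j => p.1 j + (u (Sum.inl j)).eval p, fun j => p.2 j + (u (Sum.inr j)).eval p)

theorem mode_fst (k : Fin d → ℤ) (p : Phase d) : mode (k, 0) p =
    Complex.exp (2 * (Real.pi : ℂ) * Complex.I * ∑ j, (k j : ℂ) * p.1 j) := by
  simp [mode]

theorem mode_snd (j : Fin d) (p : Phase d) : mode (0, Pi.single j 1) p = p.2 j := by
  rw [mode, Finset.prod_eq_single j] <;> simp +contextual

theorem eval_modeComp (u : Fin d ⊕ Fin d → Ham d ρ r hr) (i : Idx d) {p : Phase d}
    (hp : p ∈ polydom d ρ r) : (modeComp u i).eval p = mode i (shift u p) := by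
  let : NormedAlgebra ℚ (Ham d ρ r hr) := NormedAlgebra.restrictScalars ℚ ℂ _
  rw [← Ham.evalHom_apply p hp, modeComp, map_mul, map_mul, map_prod,
    NormedSpace.map_exp ((Ham.evalHom p hp : Ham d ρ r hr →A[ℂ] ℂ)) (Ham.evalHom p hp).cont,
    phaseShift, map_sum]
  simp only [map_smul, map_pow, map_add, Ham.evalHom_apply, Ham.eval_single, one_mul, mode_fst,
    mode_snd, ← Complex.exp_eq_exp_ℂ, smul_eq_mul]
  rw [mode, mul_comm, ← Complex.exp_add]
  simp only [shift, mul_add, Finset.sum_add_distrib, Finset.mul_sum, mul_assoc]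

theorem summable_comp {s : ℝ} (hs : 0 ≤ s) {u : Fin d ⊕ Fin d → Ham d ρ r hr}
    (hu : ∀ j, ‖u j‖ ≤ s) {c : Idx d → ℂ} (hc : MemA (ρ + 2 * Real.pi * s) (r + s) c) :
    Summable fun i => ‖c i • modeComp u i‖ := by
  refine Summable.of_nonneg_of_le (fun _ => norm_nonneg _) (fun i => ?_) hc
  rw [norm_smul]
  exact mul_le_mul_of_nonneg_left (norm_modeComp_le hs hu i) (norm_nonneg _)

theorem norm_comp_le {s : ℝ} (hs : 0 ≤ s) {u : Fin d ⊕ Fin d → Ham d ρ r hr}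
    (hu : ∀ j, ‖u j‖ ≤ s) {c : Idx d → ℂ} (hc : MemA (ρ + 2 * Real.pi * s) (r + s) c) :
    ‖comp c u‖ ≤ normA (ρ + 2 * Real.pi * s) (r + s) c := by
  have h := summable_comp hs hu hc
  refine (norm_tsum_le_tsum_norm h).trans (h.tsum_le_tsum (fun i => ?_) hc)
  rw [norm_smul]
  exact mul_le_mul_of_nonneg_left (norm_modeComp_le hs hu i) (norm_nonneg _)

theorem norm_comp_sub_le {s δ : ℝ} (hs : 0 ≤ s) (hδ : 0 ≤ δ)
    {u u' : Fin d ⊕ Fin d → Ham d ρ r hr} (hu : ∀ j, ‖u j‖ ≤ s) (hu' : ∀ j, ‖u' j‖ ≤ s)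
    (huu : ∀ j, ‖u j - u' j‖ ≤ δ) {c : Idx d → ℂ} (hc : MemA (ρ + 2 * Real.pi * s) (r + s) c)
    (hcg : MemG (ρ + 2 * Real.pi * s) (r + s) c) :
    ‖comp c u - comp c u'‖ ≤ gradA (ρ + 2 * Real.pi * s) (r + s) c * δ := by
  have h := summable_comp hs hu hc
  have h' := summable_comp hs hu' hc
  have hle : ∀ i, ‖c i • modeComp u i - c i • modeComp u' i‖ ≤
      ‖c i‖ * gradWeight (ρ + 2 * Real.pi * s) (r + s) i * δ := fun i => by
    rw [← smul_sub, norm_smul, mul_assoc]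
    exact mul_le_mul_of_nonneg_left (norm_modeComp_sub_le hs hδ hu hu' huu i) (norm_nonneg _)
  have hS : Summable fun i => ‖c i • modeComp u i - c i • modeComp u' i‖ :=
    Summable.of_nonneg_of_le (fun _ => norm_nonneg _) hle (Summable.mul_right δ hcg)
  rw [comp, comp, ← h.of_norm.tsum_sub h'.of_norm, gradA, ← tsum_mul_right]
  exact (norm_tsum_le_tsum_norm hS).trans (hS.tsum_le_tsum hle (Summable.mul_right δ hcg))

/-- Evaluation at a point is a continuous algebra homomorphism, so it passes through the series, the
exponentials and the products. The algebraic composition is therefore the composition of functions.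
-/
theorem eval_comp {s : ℝ} (hs : 0 ≤ s) {u : Fin d ⊕ Fin d → Ham d ρ r hr}
    (hu : ∀ j, ‖u j‖ ≤ s) {c : Idx d → ℂ} (hc : MemA (ρ + 2 * Real.pi * s) (r + s) c)
    {p : Phase d} (hp : p ∈ polydom d ρ r) :
    (comp c u).eval p = evalTF c (shift u p) := by
  have h := (summable_comp hs hu hc).of_norm.hasSum.map (Ham.evalHom p hp)
    (Ham.evalHom p hp).cont
  rw [evalTF_eq, ← Ham.evalHom_apply p hp, comp, ← h.tsum_eq]
  refine tsum_congr fun i => ?_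
  rw [Function.comp_apply, map_smul, Ham.evalHom_apply, eval_modeComp u i hp, smul_eq_mul]

theorem comp_add {s : ℝ} (hs : 0 ≤ s) {u : Fin d ⊕ Fin d → Ham d ρ r hr}
    (hu : ∀ j, ‖u j‖ ≤ s) {a b : Idx d → ℂ} (ha : MemA (ρ + 2 * Real.pi * s) (r + s) a)
    (hb : MemA (ρ + 2 * Real.pi * s) (r + s) b) : comp (a + b) u = comp a u + comp b u := by
  rw [comp, comp, comp, ← (summable_comp hs hu ha).of_norm.tsum_add
    (summable_comp hs hu hb).of_norm]
  exact tsum_congr fun i => add_smul _ _ _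

theorem coeff_comp_zero {c : Idx d → ℂ} (hc : MemA ρ r c) :
    comp c (0 : Fin d ⊕ Fin d → Ham d ρ r hr) = Ham.mk c hc := by
  have h0 : ∀ j, ‖(0 : Fin d ⊕ Fin d → Ham d ρ r hr) j‖ ≤ 0 := fun j => by simp
  refine Ham.ext_eval hρ.out.le fun p hp => ?_
  rw [eval_comp le_rfl h0 (by simpa using hc) hp, Ham.eval, Ham.coeff_mk]
  congr 1
  simp [shift, Ham.eval_zero]

end Comp

/-! ### Holomorphic dependence of compositions on a parameter. -/

section Holomorphy

variable {d : ℕ} {ρ r ρ' r' : ℝ} {hr : 0 < r} {hr' : 0 < r'}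

/-- The coefficient functionals. -/
noncomputable def Ham.coeffL (i : Idx d) : Ham d ρ r hr →L[ℂ] ℂ :=
  LinearMap.mkContinuous
    { toFun := fun a => a.coeff i
      map_add' := fun a b => by rw [Ham.coeff_add, Pi.add_apply]
      map_smul' := fun z a => by rw [Ham.coeff_smul, Pi.smul_apply, RingHom.id_apply] }
    (weight ρ r i)⁻¹ fun a => by
      have h := norm_coeff_mul_weight_le a i
      have hw := weight_pos ρ hr i
      rw [inv_mul_eq_div, le_div_iff₀ hw]
      exact h

theorem Ham.coeffL_apply (i : Idx d) (a : Ham d ρ r hr) : Ham.coeffL i a = a.coeff i := by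
  rw [Ham.coeffL, LinearMap.mkContinuous_apply, LinearMap.coe_mk, AddHom.coe_mk]

variable [hρ : Fact (0 < ρ)]

theorem differentiableAt_modeComp {u : ℂ → Fin d ⊕ Fin d → Ham d ρ r hr} {z : ℂ}
    (hu : ∀ j, DifferentiableAt ℂ (fun z => u z j) z) (i : Idx d) :
    DifferentiableAt ℂ (fun z => modeComp (u z) i) z := by
  have h1 : DifferentiableAt ℂ (fun z => phaseShift (u z) i.1) z := by
    unfold phaseShift
    exact DifferentiableAt.fun_sum fun j _ => (hu _).fun_const_smul _
  have h2 : DifferentiableAt ℂ (fun z => NormedSpace.exp (phaseShift (u z) i.1)) z :=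
    ((hasFDerivAt_exp (𝕂 := ℂ) (x := phaseShift (u z) i.1)).differentiableAt).comp z h1
  unfold modeComp
  exact (h2.const_mul _).mul (DifferentiableAt.fun_finsetProd
    fun j _ => ((hu (Sum.inr j)).const_add _).pow _)

/-- The composition depends holomorphically on both arguments. -/
theorem differentiableOn_comp {s : ℝ} (hs : 0 ≤ s) {U : Set ℂ} (hU : IsOpen U)
    {c : ℂ → Ham d ρ' r' hr'} (hc : DifferentiableOn ℂ c U)
    (hρ' : ρ + 2 * Real.pi * s ≤ ρ') (hr'' : r + s ≤ r')
    {u : ℂ → Fin d ⊕ Fin d → Ham d ρ r hr} (hu : ∀ j, DifferentiableOn ℂ (fun z => u z j) U)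
    (hus : ∀ z ∈ U, ∀ j, ‖u z j‖ ≤ s) :
    DifferentiableOn ℂ (fun z => comp (c z).coeff (u z)) U := by
  classical
  have hw : ∀ i : Idx d, weight (ρ + 2 * Real.pi * s) (r + s) i ≤ weight ρ' r' i :=
    fun i => weight_mono hρ' (by linarith) hr'' i
  have hterm : ∀ (a : Ham d ρ' r' hr') (z : ℂ), z ∈ U → ∀ i,
      ‖a.coeff i • modeComp (u z) i‖ ≤ ‖a.coeff i‖ * weight ρ' r' i := fun a z hz i => by
    rw [norm_smul]
    exact mul_le_mul_of_nonneg_left ((norm_modeComp_le hs (hus z hz) i).trans (hw i))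
      (norm_nonneg _)
  refine TendstoLocallyUniformlyOn.differentiableOn (φ := atTop)
    (F := fun (A : Finset (Idx d)) z => ∑ i ∈ A, (c z).coeff i • modeComp (u z) i) ?_ ?_ hU
  · rw [Metric.tendstoLocallyUniformlyOn_iff]
    intro ε hε z0 hz0
    have hcont : ContinuousWithinAt c U z0 := (hc.continuousOn) z0 hz0
    have h1 : ∀ᶠ z in 𝓝[U] z0, ‖c z - c z0‖ < ε / 2 := by
      have := Metric.tendsto_nhds.1 hcont (ε / 2) (by positivity)
      simpa only [dist_eq_norm] using this
    have hmem : Summable fun i => ‖(c z0).coeff i‖ * weight ρ' r' i := (c z0).mem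
    have h2' := tendsto_tsum_compl_atTop_zero
      (fun i : Idx d => ‖(c z0).coeff i‖ * weight ρ' r' i)
    have h2 := h2'.eventually (Iio_mem_nhds (half_pos hε))
    -- The finite set of modes is chosen for the tail of `c z0` only. Passing to `c z` costs ‖c z -
    -- c z0‖ < ε/2, because each composed mode is bounded by its weight uniformly in z.
    refine ⟨_, inter_mem h1 self_mem_nhdsWithin, ?_⟩
    filter_upwards [h2] with A hA z hz
    obtain ⟨hz1, hzU⟩ := hz
    have hsub : Summable fun i => ‖(c z - c z0).coeff i‖ * weight ρ' r' i := (c z - c z0).mem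
    have hle : ∀ i, ‖(c z).coeff i • modeComp (u z) i‖ ≤
        ‖(c z0).coeff i‖ * weight ρ' r' i + ‖(c z - c z0).coeff i‖ * weight ρ' r' i := by
      intro i
      refine (hterm _ z hzU _).trans ?_
      rw [← add_mul]
      refine mul_le_mul_of_nonneg_right ?_ (weight_pos _ hr' _).le
      have : (c z).coeff i = (c z0).coeff i + (c z - c z0).coeff i := by
        rw [Ham.coeff_sub, Pi.sub_apply, add_sub_cancel]
      rw [this]
      exact norm_add_le _ _
    have h3 := norm_tsum_sub_sum_le hmem hsub
      (fun i => mul_nonneg (norm_nonneg _) (weight_pos _ hr' _).le) hle A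
    have h4 : ∑' i, ‖(c z - c z0).coeff i‖ * weight ρ' r' i = ‖c z - c z0‖ := by
      rw [norm_def, normA]
    rw [h4] at h3
    have hA : ∑' i : {i // i ∉ A}, ‖(c z0).coeff (i : Idx d)‖ * weight ρ' r' (i : Idx d) < ε / 2 := hA
    have hz1 : ‖c z - c z0‖ < ε / 2 := hz1
    rw [dist_eq_norm, comp]
    linarith
  · refine Eventually.of_forall fun A => DifferentiableOn.fun_sum fun i _ => ?_
    intro z hz
    have hzU := hU.mem_nhds hz
    have h1 : DifferentiableAt ℂ (fun z => (c z).coeff i) z := by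
      have := (Ham.coeffL i : Ham d ρ' r' hr' →L[ℂ] ℂ).differentiableAt.comp z
        ((hc z hz).differentiableAt hzU)
      simpa only [Function.comp_def, Ham.coeffL_apply] using this
    exact (h1.smul (differentiableAt_modeComp
      (fun j => (hu j z hz).differentiableAt hzU) i)).differentiableWithinAt

end Holomorphy

/-! ### Analyticity of absolutely convergent series of monomials. -/

section PowerSeries

variable {ι I : Type*} [Fintype ι]

/-- A monomial of degree n is the diagonal of a product of n coordinate functionals, one slot for
each factor counted with multiplicity. -/
theorem exists_multilinear_monomial (α : ι → ℕ) (n : ℕ) :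
    ∃ N : ContinuousMultilinearMap ℂ (fun _ : Fin n => ι → ℂ) ℂ, ‖N‖ ≤ 1 ∧
      ∀ y, N (fun _ => y) = if ∑ j, α j = n then ∏ j, y j ^ α j else 0 := by
  by_cases h : ∑ j, α j = n
  · have hcard : Fintype.card (Σ j, Fin (α j)) = n := by simp [h]
    let e := Fintype.equivFinOfCardEq hcard
    refine ⟨(ContinuousMultilinearMap.mkPiAlgebra ℂ (Fin n) ℂ).compContinuousLinearMap
      (fun m => ContinuousLinearMap.proj (e.symm m).1), ?_, fun y => ?_⟩
    · refine (ContinuousMultilinearMap.norm_compContinuousLinearMap_le _ _).trans ?_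
      rw [ContinuousMultilinearMap.norm_mkPiAlgebra, one_mul]
      refine Finset.prod_le_one (fun _ _ => norm_nonneg _) fun m _ => ?_
      exact ContinuousLinearMap.opNorm_le_bound _ zero_le_one fun v => by
        rw [one_mul]; exact norm_le_pi_norm v _
    · rw [if_pos h]
      simp only [ContinuousMultilinearMap.compContinuousLinearMap_apply,
        ContinuousMultilinearMap.mkPiAlgebra_apply, ContinuousLinearMap.proj_apply]
      rw [Equiv.prod_comp e.symm (fun q : Σ j, Fin (α j) => y q.1), Fintype.prod_sigma]
      simp
  · exact ⟨0, by simp, fun y => by simp [h]⟩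

/-- An absolutely convergent series of monomials is analytic on the unit polydisc. -/
theorem analyticOnNhd_tsum_monomial {a : I → ℂ} (ha : Summable fun i => ‖a i‖)
    (α : I → ι → ℕ) :
    AnalyticOnNhd ℂ (fun y : ι → ℂ => ∑' i, a i * ∏ j, y j ^ α i j) (Metric.ball 0 1) := by
  choose N hN1 hN2 using fun i n => exists_multilinear_monomial (α i) n
  have hs : ∀ n, Summable fun i => ‖a i • N i n‖ := fun n => by
    refine Summable.of_nonneg_of_le (fun _ => norm_nonneg _) (fun i => ?_) ha
    rw [norm_smul]
    exact mul_le_of_le_one_right (norm_nonneg _) (hN1 i n)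
  let P : FormalMultilinearSeries ℂ (ι → ℂ) ℂ := fun n => ∑' i, a i • N i n
  have hP : HasFPowerSeriesOnBall (fun y : ι → ℂ => ∑' i, a i * ∏ j, y j ^ α i j) P 0 1 := by
    refine ⟨?_, one_pos, fun {y} hy => ?_⟩
    · have := P.le_radius_of_bound (r := 1) (∑' i, ‖a i‖) fun n => by
        rw [NNReal.coe_one, one_pow, mul_one]
        refine (norm_tsum_le_tsum_norm (hs n)).trans ((hs n).tsum_le_tsum (fun i => ?_) ha)
        rw [norm_smul]
        exact mul_le_of_le_one_right (norm_nonneg _) (hN1 i n)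
      simpa using this
    · have hy1 : ‖y‖ < 1 := by
        have h : ‖y‖ₑ < 1 := by simpa using hy
        rwa [← ofReal_norm, ENNReal.ofReal_lt_one] at h
      have hsum : Summable fun i => a i * ∏ j, y j ^ α i j := by
        refine Summable.of_norm (Summable.of_nonneg_of_le (fun _ => norm_nonneg _)
          (fun i => ?_) ha)
        rw [norm_mul, norm_prod]
        refine mul_le_of_le_one_right (norm_nonneg _) (Finset.prod_le_one
          (fun _ _ => norm_nonneg _) fun j _ => ?_)
        rw [norm_pow]
        exact pow_le_one₀ (norm_nonneg _) ((norm_le_pi_norm y j).trans hy1.le)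
      -- Grouping the monomials by total degree turns the series into a power series.
      have h1 := hsum.hasSum.tsum_fiberwise (fun i => ∑ j, α i j)
      rw [zero_add]
      refine h1.congr_fun fun n => ?_
      have h2 : P n (fun _ => y) = ∑' i, a i * N i n (fun _ => y) := by
        have h3 := ((hs n).of_norm.hasSum.mapL
          (ContinuousMultilinearMap.apply ℂ (fun _ : Fin n => ι → ℂ) ℂ (fun _ => y))).tsum_eq
        rw [ContinuousMultilinearMap.apply_apply] at h3
        exact h3.symm
      rw [h2, tsum_subtype ((fun i => ∑ j, α i j) ⁻¹' {n}) (fun i => a i * ∏ j, y j ^ α i j)]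
      refine tsum_congr fun i => ?_
      rw [hN2]
      by_cases h : ∑ j, α i j = n
      · rw [if_pos h, indicator_of_mem]
        exact h
      · rw [if_neg h, indicator_of_notMem, mul_zero]
        exact h
  have := hP.analyticOnNhd
  rwa [← ENNReal.coe_one, Metric.eball_coe, NNReal.coe_one] at this

end PowerSeries

/-! ### Analyticity of Taylor-Fourier series. -/

section Analytic

variable {d : ℕ} {ρ r : ℝ}

/-- Substitute exp(2πi x_j - ρ), exp(-2πi x_j - ρ) and y_j / r, all of modulus less than 1 at p. The
Taylor-Fourier series becomes an absolutely convergent series of monomials in these variables, with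
coefficients c_i times the weight. -/
theorem analyticAt_evalTF (hr : 0 < r) {c : Idx d → ℂ} (hc : MemA ρ r c) {p : Phase d}
    (hp : ∀ j, |(p.1 j).im| < ρ / (2 * Real.pi) ∧ ‖p.2 j‖ < r) : AnalyticAt ℂ (evalTF c) p := by
  let α : Idx d → (Fin d ⊕ Fin d) ⊕ Fin d → ℕ := fun i =>
    Sum.elim (Sum.elim (fun j => (i.1 j).toNat) (fun j => (-i.1 j).toNat)) i.2
  let a : Idx d → ℂ := fun i => c i * weight ρ r i
  have ha : Summable fun i => ‖a i‖ := by
    refine hc.congr fun i => ?_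
    simp only [a]
    rw [norm_mul, Complex.norm_real, Real.norm_of_nonneg (weight_pos ρ hr i).le]
  let Z : Phase d → (Fin d ⊕ Fin d) ⊕ Fin d → ℂ := fun q =>
    Sum.elim (Sum.elim (fun j => Complex.exp (2 * Real.pi * Complex.I * q.1 j - ρ))
      (fun j => Complex.exp (-(2 * Real.pi * Complex.I) * q.1 j - ρ))) (fun j => (r : ℂ)⁻¹ * q.2 j)
  have hx : ∀ j, AnalyticAt ℂ (fun q : Phase d => q.1 j) p := fun j =>
    ((ContinuousLinearMap.proj (R := ℂ) (φ := fun _ : Fin d => ℂ) j).comp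
      (ContinuousLinearMap.fst ℂ (Fin d → ℂ) (Fin d → ℂ))).analyticAt p
  have hy : ∀ j, AnalyticAt ℂ (fun q : Phase d => q.2 j) p := fun j =>
    ((ContinuousLinearMap.proj (R := ℂ) (φ := fun _ : Fin d => ℂ) j).comp
      (ContinuousLinearMap.snd ℂ (Fin d → ℂ) (Fin d → ℂ))).analyticAt p
  have hZ : AnalyticAt ℂ Z p := by
    refine analyticAt_pi_iff.2 ?_
    rintro ((j | j) | j)
    · exact ((analyticAt_const.mul (hx j)).sub analyticAt_const).cexp
    · exact ((analyticAt_const.mul (hx j)).sub analyticAt_const).cexp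
    · exact analyticAt_const.mul (hy j)
  have hZp : Z p ∈ Metric.ball (0 : (Fin d ⊕ Fin d) ⊕ Fin d → ℂ) 1 := by
    rw [mem_ball_zero_iff, pi_norm_lt_iff one_pos]
    rintro ((j | j) | j)
    · have h := (abs_lt.1 (hp j).1).1
      rw [neg_lt, lt_div_iff₀ (by positivity)] at h
      simp only [Z, Sum.elim_inl, Complex.norm_exp]
      rw [Real.exp_lt_one_iff]
      simp [Complex.mul_re, Complex.mul_im]
      linarith
    · have h := (abs_lt.1 (hp j).1).2
      rw [lt_div_iff₀ (by positivity)] at h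
      simp only [Z, Sum.elim_inl, Sum.elim_inr, Complex.norm_exp]
      rw [Real.exp_lt_one_iff]
      simp [Complex.mul_re, Complex.mul_im]
      linarith
    · simp only [Z, Sum.elim_inr]
      rw [norm_mul, norm_inv, Complex.norm_real, Real.norm_of_nonneg hr.le, inv_mul_eq_div,
        div_lt_one hr]
      exact (hp j).2
  have key := (analyticOnNhd_tsum_monomial ha α _ hZp).comp hZ
  refine key.congr (Eventually.of_forall fun q => ?_)
  rw [evalTF_eq, Function.comp_apply]
  refine tsum_congr fun i => ?_
  -- Positive and negative parts of k_j belong to different variables, and one of the two exponents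
  -- is zero; the product restores exp(2πi k_j x_j) and the factor exp(-ρ|k_j|).
  have hk : ∀ j, Complex.exp (2 * Real.pi * Complex.I * q.1 j - ρ) ^ (i.1 j).toNat *
      Complex.exp (-(2 * Real.pi * Complex.I) * q.1 j - ρ) ^ (-i.1 j).toNat =
      Complex.exp (2 * Real.pi * Complex.I * ((i.1 j : ℂ) * q.1 j)) *
        Complex.exp (-(ρ * |(i.1 j : ℝ)| : ℝ)) := by
    intro j
    rw [← Complex.exp_nat_mul, ← Complex.exp_nat_mul, ← Complex.exp_add, ← Complex.exp_add]
    congr 1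
    obtain ⟨n, hn | hn⟩ := (i.1 j).eq_nat_or_neg
    · simp [hn]; ring
    · simp [hn]; ring
  simp only [a, Fintype.prod_sum_type, α, Z, Sum.elim_inl, Sum.elim_inr]
  rw [← Finset.prod_mul_distrib, Finset.prod_congr rfl (fun j _ => hk j),
    Finset.prod_mul_distrib, ← Complex.exp_sum, ← Complex.exp_sum]
  simp only [mul_pow, Finset.prod_mul_distrib]
  rw [Finset.prod_pow_eq_pow_sum, mode, weight, Finset.mul_sum]
  have h1 : (r : ℂ) ^ deg i.2 * (r : ℂ)⁻¹ ^ ∑ j, i.2 j = 1 := by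
    rw [deg, ← mul_pow, mul_inv_cancel₀ (by exact_mod_cast hr.ne'), one_pow]
  have h2 : Complex.exp (ρ * (kNorm i.1 : ℝ)) *
      Complex.exp (∑ j, (-(ρ * |(i.1 j : ℝ)| : ℝ) : ℂ)) = 1 := by
    rw [← Complex.exp_add, Complex.exp_eq_one_iff]
    refine ⟨0, ?_⟩
    rw [kNorm, Finset.sum_neg_distrib, ← Complex.ofReal_sum, ← Finset.mul_sum]
    push_cast
    simp
  push_cast at h2 ⊢
  generalize (∏ j, q.2 j ^ i.2 j) = Y
  generalize Complex.exp (∑ j, 2 * (Real.pi : ℂ) * Complex.I * ((i.1 j : ℂ) * q.1 j)) = X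
  linear_combination (c i * Y * X) * (h1 * (Complex.exp (ρ * (kNorm i.1 : ℝ)) *
      Complex.exp (∑ j, -((ρ : ℂ) * |(i.1 j : ℝ)|))) + h2)

end Analytic

/-! ### Termwise differentiation. -/

section Derivative

variable {d : ℕ} {ρ r : ℝ}

/-- The coordinate function `x_j`. -/
noncomputable def dx (j : Fin d) : Phase d →L[ℂ] ℂ :=
  (ContinuousLinearMap.proj (R := ℂ) (φ := fun _ : Fin d => ℂ) j).comp
    (ContinuousLinearMap.fst ℂ (Fin d → ℂ) (Fin d → ℂ))

/-- The coordinate function `y_j`. -/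
noncomputable def dy (j : Fin d) : Phase d →L[ℂ] ℂ :=
  (ContinuousLinearMap.proj (R := ℂ) (φ := fun _ : Fin d => ℂ) j).comp
    (ContinuousLinearMap.snd ℂ (Fin d → ℂ) (Fin d → ℂ))

@[simp] theorem dx_apply (j : Fin d) (v : Phase d) : dx j v = v.1 j := rfl
@[simp] theorem dy_apply (j : Fin d) (v : Phase d) : dy j v = v.2 j := rfl

theorem norm_dx_le (j : Fin d) : ‖(dx j : Phase d →L[ℂ] ℂ)‖ ≤ 1 :=
  ContinuousLinearMap.opNorm_le_bound _ zero_le_one fun v => by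
    rw [one_mul, dx_apply]; exact (norm_le_pi_norm v.1 j).trans (norm_fst_le v)

theorem norm_dy_le (j : Fin d) : ‖(dy j : Phase d →L[ℂ] ℂ)‖ ≤ 1 :=
  ContinuousLinearMap.opNorm_le_bound _ zero_le_one fun v => by
    rw [one_mul, dy_apply]; exact (norm_le_pi_norm v.2 j).trans (norm_snd_le v)

/-- The derivative of a Taylor-Fourier mode. -/
noncomputable def modeDeriv (i : Idx d) (p : Phase d) : Phase d →L[ℂ] ℂ :=
  ∑ j, (2 * (Real.pi : ℂ) * Complex.I * (i.1 j : ℂ) * mode i p) • dx j +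
    ∑ j, ((i.2 j : ℂ) * mode (i.1, i.2 - Pi.single j 1) p) • dy j

theorem hasFDerivAt_mode (i : Idx d) (p : Phase d) :
    HasFDerivAt (mode i) (modeDeriv i p) p := by
  have h1 : HasFDerivAt (fun q : Phase d => ∏ j, q.2 j ^ i.2 j)
      (∑ j, (∏ l ∈ Finset.univ.erase j, p.2 l ^ i.2 l) •
        ((i.2 j : ℂ) * p.2 j ^ (i.2 j - 1)) • dy j) p := by
    have h : ∀ j ∈ Finset.univ, HasFDerivAt (fun q : Phase d => q.2 j ^ i.2 j)
        (((i.2 j : ℂ) * p.2 j ^ (i.2 j - 1)) • dy j) p := fun j _ => ?_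
    · have := HasFDerivAt.finsetProd h
      convert this using 1
    have := ((dy j : Phase d →L[ℂ] ℂ).hasFDerivAt (x := p)).pow (i.2 j)
    simpa [nsmul_eq_mul, mul_smul] using this
  have h2 : HasFDerivAt (fun q : Phase d =>
      Complex.exp (2 * (Real.pi : ℂ) * Complex.I * ∑ j, (i.1 j : ℂ) * q.1 j))
      (Complex.exp (2 * (Real.pi : ℂ) * Complex.I * ∑ j, (i.1 j : ℂ) * p.1 j) •
        ((2 * (Real.pi : ℂ) * Complex.I) • ∑ j, (i.1 j : ℂ) • dx j)) p := by
    refine HasFDerivAt.cexp (HasFDerivAt.const_mul (HasFDerivAt.fun_sum fun j _ => ?_) _)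
    exact ((dx j : Phase d →L[ℂ] ℂ).hasFDerivAt (x := p)).const_mul _
  refine (h1.mul h2).congr_fderiv ?_
  refine ContinuousLinearMap.ext fun v => ?_
  have h3 : ∀ j, (i.2 j : ℂ) * ((∏ l ∈ Finset.univ.erase j, p.2 l ^ i.2 l) *
      p.2 j ^ (i.2 j - 1)) = (i.2 j : ℂ) * ∏ l, p.2 l ^ (i.2 - Pi.single j 1 : Fin d → ℕ) l := by
    intro j
    rw [← Finset.prod_erase_mul _ _ (Finset.mem_univ j)]
    congr 2
    · exact Finset.prod_congr rfl fun l hl => by simp [Finset.ne_of_mem_erase hl]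
    · simp
  simp only [modeDeriv, add_apply, smul_apply,
    sum_apply, dx_apply, dy_apply, smul_eq_mul, Finset.mul_sum, mode]
  congr 1
  · exact Finset.sum_congr rfl fun j _ => by ring
  · refine Finset.sum_congr rfl fun j _ => ?_
    rw [← mul_assoc (i.2 j : ℂ) (∏ l, _), ← h3 j]
    ring

theorem norm_modeDeriv_le (hr : 0 ≤ r) {p : Phase d} (hp : p ∈ polydom d ρ r) (i : Idx d) :
    ‖modeDeriv i p‖ ≤ gradWeight ρ r i := by
  have hπ := Real.pi_pos
  rw [gradWeight_eq, modeDeriv]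
  refine (norm_add_le _ _).trans (add_le_add ((norm_sum_le _ _).trans
    (Finset.sum_le_sum fun j _ => ?_)) ((norm_sum_le _ _).trans (Finset.sum_le_sum fun j _ => ?_)))
  · have : ‖2 * (Real.pi : ℂ) * Complex.I * (i.1 j : ℂ)‖ = 2 * Real.pi * |(i.1 j : ℝ)| := by
      rw [← Complex.ofReal_intCast]
      simp [abs_of_pos Real.pi_pos]
    rw [norm_smul, norm_mul, this, mul_assoc (2 * Real.pi * |(i.1 j : ℝ)|) _ (Real.exp _)]
    refine (mul_le_of_le_one_right (by positivity) (norm_dx_le j)).trans ?_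
    exact mul_le_mul_of_nonneg_left (norm_mode_le hr hp i) (by positivity)
  · rw [norm_smul, norm_mul, Complex.norm_natCast]
    refine (mul_le_of_le_one_right (by positivity) (norm_dy_le j)).trans ?_
    rw [mul_assoc]
    by_cases h : i.2 j = 0
    · simp [h]
    have hd : deg i.2 = deg (i.2 - Pi.single j 1) + 1 := by
      have : i.2 = (i.2 - Pi.single j 1) + Pi.single j 1 := by
        funext l
        by_cases hl : l = j
        · subst hl; simp; omega
        · simp [hl]
      conv_lhs => rw [this, deg_add]
      simp [deg]
    have h2 := norm_mode_le hr hp (i.1, i.2 - Pi.single j 1)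
    rw [weight] at h2
    rw [hd, Nat.add_sub_cancel]
    exact mul_le_mul_of_nonneg_left h2 (by positivity)

theorem hasSum_coeffDy (j : Fin d) (c : Idx d → ℂ) (p : Phase d) (S : ℂ) :
    HasSum (fun i => coeffDy j c i * mode i p) S ↔
      HasSum (fun i : Idx d => c i * ((i.2 j : ℂ) * mode (i.1, i.2 - Pi.single j 1) p)) S := by
  have hinj : Function.Injective
      (fun i : Idx d => ((i.1, i.2 + Pi.single j 1) : Idx d)) := by
    intro i i2 h2
    simp only [Prod.mk.injEq, add_left_inj] at h2
    exact Prod.ext h2.1 h2.2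
  refine Iff.trans ?_ (hinj.hasSum_iff ?_)
  · refine iff_of_eq (congrArg (fun f => HasSum f S) (funext fun i => ?_))
    have h2 : i.2 + Pi.single j 1 - Pi.single j 1 = i.2 := by funext l; simp
    simp only [Function.comp, coeffDy, h2, Pi.add_apply, Pi.single_eq_same]
    push_cast
    ring
  · intro i hi
    have : i.2 j = 0 := by
      by_contra h
      refine hi ⟨(i.1, i.2 - Pi.single j 1), Prod.ext rfl (funext fun l => ?_)⟩
      by_cases hl : l = j
      · subst hl; simp; omega
      · simp [hl]
    simp [this]

theorem mem_polydom_of_mem_ball {p q : Phase d} {η : ℝ} (hp : p ∈ polydom d ρ r)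
    (hq : dist q p ≤ η) : q ∈ polydom d (ρ + 2 * Real.pi * η) (r + η) := by
  intro j
  rw [dist_eq_norm] at hq
  have h1 : ‖q.1 j - p.1 j‖ ≤ η := (norm_le_pi_norm (q - p).1 j).trans ((norm_fst_le _).trans hq)
  have h2 : ‖q.2 j - p.2 j‖ ≤ η := (norm_le_pi_norm (q - p).2 j).trans ((norm_snd_le _).trans hq)
  obtain ⟨hp1, hp2⟩ := hp j
  have hπ := Real.pi_pos
  constructor
  · have h3 : |(q.1 j).im - (p.1 j).im| ≤ η := (Complex.abs_im_le_norm (q.1 j - p.1 j)).trans h1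
    have h4 : (ρ + 2 * Real.pi * η) / (2 * Real.pi) = ρ / (2 * Real.pi) + η := by field_simp
    rw [h4]
    have := abs_sub_abs_le_abs_sub (q.1 j).im (p.1 j).im
    linarith
  · have := norm_sub_norm_le (q.2 j) (p.2 j)
    linarith

/-- The derivative of a Taylor-Fourier series. -/
noncomputable def derivTF (c : Idx d → ℂ) (p : Phase d) : Phase d →L[ℂ] ℂ :=
  ∑ j, evalTF (coeffDx j c) p • dx j + ∑ j, evalTF (coeffDy j c) p • dy j

/-- On the ball of radius η around p the derivatives of the modes are dominated by the gradient
weights of the larger domain, which are summable against c. -/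
theorem hasFDerivAt_evalTF_aux {ρ' r' η : ℝ} (hr : 0 < r) (hη : 0 < η)
    (hρ' : ρ + 2 * Real.pi * η ≤ ρ') (hr' : r + η ≤ r') {c : Idx d → ℂ}
    (hc : MemA ρ' r' c) (hg : MemG ρ' r' c) {p : Phase d} (hp : p ∈ polydom d ρ r) :
    HasFDerivAt (evalTF c) (derivTF c p) p := by
  have hmono : ∀ {q : Phase d}, q ∈ polydom d (ρ + 2 * Real.pi * η) (r + η) →
      q ∈ polydom d ρ' r' := fun hq j =>
    ⟨(hq j).1.trans (by gcongr), (hq j).2.trans hr'⟩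
  have hr0 : 0 ≤ r' := by linarith
  have hball : ∀ q ∈ Metric.ball p η, q ∈ polydom d ρ' r' := fun q hq =>
    hmono (mem_polydom_of_mem_ball hp (Metric.mem_ball.1 hq).le)
  have hpb := hball p (Metric.mem_ball_self hη)
  have hd := hasFDerivAt_tsum_of_isPreconnected (𝕜 := ℂ) (f := fun i q => c i * mode i q)
    (f' := fun i q => c i • modeDeriv i q) hg Metric.isOpen_ball
    (convex_ball p η).isPreconnected (fun i q _ => (hasFDerivAt_mode i q).const_mul (c i))
    (fun i q hq => by
      rw [norm_smul]
      exact mul_le_mul_of_nonneg_left (norm_modeDeriv_le hr0 (hball q hq) i) (norm_nonneg _))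
    (Metric.mem_ball_self hη) (hc.summable_mode hr0 hpb).of_norm (Metric.mem_ball_self hη)
  have he : (fun q => ∑' i, c i * mode i q) = evalTF c := funext fun q => (evalTF_eq c q).symm
  rw [he] at hd
  refine hd.congr_fderiv ?_
  obtain ⟨hgx, hgy⟩ := (memG_iff hr0 c).1 hg
  have hs : Summable fun i => c i • modeDeriv i p := by
    refine Summable.of_norm (Summable.of_nonneg_of_le (fun _ => norm_nonneg _) (fun i => ?_) hg)
    rw [norm_smul]
    exact mul_le_mul_of_nonneg_left (norm_modeDeriv_le hr0 hpb i) (norm_nonneg _)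
  refine ContinuousLinearMap.ext fun v => ?_
  have h1 := hs.hasSum.mapL (ContinuousLinearMap.apply ℂ ℂ v)
  refine h1.unique ?_
  have hx : ∀ j, HasSum (fun i => coeffDx j c i * mode i p) (evalTF (coeffDx j c) p) := fun j => by
    rw [evalTF_eq]; exact ((hgx j).summable_mode hr0 hpb).of_norm.hasSum
  have hy : ∀ j, HasSum (fun i : Idx d =>
      c i * ((i.2 j : ℂ) * mode (i.1, i.2 - Pi.single j 1) p)) (evalTF (coeffDy j c) p) := fun j => by
    rw [← hasSum_coeffDy, evalTF_eq]; exact ((hgy j).summable_mode hr0 hpb).of_norm.hasSum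
  have h2 := (hasSum_sum fun j (_ : j ∈ Finset.univ) => (hx j).mul_right (v.1 j)).add
    (hasSum_sum fun j (_ : j ∈ Finset.univ) => (hy j).mul_right (v.2 j))
  have h3 : ContinuousLinearMap.apply ℂ ℂ v (derivTF c p) =
      ∑ j, evalTF (coeffDx j c) p * v.1 j + ∑ j, evalTF (coeffDy j c) p * v.2 j := by
    simp [derivTF]
  have h4 : derivTF c p v = ∑ j, evalTF (coeffDx j c) p * v.1 j +
      ∑ j, evalTF (coeffDy j c) p * v.2 j := h3
  rw [h4]
  refine h2.congr_fun fun i => ?_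
  simp only [modeDeriv, ContinuousLinearMap.apply_apply, add_apply,
    smul_apply, sum_apply, dx_apply, dy_apply, smul_eq_mul,
    mul_add, Finset.mul_sum, coeffDx]
  congr 1
  · exact Finset.sum_congr rfl fun j _ => by ring
  · exact Finset.sum_congr rfl fun j _ => by ring

theorem hasFDerivAt_evalTF {ρ' r' : ℝ} (hr : 0 < r) (hρ' : ρ < ρ') (hr' : r < r')
    {c : Idx d → ℂ} (hc : MemA ρ' r' c) {p : Phase d} (hp : p ∈ polydom d ρ r) :
    HasFDerivAt (evalTF c) (derivTF c p) p := by
  have hπ := Real.pi_pos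
  -- One η is for the ball in which the series is differentiated termwise, the other for the Cauchy
  -- estimate that bounds the gradient there.
  obtain ⟨η, hη, h1, h2⟩ : ∃ η > 0, ρ + 2 * Real.pi * (2 * η) ≤ ρ' ∧ r + 2 * η ≤ r' := by
    refine ⟨min ((ρ' - ρ) / (4 * Real.pi)) ((r' - r) / 2), ?_, ?_, ?_⟩
    · exact lt_min (div_pos (by linarith) (by positivity)) (by linarith)
    · have := min_le_left ((ρ' - ρ) / (4 * Real.pi)) ((r' - r) / 2)
      rw [le_div_iff₀ (by positivity)] at this
      linarith
    · have := min_le_right ((ρ' - ρ) / (4 * Real.pi)) ((r' - r) / 2)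
      linarith
  have hg := (hc.cauchy (ρ := ρ + 2 * Real.pi * η) (r := r + η) hη (by linarith) (by linarith)
    (by linarith)).1
  refine hasFDerivAt_evalTF_aux hr hη le_rfl le_rfl (hc.mono ?_ (by linarith) (by linarith)) hg hp
  have : 0 ≤ 2 * Real.pi * η := by positivity
  linarith

end Derivative

/-! ### Linear symplectic maps from quadratic generating functions. -/

section Symplectic

variable {d : ℕ}

open Matrix in
/-- The linear symplectic map defined implicitly by a quadratic generating function. -/
theorem sympForm_of_generating (A C : Matrix (Fin d) (Fin d) ℂ) (B : Matrix (Fin d) (Fin d) ℂ)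
    (hA : A.IsSymm) (hC : C.IsSymm) {v w v' w' : Phase d}
    (hv1 : v'.1 = v.1 + Bᵀ *ᵥ v.1 + C *ᵥ v'.2) (hv2 : v'.2 = v.2 - A *ᵥ v.1 - B *ᵥ v'.2)
    (hw1 : w'.1 = w.1 + Bᵀ *ᵥ w.1 + C *ᵥ w'.2) (hw2 : w'.2 = w.2 - A *ᵥ w.1 - B *ᵥ w'.2) :
    sympForm v' w' = sympForm v w := by
  have e : ∀ a b : Phase d, sympForm a b = a.2 ⬝ᵥ b.1 - a.1 ⬝ᵥ b.2 := fun a b => by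
    simp [sympForm, dotProduct, Finset.sum_sub_distrib]
  have hs : ∀ (M : Matrix (Fin d) (Fin d) ℂ) (x y : Fin d → ℂ),
      x ⬝ᵥ (Mᵀ *ᵥ y) = (M *ᵥ x) ⬝ᵥ y := fun M x y => by
    rw [mulVec_transpose, dotProduct_comm, ← dotProduct_mulVec, dotProduct_comm]
  have hAs := hs A v.1 w.1
  have hCs := hs C v'.2 w'.2
  rw [hA.eq] at hAs
  rw [hC.eq] at hCs
  have hB1 := hs B v'.2 w.1
  have hB2 := hs B w'.2 v.1
  have f1 : v'.2 ⬝ᵥ w.1 + (B *ᵥ v'.2) ⬝ᵥ w.1 = v.2 ⬝ᵥ w.1 - (A *ᵥ v.1) ⬝ᵥ w.1 := by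
    have := congrArg (fun z => z ⬝ᵥ w.1) hv2
    simp only [sub_dotProduct] at this
    linear_combination this
  have f2 : v.1 ⬝ᵥ w'.2 + v.1 ⬝ᵥ (B *ᵥ w'.2) = v.1 ⬝ᵥ w.2 - v.1 ⬝ᵥ (A *ᵥ w.1) := by
    have := congrArg (fun z => v.1 ⬝ᵥ z) hw2
    simp only [dotProduct_sub] at this
    linear_combination this
  have f3 : v'.2 ⬝ᵥ w'.1 = v'.2 ⬝ᵥ w.1 + v'.2 ⬝ᵥ (Bᵀ *ᵥ w.1) + v'.2 ⬝ᵥ (C *ᵥ w'.2) := by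
    conv_lhs => rw [hw1]
    simp only [dotProduct_add]
  have f4 : v'.1 ⬝ᵥ w'.2 = v.1 ⬝ᵥ w'.2 + (Bᵀ *ᵥ v.1) ⬝ᵥ w'.2 + (C *ᵥ v'.2) ⬝ᵥ w'.2 := by
    conv_lhs => rw [hv1]
    simp only [add_dotProduct]
  have f5 : (Bᵀ *ᵥ v.1) ⬝ᵥ w'.2 = v.1 ⬝ᵥ (B *ᵥ w'.2) := by
    rw [dotProduct_comm, hB2, dotProduct_comm]
  -- The terms with C cancel by its symmetry and the mixed terms by transposition. The remaining
  -- terms with A cancel by the symmetry of A.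
  rw [e, e, f3, f4, f5, hB1, hCs]
  linear_combination f1 - f2 + hAs

end Symplectic

/-! ### The homological equation on the far modes. -/

section Solver

variable {d : ℕ} {ρ r : ℝ} {hr : 0 < r}

/-- The frequency `ω · k`. -/
noncomputable def freq (ω : Fin d → ℝ) (k : Fin d → ℤ) : ℝ := ∑ j, ω j * (k j : ℝ)

theorem MemA.of_le {a b : Idx d → ℂ} {C : ℝ} (hr : 0 < r) (ha : MemA ρ r a)
    (h : ∀ i, ‖b i‖ ≤ C * ‖a i‖) : MemA ρ r b ∧ normA ρ r b ≤ C * normA ρ r a := by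
  have hle : ∀ i, ‖b i‖ * weight ρ r i ≤ C * (‖a i‖ * weight ρ r i) := fun i => by
    rw [← mul_assoc]
    exact mul_le_mul_of_nonneg_right (h i) (weight_pos ρ hr i).le
  have hb : MemA ρ r b := Summable.of_nonneg_of_le
    (fun i => mul_nonneg (norm_nonneg _) (weight_pos ρ hr i).le) hle (Summable.mul_left C ha)
  refine ⟨hb, ?_⟩
  rw [normA, normA, ← tsum_mul_left]
  exact hb.tsum_le_tsum hle (Summable.mul_left C ha)

/-- A bounded linear operator given by its action on coefficients. -/
noncomputable def Ham.ofCoeffL (f : (Idx d → ℂ) →ₗ[ℂ] (Idx d → ℂ)) (C : ℝ)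
    (hf : ∀ a, MemA ρ r a → MemA ρ r (f a) ∧ normA ρ r (f a) ≤ C * normA ρ r a) :
    Ham d ρ r hr →L[ℂ] Ham d ρ r hr :=
  LinearMap.mkContinuous
    { toFun := fun a => Ham.mk (f a.coeff) (hf _ a.mem).1
      map_add' := fun a b => Ham.ext (by
        simp only [Ham.coeff_add, Ham.coeff_mk, map_add])
      map_smul' := fun z a => Ham.ext (by
        simp only [RingHom.id_apply, Ham.coeff_smul, Ham.coeff_mk, map_smul]) } C
    fun a => by
      rw [norm_def, norm_def]
      exact (hf _ a.mem).2

theorem Ham.coeff_ofCoeffL (f : (Idx d → ℂ) →ₗ[ℂ] (Idx d → ℂ)) (C : ℝ)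
    (hf : ∀ a, MemA ρ r a → MemA ρ r (f a) ∧ normA ρ r (f a) ≤ C * normA ρ r a)
    (a : Ham d ρ r hr) : (Ham.ofCoeffL f C hf a : Ham d ρ r hr).coeff = f a.coeff := by
  rw [Ham.ofCoeffL, LinearMap.mkContinuous_apply, LinearMap.coe_mk, AddHom.coe_mk, Ham.coeff_mk]

/-- The projection `𝕀⁻` on coefficients. -/
noncomputable def projFarLin (ω : Fin d → ℝ) (σ τ : ℝ) : (Idx d → ℂ) →ₗ[ℂ] (Idx d → ℂ) where
  toFun := projFar ω σ τ
  map_add' a b := by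
    funext i
    by_cases hi : i ∈ farModes ω σ τ <;> simp [projFar, hi]
  map_smul' z a := by
    funext i
    by_cases hi : i ∈ farModes ω σ τ <;> simp [projFar, hi]

theorem norm_projFar_le (ω : Fin d → ℝ) (σ τ : ℝ) (a : Idx d → ℂ) (i : Idx d) :
    ‖projFar ω σ τ a i‖ ≤ ‖a i‖ := norm_indicator_le_norm_self _ _

/-- The projection onto the far from resonance modes. -/
noncomputable def farL (ω : Fin d → ℝ) (σ τ : ℝ) : Ham d ρ r hr →L[ℂ] Ham d ρ r hr :=
  Ham.ofCoeffL (projFarLin ω σ τ) 1 fun a ha => ha.of_le hr fun i => by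
    rw [one_mul]; exact norm_projFar_le ω σ τ a i

theorem coeff_farL (ω : Fin d → ℝ) (σ τ : ℝ) (a : Ham d ρ r hr) :
    (farL ω σ τ a).coeff = projFar ω σ τ a.coeff := by
  rw [farL, Ham.coeff_ofCoeffL, projFarLin, LinearMap.coe_mk, AddHom.coe_mk]

theorem norm_farL_le (ω : Fin d → ℝ) (σ τ : ℝ) (a : Ham d ρ r hr) : ‖farL ω σ τ a‖ ≤ ‖a‖ := by
  have := (a.mem.of_le (b := projFar ω σ τ a.coeff) (C := 1) hr fun i => by
    rw [one_mul]; exact norm_projFar_le ω σ τ a.coeff i).2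
  rwa [one_mul, ← coeff_farL] at this

theorem farL_farL (ω : Fin d → ℝ) (σ τ : ℝ) (a : Ham d ρ r hr) :
    farL ω σ τ (farL ω σ τ a) = farL ω σ τ a := by
  refine Ham.ext ?_
  rw [coeff_farL, coeff_farL, projFar, projFar, indicator_indicator, inter_self]

open Classical in
/-- Coefficients of the generating function `G` with `ω · ∂_x G = a`. -/
noncomputable def genCoeff (ω : Fin d → ℝ) (σ τ : ℝ) (a : Idx d → ℂ) : Idx d → ℂ := fun i =>
  if i ∈ farModes ω σ τ then (2 * (Real.pi : ℂ) * Complex.I * (freq ω i.1 : ℂ))⁻¹ * a i else 0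

theorem freq_ne_zero {ω : Fin d → ℝ} {σ τ : ℝ} (hσ : 0 < σ) {i : Idx d}
    (hi : i ∈ farModes ω σ τ) : freq ω i.1 ≠ 0 := by
  intro h
  have h1 : σ * kNorm i.1 < |freq ω i.1| := hi.1
  rw [h, abs_zero] at h1
  have := mul_nonneg hσ.le (kNorm_nonneg i.1)
  linarith

theorem norm_two_pi_I_mul (x : ℝ) : ‖2 * (Real.pi : ℂ) * Complex.I * (x : ℂ)‖ =
    2 * Real.pi * |x| := by
  rw [norm_mul, norm_mul, norm_mul, Complex.norm_I, Complex.norm_real, Complex.norm_real,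
    Real.norm_eq_abs, Real.norm_eq_abs, abs_of_pos Real.pi_pos]
  simp

theorem norm_genCoeff {ω : Fin d → ℝ} {σ τ : ℝ} {i : Idx d} (hi : i ∈ farModes ω σ τ)
    (a : Idx d → ℂ) : ‖genCoeff ω σ τ a i‖ = ‖a i‖ / (2 * Real.pi * |freq ω i.1|) := by
  rw [genCoeff, if_pos hi, norm_mul, norm_inv, norm_two_pi_I_mul, inv_mul_eq_div]

theorem genCoeff_of_notMem {ω : Fin d → ℝ} {σ τ : ℝ} {i : Idx d} (hi : i ∉ farModes ω σ τ)
    (a : Idx d → ℂ) : genCoeff ω σ τ a i = 0 := if_neg hi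

theorem genCoeff_add (ω : Fin d → ℝ) (σ τ : ℝ) (a b : Idx d → ℂ) :
    genCoeff ω σ τ (a + b) = genCoeff ω σ τ a + genCoeff ω σ τ b := by
  funext i
  simp only [genCoeff, Pi.add_apply]
  split_ifs <;> ring

theorem genCoeff_smul (ω : Fin d → ℝ) (σ τ : ℝ) (z : ℂ) (a : Idx d → ℂ) :
    genCoeff ω σ τ (z • a) = z • genCoeff ω σ τ a := by
  funext i
  simp only [genCoeff, Pi.smul_apply, smul_eq_mul]
  split_ifs <;> ring

/-- Dividing by 2πω·k compensates the derivatives. In x one has ‖k‖ < |ω·k|/σ, and in y the factor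
‖ν‖/r is less than τ‖k‖/r, which reduces to the first case. No domain is lost. -/
theorem norm_genCoeff_mul_gradWeight_le {ω : Fin d → ℝ} {σ τ : ℝ} (hσ : 0 < σ) (hτ : 0 < τ)
    (hr : 0 < r) (a : Idx d → ℂ) (i : Idx d) :
    ‖genCoeff ω σ τ a i‖ * gradWeight ρ r i ≤
      (1 / σ * (1 + τ / r)) * (‖a i‖ * weight ρ r i) := by
  by_cases hi : i ∈ farModes ω σ τ
  · have hf : 0 < |freq ω i.1| := abs_pos.2 (freq_ne_zero hσ hi)
    have h1 : σ * kNorm i.1 < |freq ω i.1| := hi.1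
    have h2 : (deg i.2 : ℝ) < τ * kNorm i.1 := hi.2
    have hk := kNorm_nonneg i.1
    have hπ := Real.pi_pos
    have h3 : (deg i.2 : ℝ) * r ^ (deg i.2 - 1) = deg i.2 / r * r ^ deg i.2 := by
      rcases h : deg i.2 with _ | n
      · simp
      · rw [Nat.add_sub_cancel, pow_succ]; field_simp
    have h4 : gradWeight ρ r i = (2 * Real.pi * kNorm i.1 + deg i.2 / r) * weight ρ r i := by
      rw [gradWeight, h3, weight]; ring
    have h5 : (2 * Real.pi * kNorm i.1 + deg i.2 / r) ≤
        (1 / σ * (1 + τ / r)) * (2 * Real.pi * |freq ω i.1|) := by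
      have h6 : kNorm i.1 ≤ |freq ω i.1| / σ := by rw [le_div_iff₀ hσ]; linarith
      have h7 : (deg i.2 : ℝ) / r ≤ τ / r * (2 * Real.pi * kNorm i.1) := by
        rw [div_mul_eq_mul_div]
        gcongr
        have : 1 ≤ 2 * Real.pi := by linarith [Real.pi_gt_three]
        nlinarith [mul_nonneg hτ.le hk]
      calc _ ≤ (1 + τ / r) * (2 * Real.pi * kNorm i.1) := by linarith
        _ ≤ (1 + τ / r) * (2 * Real.pi * (|freq ω i.1| / σ)) := by gcongr
        _ = _ := by field_simp
    rw [norm_genCoeff hi, h4, div_mul_eq_mul_div, div_le_iff₀ (by positivity)]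
    have hw := weight_pos ρ hr i
    calc _ = (2 * Real.pi * kNorm i.1 + deg i.2 / r) * (‖a i‖ * weight ρ r i) := by ring
      _ ≤ (1 / σ * (1 + τ / r)) * (2 * Real.pi * |freq ω i.1|) * (‖a i‖ * weight ρ r i) := by
          gcongr
      _ = _ := by ring
  · rw [genCoeff_of_notMem hi, norm_zero, zero_mul]
    have hw := weight_pos ρ hr i
    positivity

theorem memG_genCoeff {ω : Fin d → ℝ} {σ τ : ℝ} (hσ : 0 < σ) (hτ : 0 < τ)
    (hr : 0 < r) {a : Idx d → ℂ} (ha : MemA ρ r a) : MemG ρ r (genCoeff ω σ τ a) ∧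
    gradA ρ r (genCoeff ω σ τ a) ≤ (1 / σ * (1 + τ / r)) * normA ρ r a := by
  have hle := norm_genCoeff_mul_gradWeight_le (ρ := ρ) (ω := ω) hσ hτ hr a
  have h : MemG ρ r (genCoeff ω σ τ a) := Summable.of_nonneg_of_le
    (fun i => mul_nonneg (norm_nonneg _) (gradWeight_nonneg hr.le i)) hle (Summable.mul_left _ ha)
  refine ⟨h, ?_⟩
  rw [gradA, normA, ← tsum_mul_left]
  exact h.tsum_le_tsum hle (Summable.mul_left _ ha)

/-- The x-derivatives alone satisfy a bound without τ. It is the one needed for the quadratic part,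
since the hypothesis on Q compares it with σ only. -/
theorem sum_normA_coeffDx_genCoeff_le {ω : Fin d → ℝ} {σ τ : ℝ} (hσ : 0 < σ) (hτ : 0 < τ)
    (hr : 0 < r) {a : Idx d → ℂ} (ha : MemA ρ r a) :
    ∑ j, normA ρ r (coeffDx j (genCoeff ω σ τ a)) ≤ 1 / σ * normA ρ r a := by
  have hm := ((memG_iff hr.le _).1 (memG_genCoeff (ω := ω) hσ hτ hr ha).1).1
  have hs : Summable fun i => ∑ j, ‖coeffDx j (genCoeff ω σ τ a) i‖ * weight ρ r i :=
    summable_sum fun j _ => hm j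
  simp only [normA]
  rw [← Summable.tsum_finsetSum fun j _ => hm j, ← tsum_mul_left]
  refine hs.tsum_le_tsum (fun i => ?_) (Summable.mul_left _ ha)
  have hw := weight_pos ρ hr i
  have hπ := Real.pi_pos
  rw [← Finset.sum_mul, ← mul_assoc]
  refine mul_le_mul_of_nonneg_right ?_ hw.le
  have h1 : ∀ j, ‖coeffDx j (genCoeff ω σ τ a) i‖ =
      2 * Real.pi * |(i.1 j : ℝ)| * ‖genCoeff ω σ τ a i‖ := fun j => by
    have := norm_two_pi_I_mul (i.1 j : ℝ)
    rw [Complex.ofReal_intCast] at this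
    rw [coeffDx, norm_mul, this]
  simp only [h1]
  rw [← Finset.sum_mul, ← Finset.mul_sum]
  change 2 * Real.pi * kNorm i.1 * _ ≤ _
  by_cases hi : i ∈ farModes ω σ τ
  · have hf : 0 < |freq ω i.1| := abs_pos.2 (freq_ne_zero hσ hi)
    have h2 : σ * kNorm i.1 < |freq ω i.1| := hi.1
    rw [norm_genCoeff hi, one_div, inv_mul_eq_div, mul_div_assoc', div_le_div_iff₀ (by positivity) hσ]
    have h3 := mul_le_mul_of_nonneg_left h2.le (by positivity : 0 ≤ 2 * Real.pi * ‖a i‖)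
    linarith
  · rw [genCoeff_of_notMem hi, norm_zero, mul_zero]
    positivity

/-- `a ↦ ∂_{x_j} G` on coefficients. -/
noncomputable def genDxLin (ω : Fin d → ℝ) (σ τ : ℝ) (j : Fin d) :
    (Idx d → ℂ) →ₗ[ℂ] (Idx d → ℂ) where
  toFun a := coeffDx j (genCoeff ω σ τ a)
  map_add' a b := by rw [genCoeff_add, coeffDx_add]
  map_smul' z a := by rw [genCoeff_smul, coeffDx_smul, RingHom.id_apply]

/-- `a ↦ ∂_{y_j} G` on coefficients. -/
noncomputable def genDyLin (ω : Fin d → ℝ) (σ τ : ℝ) (j : Fin d) :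
    (Idx d → ℂ) →ₗ[ℂ] (Idx d → ℂ) where
  toFun a := coeffDy j (genCoeff ω σ τ a)
  map_add' a b := by rw [genCoeff_add, coeffDy_add]
  map_smul' z a := by rw [genCoeff_smul, coeffDy_smul, RingHom.id_apply]

theorem normGrad_genCoeff_le {ω : Fin d → ℝ} {σ τ : ℝ} (hσ : 0 < σ) (hτ : 0 < τ)
    (hr : 0 < r) {a : Idx d → ℂ} (ha : MemA ρ r a) :
    normGrad ρ r (genCoeff ω σ τ a) ≤ (1 / σ * (1 + τ / r)) * normA ρ r a := by
  have h := memG_genCoeff (ω := ω) hσ hτ hr ha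
  rw [normGrad_eq_gradA hr.le h.1]
  exact h.2

theorem genDxLin_bound {ω : Fin d → ℝ} {σ τ : ℝ} (hσ : 0 < σ) (hτ : 0 < τ)
    (hr : 0 < r) (j : Fin d) (a : Idx d → ℂ) (ha : MemA ρ r a) :
    MemA ρ r (genDxLin ω σ τ j a) ∧
      normA ρ r (genDxLin ω σ τ j a) ≤ (1 / σ * (1 + τ / r)) * normA ρ r a := by
  refine ⟨((memG_iff hr.le _).1 (memG_genCoeff (ω := ω) hσ hτ hr ha).1).1 j,
    le_trans ?_ (normGrad_genCoeff_le (ω := ω) hσ hτ hr ha)⟩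
  refine le_trans ?_ (le_add_of_nonneg_right (Finset.sum_nonneg fun _ _ => normA_nonneg hr))
  exact Finset.single_le_sum (f := fun j => normA ρ r (coeffDx j (genCoeff ω σ τ a)))
    (fun _ _ => normA_nonneg hr) (Finset.mem_univ j)

theorem genDyLin_bound {ω : Fin d → ℝ} {σ τ : ℝ} (hσ : 0 < σ) (hτ : 0 < τ)
    (hr : 0 < r) (j : Fin d) (a : Idx d → ℂ) (ha : MemA ρ r a) :
    MemA ρ r (genDyLin ω σ τ j a) ∧
      normA ρ r (genDyLin ω σ τ j a) ≤ (1 / σ * (1 + τ / r)) * normA ρ r a := by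
  refine ⟨((memG_iff hr.le _).1 (memG_genCoeff (ω := ω) hσ hτ hr ha).1).2 j,
    le_trans ?_ (normGrad_genCoeff_le (ω := ω) hσ hτ hr ha)⟩
  refine le_trans ?_ (le_add_of_nonneg_left (Finset.sum_nonneg fun _ _ => normA_nonneg hr))
  exact Finset.single_le_sum (f := fun j => normA ρ r (coeffDy j (genCoeff ω σ τ a)))
    (fun _ _ => normA_nonneg hr) (Finset.mem_univ j)

variable (ω : Fin d → ℝ) (Q : Matrix (Fin d) (Fin d) ℂ) {σ τ : ℝ} (hσ : 0 < σ) (hτ : 0 < τ)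

/-- `a ↦ ∂_{x_j} G`. -/
noncomputable def genDx (j : Fin d) : Ham d ρ r hr →L[ℂ] Ham d ρ r hr :=
  Ham.ofCoeffL (genDxLin ω σ τ j) _ (genDxLin_bound hσ hτ hr j)

/-- `a ↦ ∂_{y_j} G`. -/
noncomputable def genDy (j : Fin d) : Ham d ρ r hr →L[ℂ] Ham d ρ r hr :=
  Ham.ofCoeffL (genDyLin ω σ τ j) _ (genDyLin_bound hσ hτ hr j)

theorem coeff_genDx (j : Fin d) (a : Ham d ρ r hr) :
    (genDx ω hσ hτ j a).coeff = coeffDx j (genCoeff ω σ τ a.coeff) := by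
  rw [genDx, Ham.coeff_ofCoeffL, genDxLin, LinearMap.coe_mk, AddHom.coe_mk]

theorem coeff_genDy (j : Fin d) (a : Ham d ρ r hr) :
    (genDy ω hσ hτ j a).coeff = coeffDy j (genCoeff ω σ τ a.coeff) := by
  rw [genDy, Ham.coeff_ofCoeffL, genDyLin, LinearMap.coe_mk, AddHom.coe_mk]

theorem sum_norm_genDx_le (a : Ham d ρ r hr) :
    ∑ j, ‖genDx ω hσ hτ j a‖ ≤ 1 / σ * ‖a‖ := by
  have h := sum_normA_coeffDx_genCoeff_le (ω := ω) hσ hτ hr a.mem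
  simpa only [norm_def, coeff_genDx] using h

theorem sum_norm_gen_le (a : Ham d ρ r hr) :
    ∑ j, ‖genDx ω hσ hτ j a‖ + ∑ j, ‖genDy ω hσ hτ j a‖ ≤ (1 / σ * (1 + τ / r)) * ‖a‖ := by
  have h := normGrad_genCoeff_le (ω := ω) hσ hτ hr a.mem
  simpa only [normGrad, norm_def, coeff_genDx, coeff_genDy] using h

/-- The unknown of the homological equation is thus a = ω·∂_xG rather than G itself. -/
theorem sum_freq_genDx (a : Ham d ρ r hr) :
    ∑ j, (ω j : ℂ) • genDx ω hσ hτ j a = farL ω σ τ a := by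
  have hsum : ∀ (s : Finset (Fin d)) (f : Fin d → Ham d ρ r hr) (i : Idx d),
      (∑ j ∈ s, f j).coeff i = ∑ j ∈ s, (f j).coeff i := fun s f i => by
    simp only [← Ham.coeffL_apply, map_sum]
  refine Ham.ext (funext fun i => ?_)
  rw [hsum, coeff_farL]
  simp only [Ham.coeff_smul, coeff_genDx, Pi.smul_apply, smul_eq_mul, coeffDx]
  by_cases hi : i ∈ farModes ω σ τ
  · have hf : (freq ω i.1 : ℂ) ≠ 0 := by exact_mod_cast freq_ne_zero hσ hi
    have hf2 : (freq ω i.1 : ℂ) = ∑ j, (ω j : ℂ) * (i.1 j : ℂ) := by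
      rw [freq]; push_cast; rfl
    have hπ : (Real.pi : ℂ) ≠ 0 := by exact_mod_cast Real.pi_ne_zero
    rw [projFar, indicator_of_mem hi, genCoeff, if_pos hi]
    have : ∀ j, (ω j : ℂ) * (2 * (Real.pi : ℂ) * Complex.I * (i.1 j : ℂ) *
        ((2 * (Real.pi : ℂ) * Complex.I * (freq ω i.1 : ℂ))⁻¹ * a.coeff i)) =
        ((ω j : ℂ) * (i.1 j : ℂ)) * ((freq ω i.1 : ℂ)⁻¹ * a.coeff i) := fun j => by
      have := Complex.I_ne_zero
      field_simp
    simp only [this]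
    rw [← Finset.sum_mul, ← hf2, mul_inv_cancel_left₀ hf]
  · rw [projFar, indicator_of_notMem hi]
    simp [genCoeff_of_notMem hi]

/-- The Hamiltonian `(Q y)_i`. -/
noncomputable def linY (i : Fin d) : Ham d ρ r hr :=
  ∑ j, Q i j • Ham.single (0, Pi.single j 1) 1

theorem norm_linY_le (i : Fin d) : ‖(linY Q i : Ham d ρ r hr)‖ ≤ r * ∑ j, ‖Q i j‖ := by
  rw [linY, Finset.mul_sum]
  refine (norm_sum_le _ _).trans (Finset.sum_le_sum fun j _ => le_of_eq ?_)
  rw [norm_smul, Ham.norm_single]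
  simp [weight, deg, kNorm, mul_comm]

theorem sum_le_matNorm (j : Fin d) : ∑ i, ‖Q i j‖ ≤ matNorm Q :=
  le_ciSup (f := fun j => ∑ i, ‖Q i j‖) (Set.finite_range _).bddAbove j

theorem matNorm_nonneg : 0 ≤ matNorm Q :=
  Real.iSup_nonneg fun _ => Finset.sum_nonneg fun _ _ => norm_nonneg _

variable {Q} in
-- The components of Qy involve row sums while the matrix norm uses column sums; symmetry of Q
-- identifies them.
theorem norm_linY_le_matNorm (hQ : Q.IsSymm) (i : Fin d) :
    ‖(linY Q i : Ham d ρ r hr)‖ ≤ r * matNorm Q := by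
  refine (norm_linY_le Q i).trans (mul_le_mul_of_nonneg_left ?_ hr.le)
  have := sum_le_matNorm Q i
  simpa only [hQ.apply] using this

variable [hρ : Fact (0 < ρ)]

/-- The perturbation of `ω · ∂_x` caused by the quadratic part. -/
noncomputable def quadOp : Ham d ρ r hr →L[ℂ] Ham d ρ r hr :=
  ∑ i, (farL ω σ τ).comp ((ContinuousLinearMap.mul ℂ (Ham d ρ r hr) (linY Q i)).comp
    (genDx ω hσ hτ i))

theorem quadOp_apply (a : Ham d ρ r hr) :
    quadOp ω Q hσ hτ a = farL ω σ τ (∑ i, linY Q i * genDx ω hσ hτ i a) := by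
  simp [quadOp]

variable {Q} in
theorem norm_quadOp_apply_le (hQ : Q.IsSymm) (a : Ham d ρ r hr) :
    ‖quadOp ω Q hσ hτ a‖ ≤ r * matNorm Q / σ * ‖a‖ := by
  rw [quadOp_apply]
  refine (norm_farL_le _ _ _ _).trans ((norm_sum_le _ _).trans ?_)
  have h0 : 0 ≤ r * matNorm Q := mul_nonneg hr.le (matNorm_nonneg Q)
  calc _ ≤ ∑ i, r * matNorm Q * ‖genDx ω hσ hτ i a‖ := Finset.sum_le_sum fun i _ =>
        (norm_mul_le _ _).trans (mul_le_mul_of_nonneg_right (norm_linY_le_matNorm hQ i)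
          (norm_nonneg _))
    _ = r * matNorm Q * ∑ i, ‖genDx ω hσ hτ i a‖ := by rw [Finset.mul_sum]
    _ ≤ r * matNorm Q * (1 / σ * ‖a‖) :=
        mul_le_mul_of_nonneg_left (sum_norm_genDx_le ω hσ hτ a) h0
    _ = _ := by ring

/-- The solution operator of the homological equation. -/
noncomputable def solveL : Ham d ρ r hr →L[ℂ] Ham d ρ r hr :=
  (Ring.inverse (1 + quadOp ω Q hσ hτ)).comp (farL ω σ τ)

variable {Q}

theorem norm_quadOp_le (hQ : Q.IsSymm) (h : 2 * r * matNorm Q ≤ σ) :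
    ‖(quadOp ω Q hσ hτ : Ham d ρ r hr →L[ℂ] Ham d ρ r hr)‖ ≤ 1 / 2 := by
  refine ContinuousLinearMap.opNorm_le_bound _ (by norm_num) fun a =>
    (norm_quadOp_apply_le ω hσ hτ hQ a).trans (mul_le_mul_of_nonneg_right ?_ (norm_nonneg _))
  rw [div_le_iff₀ hσ]
  linarith

theorem solveL_add (hQ : Q.IsSymm) (h : 2 * r * matNorm Q ≤ σ) (c : Ham d ρ r hr) :
    solveL ω Q hσ hτ c + quadOp ω Q hσ hτ (solveL ω Q hσ hτ c) = farL ω σ τ c := by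
  have hn := norm_quadOp_le (ρ := ρ) (hr := hr) ω hσ hτ hQ h
  have hu : IsUnit (1 + quadOp ω Q hσ hτ : Ham d ρ r hr →L[ℂ] Ham d ρ r hr) := by
    have := (Units.oneSub (-(quadOp ω Q hσ hτ : Ham d ρ r hr →L[ℂ] Ham d ρ r hr))
      (by rw [norm_neg]; linarith)).isUnit
    simpa using this
  have h1 := Ring.mul_inverse_cancel _ hu
  have h2 := congrArg (fun T : Ham d ρ r hr →L[ℂ] Ham d ρ r hr => T (farL ω σ τ c)) h1
  simpa [solveL] using h2

/-- The solution is the far part minus a term of at most half its own norm, which is absorbed on the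
left. -/
theorem norm_solveL_le (hQ : Q.IsSymm) (h : 2 * r * matNorm Q ≤ σ) (c : Ham d ρ r hr) :
    ‖solveL ω Q hσ hτ c‖ ≤ 2 * ‖farL ω σ τ c‖ := by
  have h1 := solveL_add ω hσ hτ hQ h c
  have hn := norm_quadOp_le (ρ := ρ) (hr := hr) ω hσ hτ hQ h
  have h2 : solveL ω Q hσ hτ c = farL ω σ τ c - quadOp ω Q hσ hτ (solveL ω Q hσ hτ c) :=
    eq_sub_of_add_eq h1
  have h3 := norm_sub_le (farL ω σ τ c) (quadOp ω Q hσ hτ (solveL ω Q hσ hτ c))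
  rw [← h2] at h3
  have h4 := ContinuousLinearMap.le_of_opNorm_le _ hn (solveL ω Q hσ hτ c)
  linarith

/-- The homological equation. -/
theorem farL_homological (hQ : Q.IsSymm) (h : 2 * r * matNorm Q ≤ σ) (c : Ham d ρ r hr) :
    farL ω σ τ (∑ i, ((ω i : ℂ) • (1 : Ham d ρ r hr) + linY Q i) *
      genDx ω hσ hτ i (solveL ω Q hσ hτ c)) = farL ω σ τ c := by
  have h1 := solveL_add ω hσ hτ hQ h c
  set a := solveL ω Q hσ hτ c
  -- The equation itself exhibits the solution as a value of the projection.
  have h2 : farL ω σ τ a = a := by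
    have h3 : a = farL ω σ τ (c - ∑ i, linY Q i * genDx ω hσ hτ i a) := by
      rw [map_sub, ← quadOp_apply, ← h1, add_sub_cancel_right]
    conv_lhs => rw [h3, farL_farL, ← h3]
  simp only [add_mul, smul_mul_assoc, one_mul, Finset.sum_add_distrib]
  rw [sum_freq_genDx, map_add, farL_farL, ← quadOp_apply, h2]
  exact h1

end Solver

/-! ### Limits of geometrically convergent sequences. -/

section GeometricLimit

variable {E : Type*} [NormedAddCommGroup E] [CompleteSpace E]

theorem tendsto_limUnder_of_geometric {f : ℕ → E} {C θ : ℝ} (hθ : θ < 1)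
    (hf : ∀ k, ‖f (k + 1) - f k‖ ≤ C * θ ^ k) :
    Tendsto f atTop (𝓝 (limUnder atTop f)) := by
  have : CauchySeq f := cauchySeq_of_le_geometric θ C hθ fun k => by
    rw [dist_comm, dist_eq_norm]; exact hf k
  exact this.tendsto_limUnder

/-- A bound for the increments that does not depend on z makes the convergence uniform, and uniform
limits of holomorphic functions are holomorphic. -/
theorem differentiableOn_limUnder_of_geometric [NormedSpace ℂ E] {f : ℕ → ℂ → E} {C θ : ℝ}
    (hθ0 : 0 ≤ θ) (hθ : θ < 1)
    {U : Set ℂ} (hU : IsOpen U) (hd : ∀ k, DifferentiableOn ℂ (f k) U)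
    (hf : ∀ z ∈ U, ∀ k, ‖f (k + 1) z - f k z‖ ≤ C * θ ^ k) :
    DifferentiableOn ℂ (fun z => limUnder atTop fun k => f k z) U := by
  refine TendstoLocallyUniformlyOn.differentiableOn (φ := atTop) (F := f) ?_
    (Eventually.of_forall hd) hU
  refine TendstoUniformlyOn.tendstoLocallyUniformlyOn ?_
  rw [Metric.tendstoUniformlyOn_iff]
  intro ε hε
  have h0 : Tendsto (fun k => C * θ ^ k / (1 - θ)) atTop (𝓝 0) := by
    have := ((tendsto_pow_atTop_nhds_zero_of_lt_one hθ0 hθ).const_mul C).div_const (1 - θ)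
    simpa using this
  filter_upwards [h0.eventually (Iio_mem_nhds hε)] with k hk z hz
  rw [dist_comm]
  refine lt_of_le_of_lt ?_ hk
  refine dist_le_of_le_geometric_of_tendsto θ C hθ (fun k => ?_)
    (tendsto_limUnder_of_geometric (f := fun k => f k z) hθ (hf z hz)) k
  rw [dist_comm, dist_eq_norm]
  exact hf z hz k

end GeometricLimit

/-! ### Symplectic maps from generating functions, by a fixed point iteration. -/

section Step

variable {d : ℕ} {ρ r ρ₁ r₁ δ : ℝ} {hr : 0 < r} {hr₁ : 0 < r₁}

/-- The perturbation of the identity that only changes `y`. -/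
noncomputable def yShift (w : Fin d → Ham d ρ₁ r₁ hr₁) : Fin d ⊕ Fin d → Ham d ρ₁ r₁ hr₁ :=
  Sum.elim 0 w

theorem norm_yShift_le {s : ℝ} (hs : 0 ≤ s) {w : Fin d → Ham d ρ₁ r₁ hr₁}
    (hw : ∀ j, ‖w j‖ ≤ s) (j : Fin d ⊕ Fin d) : ‖yShift w j‖ ≤ s := by
  rcases j with j | j
  · simpa [yShift] using hs
  · exact hw j

theorem norm_yShift_sub_le {s : ℝ} (hs : 0 ≤ s) {w w' : Fin d → Ham d ρ₁ r₁ hr₁}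
    (hw : ∀ j, ‖w j - w' j‖ ≤ s) (j : Fin d ⊕ Fin d) : ‖yShift w j - yShift w' j‖ ≤ s := by
  rcases j with j | j
  · simpa [yShift] using hs
  · exact hw j

/-- The room `δ` between the domain `(ρ₁, r₁)` and the larger domain `(ρ, r)`. -/
structure Gap (ρ r ρ₁ r₁ δ : ℝ) : Prop where
  pos : 0 < δ
  le_fst : ρ₁ + 2 * Real.pi * δ ≤ ρ
  le_snd : r₁ + δ ≤ r

theorem Gap.half_fst (h : Gap ρ r ρ₁ r₁ δ) : ρ₁ + 2 * Real.pi * (δ / 2) ≤ ρ := by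
  have := h.le_fst
  have := mul_pos Real.pi_pos h.pos
  linarith

theorem Gap.half_snd (h : Gap ρ r ρ₁ r₁ δ) : r₁ + δ / 2 ≤ r := by
  have := h.le_snd
  have := h.pos
  linarith

theorem Gap.fst_le (h : Gap ρ r ρ₁ r₁ δ) : ρ₁ ≤ ρ := by
  have := h.le_fst
  have := mul_pos Real.pi_pos h.pos
  linarith

theorem Gap.snd_le (h : Gap ρ r ρ₁ r₁ δ) : r₁ ≤ r := by
  have := h.le_snd
  have := h.pos
  linarith

theorem Gap.memA (h : Gap ρ r ρ₁ r₁ δ) (hr₁ : 0 < r₁) {c : Idx d → ℂ} (hc : MemA ρ r c) :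
    MemA (ρ₁ + 2 * Real.pi * (δ / 2)) (r₁ + δ / 2) c :=
  hc.mono h.half_fst (by have := h.pos; linarith) h.half_snd

/-- Half of the room is reserved for the displacement in a composition, the other half for Cauchy's
estimate, whose constant is therefore 2/(δ/2). -/
theorem Gap.gradA (h : Gap ρ r ρ₁ r₁ δ) (hr₁ : 0 < r₁) {c : Idx d → ℂ} (hc : MemA ρ r c) :
    MemG (ρ₁ + 2 * Real.pi * (δ / 2)) (r₁ + δ / 2) c ∧
      gradA (ρ₁ + 2 * Real.pi * (δ / 2)) (r₁ + δ / 2) c ≤ 4 / δ * normA ρ r c := by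
  have hδ := h.pos
  have := hc.cauchy (ρ := ρ₁ + 2 * Real.pi * (δ / 2)) (r := r₁ + δ / 2) (half_pos hδ)
    (by linarith) (by have := h.le_fst; linarith) (by have := h.le_snd; linarith)
  refine ⟨this.1, this.2.trans (le_of_eq ?_)⟩
  field_simp
  ring

variable [hρ₁ : Fact (0 < ρ₁)]

theorem Gap.norm_comp_le (h : Gap ρ r ρ₁ r₁ δ) (c : Ham d ρ r hr)
    {u : Fin d ⊕ Fin d → Ham d ρ₁ r₁ hr₁} (hu : ∀ j, ‖u j‖ ≤ δ / 2) :
    ‖comp c.coeff u‖ ≤ ‖c‖ :=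
  (TFHam.norm_comp_le (half_pos h.pos).le hu (h.memA hr₁ c.mem)).trans
    (normA_mono c.mem h.half_fst (by have := h.pos; linarith) h.half_snd)

theorem Gap.norm_comp_sub_le (h : Gap ρ r ρ₁ r₁ δ) (c : Ham d ρ r hr) {η : ℝ} (hη : 0 ≤ η)
    {u u' : Fin d ⊕ Fin d → Ham d ρ₁ r₁ hr₁} (hu : ∀ j, ‖u j‖ ≤ δ / 2)
    (hu' : ∀ j, ‖u' j‖ ≤ δ / 2) (huu : ∀ j, ‖u j - u' j‖ ≤ η) :
    ‖comp c.coeff u - comp c.coeff u'‖ ≤ 4 / δ * ‖c‖ * η :=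
  (TFHam.norm_comp_sub_le (half_pos h.pos).le hη hu hu' huu (h.memA hr₁ c.mem)
    (h.gradA hr₁ c.mem).1).trans (mul_le_mul_of_nonneg_right (h.gradA hr₁ c.mem).2 hη)

theorem Gap.eval_comp (h : Gap ρ r ρ₁ r₁ δ) (c : Ham d ρ r hr)
    {u : Fin d ⊕ Fin d → Ham d ρ₁ r₁ hr₁} (hu : ∀ j, ‖u j‖ ≤ δ / 2)
    {p : Phase d} (hp : p ∈ polydom d ρ₁ r₁) :
    (comp c.coeff u).eval p = c.eval (shift u p) :=
  TFHam.eval_comp (half_pos h.pos).le hu (h.memA hr₁ c.mem) hp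

theorem Gap.comp_zero (h : Gap ρ r ρ₁ r₁ δ) (c : Ham d ρ r hr) :
    comp c.coeff (0 : Fin d ⊕ Fin d → Ham d ρ₁ r₁ hr₁) = Ham.restrict h.fst_le h.snd_le c := by
  rw [coeff_comp_zero (c.mem.mono h.fst_le hr₁.le h.snd_le)]
  refine Ham.ext ?_
  rw [Ham.coeff_restrict, Ham.coeff_mk]

/-- The iterates for the fixed point problem `w = -p(x, y + w)`. -/
noncomputable def wIter (ρ₁ r₁ : ℝ) (hr₁ : 0 < r₁) [Fact (0 < ρ₁)] (p : Fin d → Ham d ρ r hr) :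
    ℕ → Fin d → Ham d ρ₁ r₁ hr₁
  | 0 => 0
  | k + 1 => fun j => -comp (p j).coeff (yShift (wIter ρ₁ r₁ hr₁ p k))

/-- The solution of `w = -p(x, y + w)`. -/
noncomputable def wLim (ρ₁ r₁ : ℝ) (hr₁ : 0 < r₁) [Fact (0 < ρ₁)] (p : Fin d → Ham d ρ r hr) :
    Fin d → Ham d ρ₁ r₁ hr₁ :=
  limUnder atTop (wIter ρ₁ r₁ hr₁ p)

theorem norm_wIter_le (h : Gap ρ r ρ₁ r₁ δ) {p : Fin d → Ham d ρ r hr}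
    (hp : ∀ j, ‖p j‖ ≤ δ / 8) (k : ℕ) (j : Fin d) : ‖wIter ρ₁ r₁ hr₁ p k j‖ ≤ ‖p j‖ := by
  have hδ := h.pos
  induction k generalizing j with
  | zero => simp [wIter]
  | succ k ih =>
    rw [wIter, norm_neg]
    exact h.norm_comp_le _ (norm_yShift_le (by linarith) fun j =>
      (ih j).trans ((hp j).trans (by linarith)))

theorem norm_yShift_wIter_le (h : Gap ρ r ρ₁ r₁ δ) {p : Fin d → Ham d ρ r hr}
    (hp : ∀ j, ‖p j‖ ≤ δ / 8) (k : ℕ) (j : Fin d ⊕ Fin d) :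
    ‖yShift (wIter ρ₁ r₁ hr₁ p k) j‖ ≤ δ / 2 := by
  have hδ := h.pos
  exact norm_yShift_le (by linarith) (fun j => (norm_wIter_le h hp k j).trans
    ((hp j).trans (by linarith))) j

/-- The Lipschitz constant of the composition is 4/δ · ‖p_j‖ ≤ 1/2 because ‖p_j‖ ≤ δ/8, so the
iteration contracts. -/
theorem norm_wIter_sub_le (h : Gap ρ r ρ₁ r₁ δ) {p : Fin d → Ham d ρ r hr}
    (hp : ∀ j, ‖p j‖ ≤ δ / 8) (k : ℕ) :
    ‖wIter ρ₁ r₁ hr₁ p (k + 1) - wIter ρ₁ r₁ hr₁ p k‖ ≤ δ / 8 * (1 / 2) ^ k := by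
  have hδ := h.pos
  induction k with
  | zero =>
    rw [pow_zero, mul_one, pi_norm_le_iff_of_nonneg (by positivity)]
    intro j
    simpa [wIter] using (norm_wIter_le (hr₁ := hr₁) h hp 1 j).trans (hp j)
  | succ k ih =>
    rw [pi_norm_le_iff_of_nonneg (by positivity)] at ih ⊢
    intro j
    rw [Pi.sub_apply, wIter, wIter, neg_sub_neg, norm_sub_rev]
    refine (h.norm_comp_sub_le (p j) (by positivity) (norm_yShift_wIter_le h hp _)
      (norm_yShift_wIter_le h hp _) (norm_yShift_sub_le (by positivity) ih)).trans ?_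
    have : 4 / δ * ‖p j‖ ≤ 1 / 2 := by
      have := hp j
      rw [div_mul_eq_mul_div, div_le_iff₀ hδ]
      linarith
    calc _ ≤ 1 / 2 * (δ / 8 * (1 / 2) ^ k) := by gcongr
      _ = _ := by ring

theorem tendsto_wIter (h : Gap ρ r ρ₁ r₁ δ) {p : Fin d → Ham d ρ r hr}
    (hp : ∀ j, ‖p j‖ ≤ δ / 8) :
    Tendsto (wIter ρ₁ r₁ hr₁ p) atTop (𝓝 (wLim ρ₁ r₁ hr₁ p)) :=
  tendsto_limUnder_of_geometric (by norm_num) (norm_wIter_sub_le h hp)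

theorem norm_wLim_le (h : Gap ρ r ρ₁ r₁ δ) {p : Fin d → Ham d ρ r hr}
    (hp : ∀ j, ‖p j‖ ≤ δ / 8) (j : Fin d) : ‖wLim ρ₁ r₁ hr₁ p j‖ ≤ ‖p j‖ :=
  le_of_tendsto ((tendsto_pi_nhds.1 (tendsto_wIter h hp) j).norm)
    (Eventually.of_forall fun k => norm_wIter_le h hp k j)

theorem norm_yShift_wLim_le (h : Gap ρ r ρ₁ r₁ δ) {p : Fin d → Ham d ρ r hr}
    (hp : ∀ j, ‖p j‖ ≤ δ / 8) (j : Fin d ⊕ Fin d) :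
    ‖yShift (wLim ρ₁ r₁ hr₁ p) j‖ ≤ δ / 2 := by
  have hδ := h.pos
  exact norm_yShift_le (by linarith) (fun j => (norm_wLim_le h hp j).trans
    ((hp j).trans (by linarith))) j

theorem wLim_eq (h : Gap ρ r ρ₁ r₁ δ) {p : Fin d → Ham d ρ r hr}
    (hp : ∀ j, ‖p j‖ ≤ δ / 8) (j : Fin d) :
    wLim ρ₁ r₁ hr₁ p j = -comp (p j).coeff (yShift (wLim ρ₁ r₁ hr₁ p)) := by
  have ht := tendsto_wIter (hr₁ := hr₁) h hp
  refine tendsto_nhds_unique (((tendsto_pi_nhds.1 ht) j).comp (tendsto_add_atTop_nat 1)) ?_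
  have hC : 0 ≤ 4 / δ * ‖p j‖ := mul_nonneg (div_nonneg (by norm_num) h.pos.le) (norm_nonneg _)
  rw [tendsto_iff_norm_sub_tendsto_zero] at ht ⊢
  refine squeeze_zero (fun _ => norm_nonneg _) (fun k => ?_)
    (by simpa using ht.const_mul (4 / δ * ‖p j‖))
  rw [Function.comp_apply, wIter, neg_sub_neg, norm_sub_rev]
  exact h.norm_comp_sub_le (p j) (norm_nonneg _) (norm_yShift_wIter_le h hp _)
    (norm_yShift_wLim_le h hp) (norm_yShift_sub_le (norm_nonneg _)
      fun i => norm_le_pi_norm (wIter ρ₁ r₁ hr₁ p k - wLim ρ₁ r₁ hr₁ p) i)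

/-- The symplectic transformation `(x, y) ↦ (x + q(x, y + w), y + w)` with
`w = -p(x, y + w)`. -/
noncomputable def genStep (ρ₁ r₁ : ℝ) (hr₁ : 0 < r₁) [Fact (0 < ρ₁)]
    (p q : Fin d → Ham d ρ r hr) : Fin d ⊕ Fin d → Ham d ρ₁ r₁ hr₁ :=
  Sum.elim (fun j => comp (q j).coeff (yShift (wLim ρ₁ r₁ hr₁ p))) (wLim ρ₁ r₁ hr₁ p)

theorem norm_genStep_inl_le (h : Gap ρ r ρ₁ r₁ δ) {p q : Fin d → Ham d ρ r hr}
    (hp : ∀ j, ‖p j‖ ≤ δ / 8) (j : Fin d) :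
    ‖genStep ρ₁ r₁ hr₁ p q (Sum.inl j)‖ ≤ ‖q j‖ :=
  h.norm_comp_le _ (norm_yShift_wLim_le h hp)

theorem norm_genStep_inr_le (h : Gap ρ r ρ₁ r₁ δ) {p q : Fin d → Ham d ρ r hr}
    (hp : ∀ j, ‖p j‖ ≤ δ / 8) (j : Fin d) :
    ‖genStep ρ₁ r₁ hr₁ p q (Sum.inr j)‖ ≤ ‖p j‖ := norm_wLim_le h hp j

theorem sum_norm_genStep_le (h : Gap ρ r ρ₁ r₁ δ) {p q : Fin d → Ham d ρ r hr}
    (hp : ∀ j, ‖p j‖ ≤ δ / 8) :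
    ∑ j, ‖genStep ρ₁ r₁ hr₁ p q j‖ ≤ ∑ j, ‖p j‖ + ∑ j, ‖q j‖ := by
  rw [Fintype.sum_sum_type, add_comm]
  exact add_le_add (Finset.sum_le_sum fun j _ => norm_genStep_inr_le h hp j)
    (Finset.sum_le_sum fun j _ => norm_genStep_inl_le h hp j)

/-- The quantity is p(x,y) - p(x,y+w), and w is itself bounded by p. The solution is -p up to a term
of second order. -/
theorem norm_wLim_add_le (h : Gap ρ r ρ₁ r₁ δ) {p : Fin d → Ham d ρ r hr}
    (hp : ∀ j, ‖p j‖ ≤ δ / 8) {W : ℝ} (hW : ∀ j, ‖p j‖ ≤ W) (hW0 : 0 ≤ W) (j : Fin d) :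
    ‖wLim ρ₁ r₁ hr₁ p j + Ham.restrict h.fst_le h.snd_le (p j)‖ ≤ 4 / δ * ‖p j‖ * W := by
  have hδ := h.pos
  rw [wLim_eq h hp, ← h.comp_zero, neg_add_eq_sub]
  refine h.norm_comp_sub_le (p j) hW0 (fun j => by simpa using (half_pos hδ).le)
    (norm_yShift_wLim_le h hp) fun i => ?_
  rw [Pi.zero_apply, zero_sub, norm_neg]
  exact norm_yShift_le hW0 (fun j => (norm_wLim_le h hp j).trans (hW j)) i

theorem differentiableOn_wLim (h : Gap ρ r ρ₁ r₁ δ) {U : Set ℂ} (hU : IsOpen U)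
    {p : ℂ → Fin d → Ham d ρ r hr} (hd : ∀ j, DifferentiableOn ℂ (fun z => p z j) U)
    (hp : ∀ z ∈ U, ∀ j, ‖p z j‖ ≤ δ / 8) :
    DifferentiableOn ℂ (fun z => wLim ρ₁ r₁ hr₁ (p z)) U := by
  refine differentiableOn_limUnder_of_geometric (f := fun k z => wIter ρ₁ r₁ hr₁ (p z) k)
    (by norm_num) (by norm_num) hU (fun k => ?_) fun z hz => norm_wIter_sub_le h (hp z hz)
  induction k with
  | zero => exact differentiableOn_const _
  | succ k ih =>
    rw [differentiableOn_pi] at ih ⊢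
    intro j
    refine (differentiableOn_comp (half_pos h.pos).le hU (hd j) h.half_fst h.half_snd ?_
      fun z hz => norm_yShift_wIter_le h (hp z hz) k).neg
    rintro (j | j)
    · exact differentiableOn_const _
    · exact ih j

theorem differentiableOn_genStep (h : Gap ρ r ρ₁ r₁ δ) {U : Set ℂ} (hU : IsOpen U)
    {p q : ℂ → Fin d → Ham d ρ r hr} (hd : ∀ j, DifferentiableOn ℂ (fun z => p z j) U)
    (hq : ∀ j, DifferentiableOn ℂ (fun z => q z j) U)
    (hp : ∀ z ∈ U, ∀ j, ‖p z j‖ ≤ δ / 8) (j : Fin d ⊕ Fin d) :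
    DifferentiableOn ℂ (fun z => genStep ρ₁ r₁ hr₁ (p z) (q z) j) U := by
  have hw := differentiableOn_pi.1 (differentiableOn_wLim (hr₁ := hr₁) h hU hd hp)
  rcases j with j | j
  · refine differentiableOn_comp (half_pos h.pos).le hU (hq j) h.half_fst h.half_snd ?_
      fun z hz => norm_yShift_wLim_le h (hp z hz)
    rintro (j | j)
    · exact differentiableOn_const _
    · exact hw j
  · exact hw j

end Step

/-! ### The integrable part, and the expansion of a transformed Hamiltonian. -/

section Estimates

variable {d : ℕ} {ρ r ρ₁ r₁ δ : ℝ} {hr : 0 < r} {hr₁ : 0 < r₁}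

theorem evalTF_h0Coeff (ω : Fin d → ℝ) (Q : Matrix (Fin d) (Fin d) ℂ) (p : Phase d) :
    evalTF (h0Coeff ω Q) p =
      ∑ j, (ω j : ℂ) * p.2 j + (1 / 2 : ℂ) * ∑ i, ∑ j, p.2 i * Q i j * p.2 j :=
  h0_eval 1 1 one_pos ω Q p

theorem memA_h0Coeff (ω : Fin d → ℝ) (Q : Matrix (Fin d) (Fin d) ℂ) :
    MemA ρ r (h0Coeff ω Q) := MemA.of_finite (h0Coeff_support ω Q)

theorem h0Coeff_apply_of_ne (ω : Fin d → ℝ) (Q : Matrix (Fin d) (Fin d) ℂ) {i : Idx d}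
    (hi : i.1 ≠ 0) : h0Coeff ω Q i = 0 := by
  have h : ∀ (ν : Fin d → ℕ) (z : ℂ), (Pi.single ((0, ν) : Idx d) z : Idx d → ℂ) i = 0 :=
    fun ν z => by rw [Pi.single_apply, if_neg fun h => hi (congrArg Prod.fst h)]
  simp only [h0Coeff, Pi.add_apply, Finset.sum_apply, h, Finset.sum_const_zero, add_zero]

theorem notMem_farModes {ω : Fin d → ℝ} {σ τ : ℝ} {i : Idx d} (hi : i.1 = 0) :
    i ∉ farModes ω σ τ := by
  rintro ⟨h, -⟩
  simp [hi, kNorm] at h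

theorem projFar_h0Coeff (ω ω' : Fin d → ℝ) (Q : Matrix (Fin d) (Fin d) ℂ) (σ τ : ℝ) :
    projFar ω' σ τ (h0Coeff ω Q) = 0 := by
  funext i
  by_cases hi : i.1 = 0
  · exact indicator_of_notMem (notMem_farModes hi) _
  · exact indicator_apply_eq_zero.2 fun _ => h0Coeff_apply_of_ne ω Q hi

theorem h0Coeff_single (ω : Fin d → ℝ) (Q : Matrix (Fin d) (Fin d) ℂ) (i : Fin d) :
    h0Coeff ω Q (0, Pi.single i 1) = ω i := by
  -- The total degree separates the linear modes from the quadratic ones.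
  have h1 : ∀ a b : Fin d, ((0, Pi.single i 1) : Idx d) ≠ (0, Pi.single a 1 + Pi.single b 1) := by
    intro a b h
    have h2 := congrArg (fun ν : Idx d => deg ν.2) h
    simp [deg, Finset.sum_add_distrib] at h2
  simp only [h0Coeff, Pi.add_apply, Finset.sum_apply]
  rw [Finset.sum_eq_single i]
  · rw [Pi.single_eq_same]
    simp only [Pi.single_eq_of_ne (h1 _ _), Finset.sum_const_zero, add_zero]
  · intro j _ hj
    refine Pi.single_eq_of_ne (fun h => hj ?_) _
    have h2 := congrFun (congrArg Prod.snd h) i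
    by_contra hne
    simp [Ne.symm hne] at h2
  · simp

/-- The linear modes of H⁰ have the coefficients ω_i and the weight r. The estimates of the
iteration involve the maximum norm ‖ω‖, the radius ε involves ‖H⁰‖, and this compares them. -/
theorem abs_le_normA_h0Coeff (ω : Fin d → ℝ) (Q : Matrix (Fin d) (Fin d) ℂ) (hr : 0 < r) :
    r * ‖ω‖ ≤ normA 0 r (h0Coeff ω Q) := by
  rw [mul_comm, ← le_div_iff₀ hr, pi_norm_le_iff_of_nonneg (div_nonneg (normA_nonneg hr) hr.le)]
  intro i
  rw [le_div_iff₀ hr]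
  have h : ‖h0Coeff ω Q (0, Pi.single i 1)‖ * weight 0 r (0, Pi.single i 1) ≤
      normA 0 r (h0Coeff ω Q) :=
    (memA_h0Coeff ω Q).le_tsum _ fun j _ => mul_nonneg (norm_nonneg _) (weight_pos 0 hr j).le
  rw [h0Coeff_single] at h
  simpa [weight, deg, kNorm] using h

/-- One far mode is enough, since |ω·k| ≤ ‖ω‖‖k‖ for the maximum norm of ω. -/
theorem lt_norm_of_mem_farModes {ω : Fin d → ℝ} {σ τ : ℝ} {i : Idx d} (hi : i ∈ farModes ω σ τ) :
    σ < ‖ω‖ := by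
  have h1 : |∑ j, ω j * (i.1 j : ℝ)| ≤ ‖ω‖ * kNorm i.1 := by
    refine (Finset.abs_sum_le_sum_abs _ _).trans ?_
    rw [kNorm, Finset.mul_sum]
    refine Finset.sum_le_sum fun j _ => ?_
    rw [abs_mul]
    exact mul_le_mul_of_nonneg_right (norm_le_pi_norm ω j) (abs_nonneg _)
  have h2 : σ * kNorm i.1 < ‖ω‖ * kNorm i.1 := hi.1.trans_le h1
  exact lt_of_mul_lt_mul_right h2 (kNorm_nonneg _)

theorem restrict_farL (hρ : ρ₁ ≤ ρ) (hrr : r₁ ≤ r) (ω : Fin d → ℝ) (σ τ : ℝ) (a : Ham d ρ r hr) :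
    (Ham.restrict hρ hrr (farL ω σ τ a) : Ham d ρ₁ r₁ hr₁) =
      farL ω σ τ (Ham.restrict hρ hrr a) := by
  refine Ham.ext ?_
  rw [Ham.coeff_restrict, coeff_farL, coeff_farL, Ham.coeff_restrict]

theorem norm_apply_le_matNorm (Q : Matrix (Fin d) (Fin d) ℂ) (i j : Fin d) :
    ‖Q i j‖ ≤ matNorm Q :=
  (Finset.single_le_sum (f := fun i => ‖Q i j‖) (fun _ _ => norm_nonneg _)
    (Finset.mem_univ i)).trans (sum_le_matNorm Q j)

theorem eval_linY (Q : Matrix (Fin d) (Fin d) ℂ) (i : Fin d) {p : Phase d}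
    (hp : p ∈ polydom d ρ r) :
    (linY Q i : Ham d ρ r hr).eval p = ∑ j, Q i j * p.2 j := by
  have h : ∀ (s : Finset (Fin d)) (f : Fin d → Ham d ρ r hr),
      (∑ j ∈ s, f j).eval p = ∑ j ∈ s, (f j).eval p := fun s f => by
    classical
    induction s using Finset.induction_on with
    | empty => simp [Ham.eval_zero]
    | insert a s ha ih => rw [Finset.sum_insert ha, Finset.sum_insert ha, Ham.eval_add _ _ hp, ih]
  rw [linY, h]
  simp only [Ham.eval_smul, Ham.eval_single, mode_snd, one_mul]

variable [hρ₁ : Fact (0 < ρ₁)]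

theorem restrict_mul [hρ' : Fact (0 < ρ)] (hρ : ρ₁ ≤ ρ) (hrr : r₁ ≤ r) (a b : Ham d ρ r hr) :
    (Ham.restrict hρ hrr (a * b) : Ham d ρ₁ r₁ hr₁) =
      Ham.restrict hρ hrr a * Ham.restrict hρ hrr b := by
  refine Ham.ext_eval hρ₁.out.le fun p hp => ?_
  have hp' : p ∈ polydom d ρ r := fun j => by
    have hπ := Real.pi_pos
    exact ⟨(hp j).1.trans (by gcongr), (hp j).2.trans hrr⟩
  rw [Ham.eval_restrict, Ham.eval_mul _ _ hp', Ham.eval_mul _ _ hp, Ham.eval_restrict,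
    Ham.eval_restrict]

/-- The partial derivative of `ω · y + (1/2) yᵀ Q y` with respect to `y_i`. -/
noncomputable def gradY (ω : Fin d → ℝ) (Q : Matrix (Fin d) (Fin d) ℂ) (i : Fin d) :
    Ham d ρ₁ r₁ hr₁ := (ω i : ℂ) • 1 + linY Q i

theorem norm_gradY_le (ω : Fin d → ℝ) {Q : Matrix (Fin d) (Fin d) ℂ} (hQ : Q.IsSymm)
    (i : Fin d) : ‖(gradY ω Q i : Ham d ρ₁ r₁ hr₁)‖ ≤ ‖ω‖ + r₁ * matNorm Q := by
  refine (norm_add_le _ _).trans (add_le_add ?_ (norm_linY_le_matNorm hQ i))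
  rw [norm_smul, norm_one, mul_one, Complex.norm_real]
  exact norm_le_pi_norm ω i

theorem restrict_gradY [hρ' : Fact (0 < ρ)] (hρ : ρ₁ ≤ ρ) (hrr : r₁ ≤ r) (ω : Fin d → ℝ)
    (Q : Matrix (Fin d) (Fin d) ℂ) (i : Fin d) :
    Ham.restrict hρ hrr (gradY ω Q i : Ham d ρ r hr) = (gradY ω Q i : Ham d ρ₁ r₁ hr₁) := by
  refine Ham.ext_eval hρ₁.out.le fun p hp => ?_
  have hp' : p ∈ polydom d ρ r := fun j => by
    have hπ := Real.pi_pos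
    exact ⟨(hp j).1.trans (by gcongr), (hp j).2.trans hrr⟩
  rw [Ham.eval_restrict, gradY, gradY, Ham.eval_add _ _ hp', Ham.eval_add _ _ hp, Ham.eval_smul,
    Ham.eval_smul, Ham.eval_one, Ham.eval_one, eval_linY _ _ hp, eval_linY _ _ hp']

/-- The Taylor expansion of the integrable Hamiltonian. -/
theorem comp_h0Coeff {s : ℝ} (hs : 0 ≤ s) (ω : Fin d → ℝ) {Q : Matrix (Fin d) (Fin d) ℂ}
    (hQ : Q.IsSymm) {v : Fin d ⊕ Fin d → Ham d ρ₁ r₁ hr₁} (hv : ∀ j, ‖v j‖ ≤ s) :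
    comp (h0Coeff ω Q) v = Ham.mk (h0Coeff ω Q) (memA_h0Coeff ω Q) +
      ∑ i, gradY ω Q i * v (Sum.inr i) +
      (1 / 2 : ℂ) • ∑ i, ∑ j, Q i j • (v (Sum.inr i) * v (Sum.inr j)) := by
  refine Ham.ext_eval hρ₁.out.le fun p hp => ?_
  rw [eval_comp hs hv (memA_h0Coeff ω Q) hp, evalTF_h0Coeff]
  have hlin : ∀ i, (linY Q i : Ham d ρ₁ r₁ hr₁).eval p = ∑ j, Q i j * p.2 j :=
    fun i => eval_linY Q i hp
  rw [← Ham.evalHom_apply p hp]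
  simp only [map_add, map_sum, map_smul, map_mul, Ham.evalHom_apply, gradY, Ham.eval_one, hlin,
    smul_eq_mul]
  rw [Ham.eval, Ham.coeff_mk, evalTF_h0Coeff]
  simp only [shift]
  set V := fun j => (v (Sum.inr j)).eval p
  -- By symmetry of Q the two mixed terms agree, which cancels the factor 1/2.
  have hcross : ∑ i, ∑ j, p.2 i * Q i j * V j = ∑ i, ∑ j, V i * Q i j * p.2 j := by
    rw [Finset.sum_comm]
    refine Finset.sum_congr rfl fun i _ => Finset.sum_congr rfl fun j _ => ?_
    rw [← hQ.apply i j]; ring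
  have e1 : ∑ i, ∑ j, (p.2 i + V i) * Q i j * (p.2 j + V j) =
      ∑ i, ∑ j, p.2 i * Q i j * p.2 j + 2 * ∑ i, ∑ j, V i * Q i j * p.2 j +
        ∑ i, ∑ j, Q i j * (V i * V j) := by
    rw [two_mul]
    nth_rw 1 [← hcross]
    simp only [← Finset.sum_add_distrib]
    exact Finset.sum_congr rfl fun i _ => Finset.sum_congr rfl fun j _ => by ring
  have e2 : ∑ i, ((ω i : ℂ) * 1 + ∑ j, Q i j * p.2 j) * V i =
      ∑ i, (ω i : ℂ) * V i + ∑ i, ∑ j, V i * Q i j * p.2 j := by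
    rw [← Finset.sum_add_distrib]
    refine Finset.sum_congr rfl fun i _ => ?_
    rw [add_mul, Finset.sum_mul, mul_one]
    congr 1
    exact Finset.sum_congr rfl fun j _ => by ring
  change ∑ j, (ω j : ℂ) * (p.2 j + V j) + 1 / 2 * ∑ i, ∑ j, (p.2 i + V i) * Q i j * (p.2 j + V j) =
    _ + ∑ i, ((ω i : ℂ) * 1 + ∑ j, Q i j * p.2 j) * V i + 1 / 2 * ∑ i, ∑ j, Q i j * (V i * V j)
  rw [e1, e2]
  simp only [mul_add, Finset.sum_add_distrib]
  ring

theorem norm_sum_sum_smul_mul_le {Q : Matrix (Fin d) (Fin d) ℂ} {w : Fin d → Ham d ρ₁ r₁ hr₁}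
    {W : ℝ} (hw : ∑ j, ‖w j‖ ≤ W) :
    ‖∑ i, ∑ j, Q i j • (w i * w j)‖ ≤ matNorm Q * W ^ 2 := by
  have h0 : 0 ≤ ∑ j, ‖w j‖ := Finset.sum_nonneg fun _ _ => norm_nonneg _
  calc _ ≤ ∑ i, ∑ j, matNorm Q * (‖w i‖ * ‖w j‖) := by
        refine (norm_sum_le _ _).trans (Finset.sum_le_sum fun i _ =>
          (norm_sum_le _ _).trans (Finset.sum_le_sum fun j _ => ?_))
        rw [norm_smul]
        exact mul_le_mul (norm_apply_le_matNorm Q i j) (norm_mul_le _ _) (norm_nonneg _)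
          (matNorm_nonneg Q)
    _ = matNorm Q * (∑ j, ‖w j‖) ^ 2 := by
        simp only [← Finset.mul_sum, ← Finset.sum_mul, sq]
    _ ≤ _ := by
        have := matNorm_nonneg Q
        gcongr

/-- The constant is 3/2 since r₁‖Q‖ ≤ σ/2 ≤ ‖ω‖/2. -/
theorem norm_sum_gradY_mul_le (ω : Fin d → ℝ) {Q : Matrix (Fin d) (Fin d) ℂ} (hQ : Q.IsSymm)
    {σ : ℝ} (hσ : 2 * r₁ * matNorm Q ≤ σ) (hσω : σ ≤ ‖ω‖)
    {w : Fin d → Ham d ρ₁ r₁ hr₁} {W : ℝ} (hw : ∑ j, ‖w j‖ ≤ W) :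
    ‖∑ i, gradY ω Q i * w i‖ ≤ 3 / 2 * ‖ω‖ * W := by
  calc _ ≤ ∑ i, 3 / 2 * ‖ω‖ * ‖w i‖ := by
        refine (norm_sum_le _ _).trans (Finset.sum_le_sum fun i _ => (norm_mul_le _ _).trans
          (mul_le_mul_of_nonneg_right ((norm_gradY_le ω hQ i).trans ?_) (norm_nonneg _)))
        linarith
    _ = 3 / 2 * ‖ω‖ * ∑ i, ‖w i‖ := by rw [Finset.mul_sum]
    _ ≤ _ := by gcongr

/-- The difference of the transformed and the original Hamiltonian. -/
theorem comp_sub_restrict_eq (ω : Fin d → ℝ) {Q : Matrix (Fin d) (Fin d) ℂ} (g : Gap ρ r ρ₁ r₁ δ) (hQ : Q.IsSymm) (K : Ham d ρ r hr) {S D : ℝ}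
    {v : Fin d ⊕ Fin d → Ham d ρ₁ r₁ hr₁} (hv : ∀ j, ‖v j‖ ≤ δ / 2) (hS : 0 ≤ S)
    (hvS : ∀ j, ‖v j‖ ≤ S)
    (hD : gradA (ρ₁ + 2 * Real.pi * (δ / 2)) (r₁ + δ / 2) (K.coeff - h0Coeff ω Q) ≤ D) :
    ∃ R : Ham d ρ₁ r₁ hr₁, ‖R‖ ≤ D * S ∧
      comp K.coeff v - Ham.restrict g.fst_le g.snd_le K =
        ∑ i, gradY ω Q i * v (Sum.inr i) +
          (1 / 2 : ℂ) • ∑ i, ∑ j, Q i j • (v (Sum.inr i) * v (Sum.inr j)) + R := by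
  have hδ := g.pos
  have hmh : MemA ρ r (K.coeff - h0Coeff ω Q) := by
    have := K.mem.add hr ((memA_h0Coeff (ρ := ρ) (r := r) ω Q).smul (-1))
    rwa [neg_one_smul, ← sub_eq_add_neg] at this
  have hK : comp K.coeff v = comp (h0Coeff ω Q) v + comp (K.coeff - h0Coeff ω Q) v := by
    rw [← comp_add (half_pos hδ).le hv (memA_h0Coeff ω Q) (g.memA hr₁ hmh), add_sub_cancel]
  refine ⟨comp (K.coeff - h0Coeff ω Q) v - comp (K.coeff - h0Coeff ω Q) 0, ?_, ?_⟩
  · refine (norm_comp_sub_le (half_pos hδ).le hS hv (fun j => by simpa using (half_pos hδ).le)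
      (fun j => by simpa using hvS j) (g.memA hr₁ hmh) (g.gradA hr₁ hmh).1).trans ?_
    exact mul_le_mul_of_nonneg_right hD hS
  · have h0 : comp (K.coeff - h0Coeff ω Q) (0 : Fin d ⊕ Fin d → Ham d ρ₁ r₁ hr₁) +
        Ham.mk (h0Coeff ω Q) (memA_h0Coeff ω Q) = Ham.restrict g.fst_le g.snd_le K := by
      rw [coeff_comp_zero (hmh.mono g.fst_le hr₁.le g.snd_le)]
      refine Ham.ext ?_
      rw [Ham.coeff_add, Ham.coeff_mk, Ham.coeff_mk, Ham.coeff_restrict, sub_add_cancel]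
    rw [hK, comp_h0Coeff (half_pos hδ).le ω hQ hv, ← h0]
    abel

end Estimates

/-! ### The effect of one elimination step. -/

section StepEstimate

variable {d : ℕ} {ρ r ρ₁ r₁ δ : ℝ} {hr : 0 < r} {hr₁ : 0 < r₁}
  [hρ : Fact (0 < ρ)] [hρ₁ : Fact (0 < ρ₁)]

/-- One step of the elimination of the far from resonance modes. -/
noncomputable def elimStep (ρ₁ r₁ : ℝ) (hr₁ : 0 < r₁) [Fact (0 < ρ₁)] (ω : Fin d → ℝ)
    (Q : Matrix (Fin d) (Fin d) ℂ) {σ τ : ℝ} (hσ : 0 < σ) (hτ : 0 < τ) (K : Ham d ρ r hr) :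
    Fin d ⊕ Fin d → Ham d ρ₁ r₁ hr₁ :=
  genStep ρ₁ r₁ hr₁ (fun j => genDx ω hσ hτ j (solveL ω Q hσ hτ K))
    (fun j => genDy ω hσ hτ j (solveL ω Q hσ hτ K))

variable (ω : Fin d → ℝ) {Q : Matrix (Fin d) (Fin d) ℂ} {σ τ : ℝ} (hσ : 0 < σ) (hτ : 0 < τ)

theorem sum_norm_genDx_solveL_le (hQ : Q.IsSymm) (h : 2 * r * matNorm Q ≤ σ) (K : Ham d ρ r hr) :
    ∑ j, ‖genDx ω hσ hτ j (solveL ω Q hσ hτ K)‖ ≤ 2 / σ * ‖farL ω σ τ K‖ := by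
  refine (sum_norm_genDx_le ω hσ hτ _).trans ?_
  have := norm_solveL_le ω hσ hτ hQ h K
  calc _ ≤ 1 / σ * (2 * ‖farL ω σ τ K‖) := by gcongr
    _ = _ := by ring

theorem sum_norm_gen_solveL_le (hQ : Q.IsSymm) (h : 2 * r * matNorm Q ≤ σ) (K : Ham d ρ r hr) :
    ∑ j, ‖genDx ω hσ hτ j (solveL ω Q hσ hτ K)‖ + ∑ j, ‖genDy ω hσ hτ j (solveL ω Q hσ hτ K)‖ ≤
      2 / σ * (1 + τ / r) * ‖farL ω σ τ K‖ := by
  refine (sum_norm_gen_le ω hσ hτ _).trans ?_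
  have := norm_solveL_le ω hσ hτ hQ h K
  calc _ ≤ 1 / σ * (1 + τ / r) * (2 * ‖farL ω σ τ K‖) := by gcongr
    _ = _ := by ring

theorem norm_genDx_solveL_le (hQ : Q.IsSymm) (h : 2 * r * matNorm Q ≤ σ) (K : Ham d ρ r hr)
    {S : ℝ} (hS : 2 / σ * (1 + τ / r) * ‖farL ω σ τ K‖ ≤ S) (j : Fin d) :
    ‖genDx ω hσ hτ j (solveL ω Q hσ hτ K)‖ ≤ S := by
  refine le_trans ?_ ((sum_norm_gen_solveL_le ω hσ hτ hQ h K).trans hS)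
  refine le_trans ?_ (le_add_of_nonneg_right (Finset.sum_nonneg fun _ _ => norm_nonneg _))
  exact Finset.single_le_sum (f := fun j => ‖genDx ω hσ hτ j (solveL ω Q hσ hτ K)‖)
    (fun _ _ => norm_nonneg _) (Finset.mem_univ j)

theorem sum_norm_elimStep_le (g : Gap ρ r ρ₁ r₁ δ) (hQ : Q.IsSymm) (h : 2 * r * matNorm Q ≤ σ)
    (K : Ham d ρ r hr) {S : ℝ} (hS : 2 / σ * (1 + τ / r) * ‖farL ω σ τ K‖ ≤ S) (hSδ : S ≤ δ / 8) :
    ∑ j, ‖elimStep ρ₁ r₁ hr₁ ω Q hσ hτ K j‖ ≤ S :=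
  (sum_norm_genStep_le g fun j => (norm_genDx_solveL_le ω hσ hτ hQ h K hS j).trans hSδ).trans
    ((sum_norm_gen_solveL_le ω hσ hτ hQ h K).trans hS)

theorem farL_homological_restrict (g : Gap ρ r ρ₁ r₁ δ) (hQ : Q.IsSymm)
    (h : 2 * r * matNorm Q ≤ σ) (K : Ham d ρ r hr) :
    farL ω σ τ (∑ i, gradY ω Q i * (Ham.restrict g.fst_le g.snd_le
      (genDx ω hσ hτ i (solveL ω Q hσ hτ K)) : Ham d ρ₁ r₁ hr₁)) =
        farL ω σ τ (Ham.restrict g.fst_le g.snd_le K) := by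
  have h1 := farL_homological ω hσ hτ hQ h K
  have h2 := congrArg (Ham.restrict (hr := hr₁) g.fst_le g.snd_le) h1
  rw [restrict_farL, restrict_farL, map_sum] at h2
  rw [← h2]
  congr 1
  refine Finset.sum_congr rfl fun i _ => ?_
  rw [restrict_mul]
  congr 1
  exact (restrict_gradY g.fst_le g.snd_le ω Q i).symm

/-- The quadratic part of the expansion is small compared to the linear part. -/
theorem norm_half_sum_sum_le (hσω : σ ≤ ‖ω‖) (hδ : 0 < δ) (hm : 2 * δ * matNorm Q ≤ σ)
    {w : Fin d → Ham d ρ₁ r₁ hr₁} {W : ℝ} (hw : ∑ j, ‖w j‖ ≤ W) :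
    ‖(1 / 2 : ℂ) • ∑ i, ∑ j, Q i j • (w i * w j)‖ ≤ ‖ω‖ / δ * W ^ 2 := by
  rw [norm_smul]
  have h1 := norm_sum_sum_smul_mul_le (Q := Q) hw
  have h2 : matNorm Q * W ^ 2 ≤ ‖ω‖ / δ * W ^ 2 := by
    refine mul_le_mul_of_nonneg_right ?_ (sq_nonneg W)
    rw [le_div_iff₀ hδ]
    have := mul_nonneg hδ.le (matNorm_nonneg Q)
    linarith
  have h3 : ‖(1 / 2 : ℂ)‖ = 1 / 2 := by norm_num
  rw [h3]
  have := norm_nonneg (∑ i, ∑ j, Q i j • (w i * w j))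
  linarith

/-- The effect of one elimination step. -/
theorem elimStep_estimate (g : Gap ρ r ρ₁ r₁ δ) (hQ : Q.IsSymm) (h : 2 * r * matNorm Q ≤ σ)
    (hσω : σ ≤ ‖ω‖) (K : Ham d ρ r hr) {S D E : ℝ}
    (hS : 2 / σ * (1 + τ / r) * ‖farL ω σ τ K‖ ≤ S) (hSδ : S ≤ δ / 8)
    (hE : ‖farL ω σ τ K‖ ≤ E) (hWδ : 2 / σ * E ≤ δ / 8)
    (hD : gradA (ρ₁ + 2 * Real.pi * (δ / 2)) (r₁ + δ / 2) (K.coeff - h0Coeff ω Q) ≤ D) :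
    ‖comp K.coeff (elimStep ρ₁ r₁ hr₁ ω Q hσ hτ K) - Ham.restrict g.fst_le g.snd_le K‖ ≤
        2 * ‖ω‖ * (2 / σ * E) + D * S ∧
      ‖farL ω σ τ (comp K.coeff (elimStep ρ₁ r₁ hr₁ ω Q hσ hτ K))‖ ≤
        7 * ‖ω‖ / δ * (2 / σ * E) ^ 2 + D * S := by
  have hδ := g.pos
  set p := fun j => genDx ω hσ hτ j (solveL ω Q hσ hτ K) with hp
  have hpS : ∀ j, ‖p j‖ ≤ δ / 8 := fun j => (norm_genDx_solveL_le ω hσ hτ hQ h K hS j).trans hSδ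
  have hpW : ∑ j, ‖p j‖ ≤ 2 / σ * E := (sum_norm_genDx_solveL_le ω hσ hτ hQ h K).trans
    (mul_le_mul_of_nonneg_left hE (by positivity))
  have hsum := sum_norm_elimStep_le (hr₁ := hr₁) ω hσ hτ g hQ h K hS hSδ
  have hinr : ∀ j, elimStep ρ₁ r₁ hr₁ ω Q hσ hτ K (Sum.inr j) = wLim ρ₁ r₁ hr₁ p j :=
    fun j => rfl
  generalize elimStep ρ₁ r₁ hr₁ ω Q hσ hτ K = v at hsum hinr ⊢
  have hvS : ∀ j, ‖v j‖ ≤ S := fun j =>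
    (Finset.single_le_sum (f := fun j => ‖v j‖) (fun _ _ => norm_nonneg _)
      (Finset.mem_univ j)).trans hsum
  have hS0 : 0 ≤ S := (Finset.sum_nonneg fun _ _ => norm_nonneg _).trans hsum
  obtain ⟨R, hR, hdiff⟩ := comp_sub_restrict_eq ω g hQ K (D := D)
    (fun j => (hvS j).trans (by linarith)) hS0 hvS hD
  have hhom := farL_homological_restrict (hr₁ := hr₁) ω hσ hτ g hQ h K
  have hpW1 : ∀ j, ‖p j‖ ≤ 2 / σ * E := fun j =>
    (Finset.single_le_sum (f := fun j => ‖p j‖) (fun _ _ => norm_nonneg _)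
      (Finset.mem_univ j)).trans hpW
  generalize 2 / σ * E = W at hpW hpW1 hWδ ⊢
  have hW0 : 0 ≤ W := (Finset.sum_nonneg fun _ _ => norm_nonneg _).trans hpW
  -- `W` bounds the change of y alone and `S` the whole displacement. H⁰ does not depend on x, so
  -- its contribution involves only `W`.
  have hwW : ∑ j, ‖v (Sum.inr j)‖ ≤ W :=
    (Finset.sum_le_sum fun j _ => by rw [hinr]; exact norm_wLim_le g hpS j).trans hpW
  have hr₁r := g.snd_le
  -- With δ ≤ r, the assumption on Q also bounds δ‖Q‖, which brings the quadratic term into the form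
  -- ‖ω‖W²/δ.
  have hδr : δ ≤ r := by have := g.le_snd; linarith
  have hmat := matNorm_nonneg Q
  have h₁ : 2 * r₁ * matNorm Q ≤ σ := le_trans (by gcongr) h
  have h₂ : 2 * δ * matNorm Q ≤ σ := le_trans (by gcongr) h
  have hω : 0 ≤ ‖ω‖ := norm_nonneg _
  have hquad := norm_half_sum_sum_le ω hσω hδ h₂ hwW
  constructor
  · rw [hdiff]
    refine (norm_add_le _ _).trans (add_le_add ((norm_add_le _ _).trans ?_) hR)
    have h3 := norm_sum_gradY_mul_le ω hQ h₁ hσω hwW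
    have h4 : ‖ω‖ / δ * W ^ 2 ≤ ‖ω‖ / 8 * W := by
      have h5 : ‖ω‖ / δ * W ^ 2 = ‖ω‖ * W * (W / δ) := by ring
      have h6 : W / δ ≤ 1 / 8 := by rw [div_le_iff₀ hδ]; linarith
      have h7 := mul_le_mul_of_nonneg_left h6 (mul_nonneg hω hW0)
      linarith
    have := mul_nonneg hω hW0
    linarith
  · have hwP : ∑ j, ‖v (Sum.inr j) + (Ham.restrict g.fst_le g.snd_le (p j) :
        Ham d ρ₁ r₁ hr₁)‖ ≤ 4 / δ * W ^ 2 := by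
      calc _ ≤ ∑ j, 4 / δ * ‖p j‖ * W := Finset.sum_le_sum fun j _ => by
              rw [hinr]; exact norm_wLim_add_le g hpS hpW1 hW0 j
        _ = 4 / δ * (∑ j, ‖p j‖) * W := by rw [← Finset.sum_mul, ← Finset.mul_sum]
        _ ≤ 4 / δ * W * W := by gcongr
        _ = _ := by ring
    have h3 := norm_sum_gradY_mul_le ω hQ h₁ hσω hwP
    -- The homological equation trades the far part of K for that of (ω+Qy)·p. In the linear term
    -- only w + p survives, which is of second order.
    have hsplit : farL ω σ τ (comp K.coeff v) = farL ω σ τ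
        (∑ i, gradY ω Q i * (v (Sum.inr i) + (Ham.restrict g.fst_le g.snd_le (p i) :
          Ham d ρ₁ r₁ hr₁)) +
        (1 / 2 : ℂ) • ∑ i, ∑ j, Q i j • (v (Sum.inr i) * v (Sum.inr j)) + R) := by
      simp only [mul_add, Finset.sum_add_distrib]
      generalize ∑ i, ∑ j, Q i j • (v (Sum.inr i) * v (Sum.inr j)) = X at hdiff ⊢
      generalize ∑ i, gradY ω Q i * v (Sum.inr i) = Y at hdiff ⊢
      rw [eq_add_of_sub_eq' hdiff]
      simp only [map_add]
      rw [hhom]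
      abel
    rw [hsplit]
    refine (norm_farL_le _ _ _ _).trans ((norm_add_le _ _).trans (add_le_add
      ((norm_add_le _ _).trans ?_) hR))
    -- The total is 7 = 6 + 1: six from w + p, one from the quadratic part of H⁰.
    have h5 : 3 / 2 * ‖ω‖ * (4 / δ * W ^ 2) = 6 * (‖ω‖ / δ * W ^ 2) := by ring
    have h6 : 7 * ‖ω‖ / δ * W ^ 2 = 7 * (‖ω‖ / δ * W ^ 2) := by ring
    linarith

end StepEstimate

/-! ### Symplecticity of the elimination steps. -/

section ShiftDeriv

variable {d : ℕ} {ρ r ρ₁ r₁ ρ₀ r₀ δ : ℝ} {hr : 0 < r} {hr₁ : 0 < r₁}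

theorem polydom_mono (hρ : ρ₁ ≤ ρ) (hrr : r₁ ≤ r) : polydom d ρ₁ r₁ ⊆ polydom d ρ r := fun p hp j =>
  ⟨(hp j).1.trans (by have := Real.pi_pos; gcongr), (hp j).2.trans hrr⟩

theorem polydom_mem_nhds (hρ : ρ₀ < ρ) (hrr : r₀ < r) {p : Phase d} (hp : p ∈ polydom d ρ₀ r₀) :
    polydom d ρ r ∈ 𝓝 p := by
  have hπ := Real.pi_pos
  have hη : 0 < min ((ρ - ρ₀) / (2 * Real.pi)) (r - r₀) :=
    lt_min (div_pos (by linarith) (by positivity)) (by linarith)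
  refine mem_of_superset (Metric.closedBall_mem_nhds p hη) fun q hq => ?_
  refine polydom_mono ?_ ?_ (mem_polydom_of_mem_ball hp hq)
  · have := min_le_left ((ρ - ρ₀) / (2 * Real.pi)) (r - r₀)
    rw [le_div_iff₀ (by positivity)] at this
    linarith
  · have := min_le_right ((ρ - ρ₀) / (2 * Real.pi)) (r - r₀)
    linarith

theorem shift_mem_polydom {s : ℝ} {u : Fin d ⊕ Fin d → Ham d ρ₁ r₁ hr₁} (hu : ∀ j, ‖u j‖ ≤ s)
    (hρ : ρ₀ ≤ ρ₁) (hrr : r₀ ≤ r₁) {p : Phase d} (hp : p ∈ polydom d ρ₀ r₀) :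
    shift u p ∈ polydom d (ρ₀ + 2 * Real.pi * s) (r₀ + s) := by
  have hπ := Real.pi_pos
  have he : ∀ j, ‖(u j).eval p‖ ≤ s := fun j =>
    (Ham.norm_eval_le (u j) (polydom_mono hρ hrr hp)).trans (hu j)
  intro j
  constructor
  · have h1 := (Complex.abs_im_le_norm _).trans (he (Sum.inl j))
    have h2 : (ρ₀ + 2 * Real.pi * s) / (2 * Real.pi) = ρ₀ / (2 * Real.pi) + s := by field_simp
    rw [h2, shift]
    simp only [Complex.add_im]
    exact (abs_add_le _ _).trans (add_le_add (hp j).1 h1)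
  · exact (norm_add_le _ _).trans (add_le_add (hp j).2 (he _))

/-- The derivative of `id + u`. -/
noncomputable def shiftDeriv (u : Fin d ⊕ Fin d → Ham d ρ₁ r₁ hr₁) (p : Phase d) :
    Phase d →L[ℂ] Phase d :=
  (ContinuousLinearMap.pi fun j => dx j + derivTF (u (Sum.inl j)).coeff p).prod
    (ContinuousLinearMap.pi fun j => dy j + derivTF (u (Sum.inr j)).coeff p)

theorem hasFDerivAt_shift (hr₀ : 0 < r₀) (hρ : ρ₀ < ρ₁) (hrr : r₀ < r₁)
    (u : Fin d ⊕ Fin d → Ham d ρ₁ r₁ hr₁) {p : Phase d} (hp : p ∈ polydom d ρ₀ r₀) :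
    HasFDerivAt (shift u) (shiftDeriv u p) p := by
  have h : ∀ j, HasFDerivAt (u j).eval (derivTF (u j).coeff p) p := fun j =>
    hasFDerivAt_evalTF hr₀ hρ hrr (u j).mem hp
  refine HasFDerivAt.prodMk (hasFDerivAt_pi.2 fun j => ?_) (hasFDerivAt_pi.2 fun j => ?_)
  · exact (dx j).hasFDerivAt.add (h _)
  · exact (dy j).hasFDerivAt.add (h _)

theorem shiftDeriv_fst (u : Fin d ⊕ Fin d → Ham d ρ₁ r₁ hr₁) (p v : Phase d) (j : Fin d) :
    (shiftDeriv u p v).1 j = v.1 j + derivTF (u (Sum.inl j)).coeff p v := rfl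

theorem shiftDeriv_snd (u : Fin d ⊕ Fin d → Ham d ρ₁ r₁ hr₁) (p v : Phase d) (j : Fin d) :
    (shiftDeriv u p v).2 j = v.2 j + derivTF (u (Sum.inr j)).coeff p v := rfl

/-- `g` is differentiable at `p` and its derivative preserves the symplectic form. -/
def IsSympAt (g : Phase d → Phase d) (p : Phase d) : Prop :=
  ∃ L : Phase d →L[ℂ] Phase d, HasFDerivAt g L p ∧
    ∀ v w, sympForm (L v) (L w) = sympForm v w

theorem IsSympAt.comp {f g : Phase d → Phase d} {p : Phase d} (hg : IsSympAt g (f p))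
    (hf : IsSympAt f p) : IsSympAt (g ∘ f) p := by
  obtain ⟨L, hL, hLs⟩ := hg
  obtain ⟨M, hM, hMs⟩ := hf
  exact ⟨L.comp M, hL.comp p hM, fun v w => by
    rw [ContinuousLinearMap.comp_apply, ContinuousLinearMap.comp_apply, hLs, hMs]⟩

theorem IsSympAt.congr {f g : Phase d → Phase d} {p : Phase d} (hf : IsSympAt f p)
    (h : g =ᶠ[𝓝 p] f) : IsSympAt g p := by
  obtain ⟨L, hL, hLs⟩ := hf
  exact ⟨L, hL.congr_of_eventuallyEq h, hLs⟩

theorem coeffDx_comm (i j : Fin d) (c : Idx d → ℂ) :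
    coeffDx i (coeffDx j c) = coeffDx j (coeffDx i c) := by
  funext a; simp only [coeffDx]; ring

theorem coeffDx_coeffDy (i j : Fin d) (c : Idx d → ℂ) :
    coeffDx i (coeffDy j c) = coeffDy j (coeffDx i c) := by
  funext a; simp only [coeffDx, coeffDy]; ring

theorem coeffDy_comm (i j : Fin d) (c : Idx d → ℂ) :
    coeffDy i (coeffDy j c) = coeffDy j (coeffDy i c) := by
  funext a
  simp only [coeffDy]
  rcases eq_or_ne i j with rfl | hij
  · rfl
  · rw [add_right_comm a.2 (Pi.single i 1) (Pi.single j 1)]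
    simp only [Pi.add_apply, Pi.single_eq_of_ne hij, Pi.single_eq_of_ne hij.symm]
    push_cast
    ring

theorem derivTF_apply (c : Idx d → ℂ) (p v : Phase d) :
    derivTF c p v = ∑ i, evalTF (coeffDx i c) p * v.1 i + ∑ i, evalTF (coeffDy i c) p * v.2 i := by
  simp [derivTF, sum_apply]

variable [hρ₁ : Fact (0 < ρ₁)]

/-- Transformations with a generating function are symplectic. -/
theorem isSympAt_genStep (g : Gap ρ r ρ₁ r₁ δ) {p q : Fin d → Ham d ρ r hr}
    (hp : ∀ j, ‖p j‖ ≤ δ / 8) {G : Idx d → ℂ} (hpG : ∀ j, (p j).coeff = coeffDx j G)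
    (hqG : ∀ j, (q j).coeff = coeffDy j G) (hr₀ : 0 < r₀) (hρ : ρ₀ < ρ₁) (hrr : r₀ < r₁)
    {z : Phase d} (hz : z ∈ polydom d ρ₀ r₀) :
    IsSympAt (shift (genStep ρ₁ r₁ hr₁ p q)) z := by
  have hδ := g.pos
  have hπ := Real.pi_pos
  set u := genStep ρ₁ r₁ hr₁ p q with hu
  set w := wLim ρ₁ r₁ hr₁ p with hw
  set ζ := shift (yShift w) z with hζ
  have hY := norm_yShift_wLim_le (hr₁ := hr₁) g hp
  have hsh := hasFDerivAt_shift hr₀ hρ hrr u hz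
  refine ⟨shiftDeriv u z, hsh, ?_⟩
  have hshY := hasFDerivAt_shift hr₀ hρ hrr (yShift w) hz
  -- The map (x,y) ↦ (x,y+w) has the old position and the new momentum as components, which are the
  -- arguments of the generating function.
  have hL : ∀ v, shiftDeriv (yShift w) z v = (v.1, (shiftDeriv u z v).2) := fun v => by
    refine Prod.ext (funext fun j => ?_) (funext fun j => ?_)
    · rw [shiftDeriv_fst]
      have : (yShift w (Sum.inl j)).coeff = 0 := rfl
      rw [this, derivTF_apply]
      have hx : ∀ i, coeffDx i (0 : Idx d → ℂ) = 0 := fun i => by funext; simp [coeffDx]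
      have hy : ∀ i, coeffDy i (0 : Idx d → ℂ) = 0 := fun i => by funext; simp [coeffDy]
      simp [hx, hy, evalTF]
    · rw [shiftDeriv_snd, shiftDeriv_snd]
      rfl
  have hζm : ζ ∈ polydom d (ρ₁ + 2 * Real.pi * (δ / 2)) (r₁ + δ / 2) :=
    shift_mem_polydom hY le_rfl le_rfl (polydom_mono hρ.le hrr.le hz)
  have hdp : ∀ c : Ham d ρ r hr, HasFDerivAt (fun z' => c.eval (shift (yShift w) z'))
      ((derivTF c.coeff ζ).comp (shiftDeriv (yShift w) z)) z := fun c => by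
    refine HasFDerivAt.comp z (hasFDerivAt_evalTF (ρ := ρ₁ + 2 * Real.pi * (δ / 2))
      (r := r₁ + δ / 2) (by linarith) ?_ ?_ c.mem hζm) hshY
    · have := g.le_fst; have := mul_pos hπ hδ; linarith
    · have := g.le_snd; linarith
  have hnear := polydom_mem_nhds hρ hrr hz
  -- The implicit relations between old and new variables hold near z, so uniqueness of the
  -- derivative allows them to be linearised.
  have h1 : ∀ j v, (shiftDeriv u z v).1 j =
      v.1 j + derivTF (q j).coeff ζ (v.1, (shiftDeriv u z v).2) := fun j v => by
    have ha : HasFDerivAt (fun z' => (shift u z').1 j) ((dx j).comp (shiftDeriv u z)) z :=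
      (dx j).hasFDerivAt.comp z hsh
    have hb := (dx j).hasFDerivAt (x := z) |>.add (hdp (q j))
    have hab : (fun z' => (shift u z').1 j) =ᶠ[𝓝 z]
        fun z' => dx j z' + (q j).eval (shift (yShift w) z') := by
      filter_upwards [hnear] with z' hz'
      rw [dx_apply, ← g.eval_comp (q j) hY hz']
      rfl
    have := congrArg (fun T : Phase d →L[ℂ] ℂ => T v) (ha.unique (hb.congr_of_eventuallyEq hab))
    simp only [ContinuousLinearMap.comp_apply, add_apply, dx_apply, hL] at this
    exact this
  have h2 : ∀ j v, (shiftDeriv u z v).2 j =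
      v.2 j - derivTF (p j).coeff ζ (v.1, (shiftDeriv u z v).2) := fun j v => by
    have ha : HasFDerivAt (fun z' => (shift u z').2 j) ((dy j).comp (shiftDeriv u z)) z :=
      (dy j).hasFDerivAt.comp z hsh
    have hb := (dy j).hasFDerivAt (x := z) |>.sub (hdp (p j))
    have hab : (fun z' => (shift u z').2 j) =ᶠ[𝓝 z]
        fun z' => dy j z' - (p j).eval (shift (yShift w) z') := by
      filter_upwards [hnear] with z' hz'
      have h3 : (w j).eval z' = -(p j).eval (shift (yShift w) z') := by
        rw [hw, wLim_eq g hp, ← hw, ← g.eval_comp (p j) hY hz', ← neg_one_smul ℂ, Ham.eval_smul,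
          neg_one_mul]
      rw [dy_apply, sub_eq_add_neg, ← h3]
      rfl
    have := congrArg (fun T : Phase d →L[ℂ] ℂ => T v) (ha.unique (hb.congr_of_eventuallyEq hab))
    simp only [ContinuousLinearMap.comp_apply, sub_apply, dy_apply, hL] at this
    exact this
  -- The linearised relations are those of the Hessian of G. As mixed derivatives commute, the block
  -- here is the transpose of the one in the second relation.
  have hv1 : ∀ v, (shiftDeriv u z v).1 = v.1 +
      Matrix.mulVec (Matrix.transpose fun i j => evalTF (coeffDy j (coeffDx i G)) ζ) v.1 +
      Matrix.mulVec (fun i j => evalTF (coeffDy j (coeffDy i G)) ζ) (shiftDeriv u z v).2 :=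
    fun v => by
      funext j
      rw [h1, derivTF_apply, hqG, ← add_assoc]
      simp only [coeffDx_coeffDy]
      rfl
  have hv2 : ∀ v, (shiftDeriv u z v).2 = v.2 -
      Matrix.mulVec (fun i j => evalTF (coeffDx j (coeffDx i G)) ζ) v.1 -
      Matrix.mulVec (fun i j => evalTF (coeffDy j (coeffDx i G)) ζ) (shiftDeriv u z v).2 :=
    fun v => by
      funext j
      rw [h2, derivTF_apply, hpG, ← sub_sub]
      rfl
  intro v v'
  refine sympForm_of_generating _ _ _ ?_ ?_ (hv1 v) (hv2 v) (hv1 v') (hv2 v')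
  · exact Matrix.IsSymm.ext fun i j => by rw [coeffDx_comm]
  · exact Matrix.IsSymm.ext fun i j => by rw [coeffDy_comm]

theorem isSympAt_elimStep [hρ' : Fact (0 < ρ)] (ω : Fin d → ℝ) {Q : Matrix (Fin d) (Fin d) ℂ}
    {σ τ : ℝ} (hσ : 0 < σ) (hτ : 0 < τ) (g : Gap ρ r ρ₁ r₁ δ) (hQ : Q.IsSymm)
    (h : 2 * r * matNorm Q ≤ σ) (K : Ham d ρ r hr)
    (hS : 2 / σ * (1 + τ / r) * ‖farL ω σ τ K‖ ≤ δ / 8) (hr₀ : 0 < r₀) (hρ : ρ₀ < ρ₁)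
    (hrr : r₀ < r₁) {z : Phase d} (hz : z ∈ polydom d ρ₀ r₀) :
    IsSympAt (shift (elimStep ρ₁ r₁ hr₁ ω Q hσ hτ K)) z :=
  isSympAt_genStep g (norm_genDx_solveL_le ω hσ hτ hQ h K hS)
    (G := genCoeff ω σ τ (solveL ω Q hσ hτ K).coeff) (fun j => coeff_genDx ω hσ hτ j _)
    (fun j => coeff_genDy ω hσ hτ j _) hr₀ hρ hrr hz

end ShiftDeriv

/-! ### Real-analyticity is preserved. -/

section Real

open ComplexConjugate

variable {d : ℕ} {ρ r ρ₁ r₁ δ : ℝ} {hr : 0 < r} {hr₁ : 0 < r₁}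

/-- The Hamiltonian takes real values at the real points. -/
def RealH (a : Ham d ρ r hr) : Prop :=
  ∀ x y : Fin d → ℝ, (∀ j, |y j| ≤ r) → (a.eval (realPoint x y)).im = 0

/-- Coefficients of the complex conjugate at the real points. -/
noncomputable def conjCoeff (c : Idx d → ℂ) : Idx d → ℂ := fun i => conj (c (-i.1, i.2))

/-- The reflection `(k, ν) ↦ (-k, ν)`. -/
def reflect (d : ℕ) : Idx d ≃ Idx d := (Equiv.neg (Fin d → ℤ)).prodCongr (Equiv.refl _)

theorem reflect_apply (i : Idx d) : reflect d i = (-i.1, i.2) := rfl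

theorem kNorm_neg (k : Fin d → ℤ) : kNorm (-k) = kNorm k := by simp [kNorm]

theorem MemA.conjCoeff {c : Idx d → ℂ} (hc : MemA ρ r c) : MemA ρ r (conjCoeff c) := by
  refine ((reflect d).summable_iff.2 hc).congr fun i => ?_
  simp [reflect_apply, TFHam.conjCoeff, weight, kNorm_neg]

theorem conj_two : conj (2 : ℂ) = 2 := map_ofNat _ 2

theorem mode_realPoint_reflect (i : Idx d) (x y : Fin d → ℝ) :
    mode (reflect d i) (realPoint x y) = conj (mode i (realPoint x y)) := by
  simp [mode, reflect_apply, realPoint, ← Complex.exp_conj, conj_two]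

theorem evalTF_conjCoeff (c : Idx d → ℂ) (x y : Fin d → ℝ) :
    evalTF (conjCoeff c) (realPoint x y) = conj (evalTF c (realPoint x y)) := by
  rw [evalTF_eq, evalTF_eq, Complex.conj_tsum, ← (reflect d).tsum_eq]
  refine tsum_congr fun i => ?_
  rw [mode_realPoint_reflect, map_mul, conjCoeff, reflect_apply, neg_neg]

theorem realH_of_conjCoeff {a : Ham d ρ r hr} (h : conjCoeff a.coeff = a.coeff) : RealH a := by
  intro x y _
  have := evalTF_conjCoeff a.coeff x y
  rw [h] at this
  exact Complex.conj_eq_iff_im.1 this.symm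

/-- The reflected and conjugated coefficients represent the complex conjugate at real points, so
both series agree there and uniqueness applies. -/
theorem conjCoeff_eq_of_real {s : ℝ} (hρ : 0 ≤ ρ) (hs : 0 < s) (hsr : s ≤ r) {c : Idx d → ℂ}
    (hc : MemA ρ r c)
    (h : ∀ x y : Fin d → ℝ, (∀ j, |y j| ≤ s) → (evalTF c (realPoint x y)).im = 0) :
    conjCoeff c = c := by
  have hr : 0 < r := hs.trans_le hsr
  have : conjCoeff c + (-1 : ℂ) • c = 0 := by
    refine coeff_eq_zero_of_evalTF_real hρ hs hsr (hc.conjCoeff.add hr (hc.smul _))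
      fun x y hy => ?_
    rw [evalTF_add hr.le hc.conjCoeff (hc.smul _)
      (realPoint_mem_polydom hρ fun j => (hy j).trans hsr), evalTF_smul, evalTF_conjCoeff,
      Complex.conj_eq_iff_im.2 (h x y hy)]
    ring
  rw [neg_one_smul] at this
  exact eq_of_sub_eq_zero (by rwa [sub_eq_add_neg])

theorem RealH.conjCoeff_eq (hρ : 0 ≤ ρ) {a : Ham d ρ r hr} (h : RealH a) :
    conjCoeff a.coeff = a.coeff :=
  conjCoeff_eq_of_real hρ hr le_rfl a.mem h

theorem RealH.zero : RealH (0 : Ham d ρ r hr) := fun x y _ => by rw [Ham.eval_zero]; simp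

theorem RealH.restrict (hρ : ρ₁ ≤ ρ) (hrr : r₁ ≤ r) {a : Ham d ρ r hr} (ha : RealH a) :
    RealH (Ham.restrict hρ hrr a : Ham d ρ₁ r₁ hr₁) := fun x y hy => by
  rw [Ham.eval_restrict]; exact ha x y fun j => (hy j).trans hrr

theorem RealH.add (hρ : 0 ≤ ρ) {a b : Ham d ρ r hr} (ha : RealH a) (hb : RealH b) :
    RealH (a + b) := fun x y hy => by
  rw [Ham.eval_add _ _ (realPoint_mem_polydom hρ hy), Complex.add_im, ha x y hy, hb x y hy,
    add_zero]

theorem RealH.smul {a : Ham d ρ r hr} (ha : RealH a) {z : ℂ} (hz : z.im = 0) : RealH (z • a) :=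
  fun x y hy => by rw [Ham.eval_smul, Complex.mul_im, ha x y hy, hz, mul_zero, zero_mul, add_zero]

theorem RealH.neg {a : Ham d ρ r hr} (ha : RealH a) : RealH (-a) := by
  rw [← neg_one_smul ℂ]; exact ha.smul (by simp)

theorem RealH.sum (hρ : 0 ≤ ρ) {ι : Type*} {s : Finset ι} {f : ι → Ham d ρ r hr}
    (h : ∀ i ∈ s, RealH (f i)) : RealH (∑ i ∈ s, f i) := by
  classical
  induction s using Finset.induction_on with
  | empty => exact RealH.zero
  | insert a s ha ih =>
    rw [Finset.sum_insert ha]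
    exact (h a (Finset.mem_insert_self _ _)).add hρ
      (ih fun i hi => h i (Finset.mem_insert_of_mem hi))

theorem neg_mem_farModes {ω : Fin d → ℝ} {σ τ : ℝ} {i : Idx d} :
    ((-i.1, i.2) : Idx d) ∈ farModes ω σ τ ↔ i ∈ farModes ω σ τ := by
  simp [farModes, kNorm_neg, Finset.sum_neg_distrib]

theorem RealH.farL (hρ : 0 ≤ ρ) {a : Ham d ρ r hr} (ha : RealH a) (ω : Fin d → ℝ) (σ τ : ℝ) :
    RealH (TFHam.farL ω σ τ a) := by
  refine realH_of_conjCoeff ?_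
  rw [coeff_farL]
  nth_rw 2 [← ha.conjCoeff_eq hρ]
  funext i
  by_cases hi : i ∈ farModes ω σ τ
  · simp [conjCoeff, projFar, hi, neg_mem_farModes]
  · simp [conjCoeff, projFar, hi, neg_mem_farModes]

theorem freq_neg (ω : Fin d → ℝ) (k : Fin d → ℤ) : freq ω (-k) = -freq ω k := by
  simp [freq, Finset.sum_neg_distrib]

/-- Conjugation together with k ↦ -k changes the sign of i and of ω·k, hence not of their product,
and the set of far modes is symmetric. -/
theorem conjCoeff_genCoeff (ω : Fin d → ℝ) (σ τ : ℝ) (c : Idx d → ℂ) :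
    conjCoeff (genCoeff ω σ τ c) = genCoeff ω σ τ (conjCoeff c) := by
  funext i
  by_cases hi : i ∈ farModes ω σ τ
  · simp [conjCoeff, genCoeff, hi, neg_mem_farModes, freq_neg, conj_two]
  · simp [conjCoeff, genCoeff, hi, neg_mem_farModes]

theorem conjCoeff_coeffDx (j : Fin d) (c : Idx d → ℂ) :
    conjCoeff (coeffDx j c) = coeffDx j (conjCoeff c) := by
  funext i
  simp [conjCoeff, coeffDx, conj_two]

theorem conjCoeff_coeffDy (j : Fin d) (c : Idx d → ℂ) :
    conjCoeff (coeffDy j c) = coeffDy j (conjCoeff c) := by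
  funext i
  simp [conjCoeff, coeffDy]

section

variable {ω : Fin d → ℝ} {Q : Matrix (Fin d) (Fin d) ℂ} {σ τ : ℝ} {hσ : 0 < σ} {hτ : 0 < τ}

theorem RealH.genDx (hρ : 0 ≤ ρ) {a : Ham d ρ r hr} (ha : RealH a) (j : Fin d) :
    RealH (TFHam.genDx ω hσ hτ j a) := by
  refine realH_of_conjCoeff ?_
  rw [coeff_genDx, conjCoeff_coeffDx, conjCoeff_genCoeff, ha.conjCoeff_eq hρ]

theorem RealH.genDy (hρ : 0 ≤ ρ) {a : Ham d ρ r hr} (ha : RealH a) (j : Fin d) :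
    RealH (TFHam.genDy ω hσ hτ j a) := by
  refine realH_of_conjCoeff ?_
  rw [coeff_genDy, conjCoeff_coeffDy, conjCoeff_genCoeff, ha.conjCoeff_eq hρ]

theorem realH_linY (hρ : 0 ≤ ρ) (hQ : ∀ i j, (Q i j).im = 0) (i : Fin d) :
    RealH (linY Q i : Ham d ρ r hr) := fun x y hy => by
  rw [eval_linY _ _ (realPoint_mem_polydom hρ hy), Complex.im_sum]
  exact Finset.sum_eq_zero fun j _ => by simp [realPoint, hQ]

end

theorem RealH.exists_shift (hρ : 0 ≤ ρ) {u : Fin d ⊕ Fin d → Ham d ρ r hr}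
    (hu : ∀ j, RealH (u j)) {x y : Fin d → ℝ} (hy : ∀ j, |y j| ≤ r) :
    ∃ x₁ y₁ : Fin d → ℝ, shift u (realPoint x y) = realPoint x₁ y₁ ∧
      ∀ j, |y₁ j| ≤ r + ‖u (Sum.inr j)‖ := by
  have hp := realPoint_mem_polydom hρ (x := x) hy
  have hre : ∀ j, (((u j).eval (realPoint x y)).re : ℂ) = (u j).eval (realPoint x y) :=
    fun j => Complex.conj_eq_iff_re.1 (Complex.conj_eq_iff_im.2 (hu j x y hy))
  refine ⟨fun j => x j + ((u (Sum.inl j)).eval (realPoint x y)).re,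
    fun j => y j + ((u (Sum.inr j)).eval (realPoint x y)).re, ?_, fun j => ?_⟩
  · refine Prod.ext (funext fun j => ?_) (funext fun j => ?_)
    · change (x j : ℂ) + _ = ((x j + _ : ℝ) : ℂ)
      rw [Complex.ofReal_add, hre]
    · change (y j : ℂ) + _ = ((y j + _ : ℝ) : ℂ)
      rw [Complex.ofReal_add, hre]
  · exact (abs_add_le _ _).trans (add_le_add (hy j)
      ((Complex.abs_re_le_norm _).trans (Ham.norm_eval_le _ hp)))

theorem RealH.lim [Fact (0 < ρ)] {f : ℕ → Ham d ρ r hr} {a : Ham d ρ r hr}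
    (hf : Tendsto f atTop (𝓝 a)) (h : ∀ k, RealH (f k)) : RealH a := fun x y hy => by
  have hp := realPoint_mem_polydom (Fact.out : 0 < ρ).le (x := x) hy
  have h1 : Tendsto (fun k => ((f k).eval (realPoint x y)).im) atTop
      (𝓝 (a.eval (realPoint x y)).im) :=
    (Complex.continuous_im.tendsto _).comp (((Ham.evalHom _ hp).cont.tendsto a).comp hf)
  simp only [h _ x y hy] at h1
  exact tendsto_nhds_unique h1 tendsto_const_nhds |>.symm ▸ rfl

theorem RealH.mul [Fact (0 < ρ)] {a b : Ham d ρ r hr} (ha : RealH a) (hb : RealH b) :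
    RealH (a * b) := fun x y hy => by
  rw [Ham.eval_mul _ _ (realPoint_mem_polydom (Fact.out : 0 < ρ).le hy), Complex.mul_im,
    ha x y hy, hb x y hy, mul_zero, zero_mul, add_zero]

/-- Reality cannot be read off the inverse operator. But the solution is the limit of the iteration
b ↦ 𝕀⁻c - `quadOp` b started at zero, a contraction by 1/2 whose iterates are real when Q is. -/
theorem RealH.solveL [Fact (0 < ρ)] {ω : Fin d → ℝ} {Q : Matrix (Fin d) (Fin d) ℂ} {σ τ : ℝ}
    {hσ : 0 < σ} {hτ : 0 < τ} (hQ : Q.IsSymm) (hQr : ∀ i j, (Q i j).im = 0)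
    (h : 2 * r * matNorm Q ≤ σ) {c : Ham d ρ r hr} (hc : RealH c) :
    RealH (TFHam.solveL ω Q hσ hτ c) := by
  have hρ : 0 ≤ ρ := (Fact.out : 0 < ρ).le
  set a := TFHam.solveL ω Q hσ hτ c
  let F : Ham d ρ r hr → Ham d ρ r hr := fun b => TFHam.farL ω σ τ c - quadOp ω Q hσ hτ b
  have hFa : F a = a := by
    rw [sub_eq_iff_eq_add]; exact (solveL_add ω hσ hτ hQ h c).symm
  have hn := norm_quadOp_le (ρ := ρ) (hr := hr) ω hσ hτ hQ h
  have hF : ∀ b, ‖F b - a‖ ≤ 1 / 2 * ‖b - a‖ := fun b => by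
    have h1 : F b - a = -quadOp ω Q hσ hτ (b - a) := by
      conv_lhs => rw [← hFa]
      simp only [F, map_sub]
      abel
    rw [h1, norm_neg]
    exact ContinuousLinearMap.le_of_opNorm_le _ hn _
  have hreal : ∀ k, RealH (F^[k] 0) := fun k => by
    induction k with
    | zero => exact RealH.zero
    | succ k ih =>
      rw [Function.iterate_succ_apply']
      have h2 : RealH (quadOp ω Q hσ hτ (F^[k] 0)) := by
        rw [quadOp_apply]
        exact (RealH.sum hρ fun i _ => (realH_linY hρ hQr i).mul (ih.genDx hρ i)).farL hρ _ _ _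
      have h3 := (hc.farL hρ ω σ τ).add hρ h2.neg
      rwa [← sub_eq_add_neg] at h3
  have hle : ∀ k, ‖F^[k] 0 - a‖ ≤ (1 / 2) ^ k * ‖a‖ := fun k => by
    induction k with
    | zero => simp
    | succ k ih =>
      rw [Function.iterate_succ_apply']
      refine (hF _).trans ?_
      rw [pow_succ']
      linarith
  refine RealH.lim (f := fun k => F^[k] 0) ?_ hreal
  rw [tendsto_iff_norm_sub_tendsto_zero]
  refine squeeze_zero (fun _ => norm_nonneg _) hle ?_
  simpa using (tendsto_pow_atTop_nhds_zero_of_lt_one (by norm_num : (0 : ℝ) ≤ 1 / 2)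
    (by norm_num)).mul_const ‖a‖

theorem RealH.yShift {w : Fin d → Ham d ρ₁ r₁ hr₁} (hw : ∀ j, RealH (w j))
    (j : Fin d ⊕ Fin d) : RealH (TFHam.yShift w j) := by
  rcases j with j | j
  · exact RealH.zero
  · exact hw j

variable [hρ₁ : Fact (0 < ρ₁)]

theorem RealH.comp (g : Gap ρ r ρ₁ r₁ δ) {c : Ham d ρ r hr} (hc : RealH c)
    {u : Fin d ⊕ Fin d → Ham d ρ₁ r₁ hr₁} (hu : ∀ j, RealH (u j)) (hus : ∀ j, ‖u j‖ ≤ δ / 2) :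
    RealH (TFHam.comp c.coeff u) := fun x y hy => by
  rw [g.eval_comp c hus (realPoint_mem_polydom hρ₁.out.le hy)]
  obtain ⟨x₁, y₁, h, hy₁⟩ := RealH.exists_shift hρ₁.out.le hu (x := x) hy
  rw [h]
  exact hc x₁ y₁ fun j => (hy₁ j).trans
    (by have := hus (Sum.inr j); have := g.half_snd; linarith)

theorem RealH.wLim (g : Gap ρ r ρ₁ r₁ δ) {p : Fin d → Ham d ρ r hr} (hp : ∀ j, ‖p j‖ ≤ δ / 8)
    (h : ∀ j, RealH (p j)) (j : Fin d) : RealH (TFHam.wLim ρ₁ r₁ hr₁ p j) := by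
  refine RealH.lim (tendsto_pi_nhds.1 (tendsto_wIter g hp) j) fun k => ?_
  induction k generalizing j with
  | zero => exact RealH.zero
  | succ k ih => exact ((h j).comp g (RealH.yShift ih) (norm_yShift_wIter_le g hp k)).neg

theorem RealH.genStep (g : Gap ρ r ρ₁ r₁ δ) {p q : Fin d → Ham d ρ r hr}
    (hp : ∀ j, ‖p j‖ ≤ δ / 8) (h : ∀ j, RealH (p j)) (hq : ∀ j, RealH (q j))
    (j : Fin d ⊕ Fin d) : RealH (TFHam.genStep ρ₁ r₁ hr₁ p q j) := by
  rcases j with j | j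
  · exact (hq j).comp g (RealH.yShift (RealH.wLim g hp h)) (norm_yShift_wLim_le g hp)
  · exact RealH.wLim g hp h j

theorem RealH.elimStep [hρ : Fact (0 < ρ)] {ω : Fin d → ℝ} {Q : Matrix (Fin d) (Fin d) ℂ}
    {σ τ : ℝ} {hσ : 0 < σ} {hτ : 0 < τ} (g : Gap ρ r ρ₁ r₁ δ) (hQ : Q.IsSymm)
    (hQr : ∀ i j, (Q i j).im = 0) (h : 2 * r * matNorm Q ≤ σ) {K : Ham d ρ r hr} (hK : RealH K)
    (hS : 2 / σ * (1 + τ / r) * ‖TFHam.farL ω σ τ K‖ ≤ δ / 8) (j : Fin d ⊕ Fin d) :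
    RealH (TFHam.elimStep ρ₁ r₁ hr₁ ω Q hσ hτ K j) :=
  have ha := hK.solveL (ω := ω) (hσ := hσ) (hτ := hτ) hQ hQr h
  RealH.genStep g (norm_genDx_solveL_le ω hσ hτ hQ h K hS) (fun j => ha.genDx hρ.out.le j)
    (fun j => ha.genDy hρ.out.le j) j

end Real

/-! ### The iteration: invariants and geometric bounds. -/

/-- The data of the iteration that eliminates the far from resonance modes: the integrable
Hamiltonian, a decreasing sequence of domains, and a domain contained in all of them. -/
structure ElimData (d : ℕ) where
  ω : Fin d → ℝ
  Q : Matrix (Fin d) (Fin d) ℂ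
  σ : ℝ
  τ : ℝ
  hσ : 0 < σ
  hτ : 0 < τ
  hQ : Q.IsSymm
  ρs : ℕ → ℝ
  rs : ℕ → ℝ
  hρs : ∀ n, 0 < ρs n
  hrs : ∀ n, 0 < rs n
  m : ℝ
  hm : 0 < m
  gap : ∀ n, Gap (ρs n) (rs n) (ρs (n + 1)) (rs (n + 1)) (m / 4 * (1 / 2) ^ n)
  ρf : ℝ
  rf : ℝ
  hρf : 0 < ρf
  hrf : 0 < rf
  gapf : Gap (ρs 0) (rs 0) ρf rf (m / 2)
  ρf_le : ∀ n, ρf ≤ ρs n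
  rf_le : ∀ n, rf ≤ rs n
  hσQ : 2 * rs 0 * matNorm Q ≤ σ
  hσω : σ ≤ ‖ω‖
  b : ℝ
  hb : ∀ n, 1 + τ / rs n ≤ b

namespace ElimData

variable {d : ℕ} (A : ElimData d)

instance (n : ℕ) : Fact (0 < A.ρs n) := ⟨A.hρs n⟩
instance : Fact (0 < A.ρf) := ⟨A.hρf⟩

/-- The room between consecutive domains. -/
noncomputable def δs (n : ℕ) : ℝ := A.m / 4 * (1 / 2) ^ n

theorem δs_pos (n : ℕ) : 0 < A.δs n := (A.gap n).pos

theorem gap' (n : ℕ) : Gap (A.ρs n) (A.rs n) (A.ρs (n + 1)) (A.rs (n + 1)) (A.δs n) := A.gap n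

/-- The Hamiltonians on the `n`-th domain. -/
abbrev Dom (n : ℕ) : Type := Ham d (A.ρs n) (A.rs n) (A.hrs n)

/-- The Hamiltonians on the final domain. -/
abbrev Target : Type := Ham d A.ρf A.rf A.hrf

/-- The elimination step from the `n`-th to the next domain. -/
noncomputable def step (n : ℕ) (K : A.Dom n) : Fin d ⊕ Fin d → A.Dom (n + 1) :=
  elimStep (A.ρs (n + 1)) (A.rs (n + 1)) (A.hrs (n + 1)) A.ω A.Q A.hσ A.hτ K

/-- The sequence of transformed Hamiltonians. -/
noncomputable def ham (H : A.Dom 0) : (n : ℕ) → A.Dom n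
  | 0 => H
  | n + 1 => comp (ham H n).coeff (A.step n (ham H n))

/-- The sequence of transformations, minus the identity. -/
noncomputable def vec (H : A.Dom 0) : (n : ℕ) → Fin d ⊕ Fin d → A.Dom n
  | 0 => 0
  | n + 1 => fun j => A.step n (A.ham H n) j + comp (vec H n j).coeff (A.step n (A.ham H n))

/-- The projection onto the far from resonance modes. -/
noncomputable abbrev far (n : ℕ) : A.Dom n →L[ℂ] A.Dom n := farL A.ω A.σ A.τ

/-- Restriction to the final domain. -/
noncomputable abbrev res (n : ℕ) : A.Dom n →L[ℂ] A.Target := Ham.restrict (A.ρf_le n) (A.rf_le n)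

/-- Bound for the norm of the first step. -/
noncomputable def S (E : ℝ) : ℝ := 2 / A.σ * A.b * E

/-- Bound for the gradient of the perturbation. -/
noncomputable def G (E : ℝ) : ℝ := 174 * ‖A.ω‖ * E / (A.σ * A.m)

/-- Smallness conditions on the initial Hamiltonian. -/
structure Small (H : A.Dom 0) (E D : ℝ) : Prop where
  far_le : ‖A.far 0 H‖ ≤ E
  grad_le : gradA (A.ρs 1 + 2 * Real.pi * (A.δs 0 / 2)) (A.rs 1 + A.δs 0 / 2)
    (H.coeff - h0Coeff A.ω A.Q) ≤ D
  S_le : A.S E ≤ A.m / 32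
  grad_small : (D + A.G E) * (2 / A.σ * A.b) ≤ 1 / 16
  far_small : 448 * ‖A.ω‖ / A.m * (2 / A.σ) ^ 2 * E ≤ 1

variable {A} {H : A.Dom 0} {E D : ℝ}

theorem Small.E_nonneg (h : A.Small H E D) : 0 ≤ E := (norm_nonneg _).trans h.far_le

theorem one_le_b (A : ElimData d) : 1 ≤ A.b :=
  le_trans (by have := A.hτ; have := A.hrs 0; simp; positivity) (A.hb 0)

theorem rs_le (A : ElimData d) (n : ℕ) : A.rs n ≤ A.rs 0 := by
  induction n with
  | zero => exact le_rfl
  | succ n ih => exact (A.gap n).snd_le.trans ih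

theorem hσQ' (A : ElimData d) (n : ℕ) : 2 * A.rs n * matNorm A.Q ≤ A.σ := by
  have := A.rs_le n
  have := matNorm_nonneg A.Q
  exact le_trans (by gcongr) A.hσQ

theorem Small.S_nonneg (h : A.Small H E D) : 0 ≤ A.S E := by
  have := A.hσ
  have := A.one_le_b
  have := h.E_nonneg
  unfold S
  positivity

theorem Small.G_nonneg (h : A.Small H E D) : 0 ≤ A.G E := by
  have := A.hσ
  have := A.hm
  have := h.E_nonneg
  unfold G
  positivity

theorem memA_sub_h0Coeff {ρ r : ℝ} {hr : 0 < r} (K : Ham d ρ r hr) (ω : Fin d → ℝ)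
    (Q : Matrix (Fin d) (Fin d) ℂ) : MemA ρ r (K.coeff - h0Coeff ω Q) := by
  have := K.mem.add hr ((memA_h0Coeff (ρ := ρ) (r := r) ω Q).smul (-1))
  rwa [neg_one_smul, ← sub_eq_add_neg] at this

theorem pow_eighth_le (n : ℕ) : (1 / 8 : ℝ) ^ n ≤ (1 / 2) ^ n :=
  pow_le_pow_left₀ (by norm_num) (by norm_num) n

/-- Displacements decrease like 8⁻ⁿ and rooms only like 2⁻ⁿ, so the condition at n = 0, which is S ≤
m/32, suffices. -/
theorem Small.S_pow_le (h : A.Small H E D) (n : ℕ) : A.S E * (1 / 8) ^ n ≤ A.δs n / 8 := by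
  have h1 := mul_le_mul h.S_le (pow_eighth_le n) (by positivity) (by have := A.hm; positivity)
  refine h1.trans (le_of_eq ?_)
  rw [δs]; ring

/-- What is known about the Hamiltonian before the `n`-th step. -/
structure Inv (A : ElimData d) (n : ℕ) (K : A.Dom n) (E D : ℝ) : Prop where
  far_le : ‖A.far n K‖ ≤ E * (1 / 8) ^ n
  grad_le : gradA (A.ρs (n + 1) + 2 * Real.pi * (A.δs n / 2)) (A.rs (n + 1) + A.δs n / 2)
    (K.coeff - h0Coeff A.ω A.Q) ≤ D + A.G E * (1 - (1 / 4) ^ n)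

theorem Inv.S_le {n : ℕ} {K : A.Dom n} (hK : A.Inv n K E D) :
    2 / A.σ * (1 + A.τ / A.rs n) * ‖A.far n K‖ ≤ A.S E * (1 / 8) ^ n := by
  have h1 := A.hb n
  have h2 := hK.far_le
  have := A.hσ
  have := A.hτ
  have := A.hrs n
  have := A.one_le_b
  calc _ ≤ 2 / A.σ * A.b * (E * (1 / 8) ^ n) := by gcongr
    _ = _ := by rw [S]; ring

/-- The two errors in the new far part, the quadratic one and D·S, are each at most 1/16 of E·8⁻ⁿ,
which together gives the factor 1/8. In the first bound 65/16 = 4 + 1/16, where D·S contributes the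
1/16 because σ ≤ ‖ω‖. -/
theorem Small.estimate (h : A.Small H E D) {n : ℕ} {K : A.Dom n} (hK : A.Inv n K E D) :
    ‖comp K.coeff (A.step n K) - Ham.restrict (A.gap' n).fst_le (A.gap' n).snd_le K‖ ≤
        65 / 16 * (‖A.ω‖ / A.σ) * E * (1 / 8) ^ n ∧
      ‖A.far (n + 1) (comp K.coeff (A.step n K))‖ ≤ E * (1 / 8) ^ (n + 1) := by
  have hσ := A.hσ
  have hm := A.hm
  have hE := h.E_nonneg
  have hb := A.one_le_b
  have hS := h.S_pow_le n
  have hpow : (0 : ℝ) < (1 / 8) ^ n := by positivity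
  have hW : 2 / A.σ * (E * (1 / 8) ^ n) ≤ A.S E * (1 / 8) ^ n := by
    rw [S]
    have h1 : 2 / A.σ * 1 * E ≤ 2 / A.σ * A.b * E := by gcongr
    have h2 := mul_le_mul_of_nonneg_right h1 hpow.le
    linarith
  obtain ⟨h1, h2⟩ := elimStep_estimate (hr₁ := A.hrs (n + 1)) A.ω A.hσ A.hτ (A.gap' n) A.hQ
    (A.hσQ' n) A.hσω K hK.S_le hS hK.far_le (hW.trans hS) hK.grad_le
  have hDS : (D + A.G E * (1 - (1 / 4) ^ n)) * (A.S E * (1 / 8) ^ n) ≤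
      1 / 16 * (E * (1 / 8) ^ n) := by
    have h3 : A.G E * (1 - (1 / 4) ^ n) ≤ A.G E :=
      mul_le_of_le_one_right h.G_nonneg (by have : (0 : ℝ) < (1 / 4) ^ n := by positivity
                                            linarith)
    have h4 : (D + A.G E * (1 - (1 / 4) ^ n)) * (2 / A.σ * A.b) ≤ 1 / 16 :=
      le_trans (mul_le_mul_of_nonneg_right (by linarith) (by positivity)) h.grad_small
    have h5 := mul_le_mul_of_nonneg_right h4 (mul_nonneg hE hpow.le)
    rw [S]
    linarith
  have hωσ : 1 ≤ ‖A.ω‖ / A.σ := (one_le_div hσ).2 A.hσω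
  have hEp : 0 ≤ E * (1 / 8) ^ n := mul_nonneg hE hpow.le
  constructor
  · refine h1.trans ?_
    have e1 : 2 * ‖A.ω‖ * (2 / A.σ * (E * (1 / 8) ^ n)) =
        4 * (‖A.ω‖ / A.σ) * (E * (1 / 8) ^ n) := by ring
    have h6 := mul_le_mul_of_nonneg_right hωσ hEp
    rw [e1]
    linarith
  · refine h2.trans ?_
    have e1 : 7 * ‖A.ω‖ / A.δs n * (2 / A.σ * (E * (1 / 8) ^ n)) ^ 2 =
        (448 * ‖A.ω‖ / A.m * (2 / A.σ) ^ 2 * E) * (1 / 16) * (E * (1 / 8) ^ n) *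
          ((1 / 8) ^ n * 2 ^ n) := by
      rw [δs, one_div_pow 2]
      field_simp
      ring
    have h3 : (1 / 8 : ℝ) ^ n * 2 ^ n ≤ 1 := by
      rw [← mul_pow]
      exact pow_le_one₀ (by norm_num) (by norm_num)
    have h4 : (448 * ‖A.ω‖ / A.m * (2 / A.σ) ^ 2 * E) * (1 / 16) * (E * (1 / 8) ^ n) *
          ((1 / 8) ^ n * 2 ^ n) ≤ 1 * (1 / 16) * (E * (1 / 8) ^ n) * 1 := by
      have := h.far_small
      gcongr
    rw [e1, pow_succ (1 / 8 : ℝ) n]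
    linarith

/-- The n-th change of the Hamiltonian is of order 8⁻ⁿ and Cauchy's estimate on the next domain
costs a factor of order 2ⁿ, so the gradient grows by a geometric series of ratio 1/4. The constant
174 is chosen such that 130 = 32 · 65/16 is at most 3/4 of it. -/
theorem Small.inv (h : A.Small H E D) (n : ℕ) : A.Inv n (A.ham H n) E D := by
  have hσ := A.hσ
  have hm := A.hm
  have hπ := Real.pi_pos
  induction n with
  | zero =>
    have hz : A.ham H 0 = H := rfl
    rw [hz]
    exact ⟨by simpa using h.far_le, by simpa using h.grad_le⟩
  | succ n ih =>
    obtain ⟨h1, h2⟩ := h.estimate ih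
    refine ⟨h2, ?_⟩
    set K := A.ham H n with hK
    have hK1 : A.ham H (n + 1) = comp K.coeff (A.step n K) := rfl
    rw [hK1]
    set K' := comp K.coeff (A.step n K) with hK'
    set R := K' - Ham.restrict (A.gap' n).fst_le (A.gap' n).snd_le K with hR
    have hco : K'.coeff - h0Coeff A.ω A.Q = (K.coeff - h0Coeff A.ω A.Q) + R.coeff := by
      rw [hR, Ham.coeff_sub, Ham.coeff_restrict]; abel
    have hg1 := (A.gap' n).gradA (A.hrs (n + 1)) (memA_sub_h0Coeff K A.ω A.Q)
    have hg2 := (A.gap' (n + 1)).gradA (A.hrs (n + 2)) R.mem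
    have hδ := A.δs_pos n
    have hδ1 := A.δs_pos (n + 1)
    have hle1 : A.ρs (n + 2) + 2 * Real.pi * (A.δs (n + 1) / 2) ≤
        A.ρs (n + 1) + 2 * Real.pi * (A.δs n / 2) := by
      have := (A.gap' (n + 1)).half_fst
      have := mul_pos hπ hδ
      linarith
    have hle2 : A.rs (n + 2) + A.δs (n + 1) / 2 ≤ A.rs (n + 1) + A.δs n / 2 := by
      have := (A.gap' (n + 1)).half_snd
      linarith
    have hr0 : 0 ≤ A.rs (n + 2) + A.δs (n + 1) / 2 := by have := A.hrs (n + 2); linarith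
    have h3 := (MemG.add hr0 (hg1.1.mono hle1 hr0 hle2) hg2.1).2
    rw [hco]
    refine h3.trans ?_
    have h4 := (gradA_mono hg1.1 hle1 hr0 hle2).trans ih.grad_le
    have h5 : 4 / A.δs (n + 1) * ‖R‖ ≤ A.G E * ((1 / 4) ^ n * (3 / 4)) := by
      calc _ ≤ 4 / A.δs (n + 1) * (65 / 16 * (‖A.ω‖ / A.σ) * E * (1 / 8) ^ n) := by gcongr
        _ = 130 * ‖A.ω‖ * E / (A.σ * A.m) * ((1 / 8) ^ n * 2 ^ n) := by
          rw [δs, one_div_pow 2 (n + 1), pow_succ]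
          field_simp
          ring
        _ = 130 * ‖A.ω‖ * E / (A.σ * A.m) * (1 / 4) ^ n := by rw [← mul_pow]; norm_num
        _ ≤ _ := by
          have hE := h.E_nonneg
          have hE' := mul_nonneg (norm_nonneg A.ω) hE
          have h8 : A.G E * ((1 / 4) ^ n * (3 / 4)) =
              174 * ‖A.ω‖ * E * (3 / 4) / (A.σ * A.m) * (1 / 4) ^ n := by rw [G]; ring
          rw [h8]
          refine mul_le_mul_of_nonneg_right ?_ (by positivity)
          exact div_le_div_of_nonneg_right (by linarith) (by positivity)
    have h6 : gradA (A.ρs (n + 2) + 2 * Real.pi * (A.δs (n + 1) / 2))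
        (A.rs (n + 2) + A.δs (n + 1) / 2) R.coeff ≤ 4 / A.δs (n + 1) * ‖R‖ := hg2.2
    have h7 : A.G E * (1 - (1 / 4) ^ (n + 1)) = A.G E * (1 - (1 / 4) ^ n) +
        A.G E * ((1 / 4) ^ n * (3 / 4)) := by ring
    rw [h7]
    linarith

theorem Small.sum_norm_step_le (h : A.Small H E D) (n : ℕ) :
    ∑ j, ‖A.step n (A.ham H n) j‖ ≤ A.S E * (1 / 8) ^ n :=
  sum_norm_elimStep_le A.ω A.hσ A.hτ (A.gap' n) A.hQ (A.hσQ' n) _ (h.inv n).S_le (h.S_pow_le n)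

theorem Small.norm_step_le (h : A.Small H E D) (n : ℕ) (j : Fin d ⊕ Fin d) :
    ‖A.step n (A.ham H n) j‖ ≤ A.S E * (1 / 8) ^ n :=
  (Finset.single_le_sum (f := fun j => ‖A.step n (A.ham H n) j‖) (fun _ _ => norm_nonneg _)
    (Finset.mem_univ j)).trans (h.sum_norm_step_le n)

theorem Small.norm_step_le_half (h : A.Small H E D) (n : ℕ) (j : Fin d ⊕ Fin d) :
    ‖A.step n (A.ham H n) j‖ ≤ A.δs n / 2 :=
  (h.norm_step_le n j).trans ((h.S_pow_le n).trans (by have := A.δs_pos n; linarith))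

/-- The increment is a new displacement plus a composition that does not increase the norm, and 8/7
is the sum of the powers of 1/8. -/
theorem Small.sum_norm_vec_le (h : A.Small H E D) (n : ℕ) :
    ∑ j, ‖A.vec H n j‖ ≤ 8 / 7 * A.S E * (1 - (1 / 8) ^ n) := by
  induction n with
  | zero => simp [vec]
  | succ n ih =>
    have h1 : ∑ j, ‖A.vec H (n + 1) j‖ ≤
        ∑ j, ‖A.step n (A.ham H n) j‖ + ∑ j, ‖A.vec H n j‖ := by
      rw [← Finset.sum_add_distrib]
      exact Finset.sum_le_sum fun j _ => (norm_add_le _ _).trans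
        (add_le_add_right ((A.gap' n).norm_comp_le _ (h.norm_step_le_half n)) _)
    have h2 := h.sum_norm_step_le n
    have h3 : 8 / 7 * A.S E * (1 - (1 / 8) ^ (n + 1)) =
        A.S E * (1 / 8) ^ n + 8 / 7 * A.S E * (1 - (1 / 8) ^ n) := by ring
    rw [h3]
    linarith

theorem Small.norm_vec_le (h : A.Small H E D) (n : ℕ) (j : Fin d ⊕ Fin d) :
    ‖A.vec H n j‖ ≤ 8 / 7 * A.S E := by
  refine (Finset.single_le_sum (f := fun j => ‖A.vec H n j‖) (fun _ _ => norm_nonneg _)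
    (Finset.mem_univ j)).trans ((h.sum_norm_vec_le n).trans ?_)
  have := h.S_nonneg
  exact mul_le_of_le_one_right (by positivity)
    (by have : (0 : ℝ) < (1 / 8) ^ n := by positivity
        linarith)

/-- Besides the new displacement, the old transformation is moved by composing it with the new step.
Its Lipschitz constant grows like 2ⁿ against a displacement of order 8⁻ⁿ, hence the rate 1/4. -/
theorem Small.norm_vec_sub_le (h : A.Small H E D) (n : ℕ) (j : Fin d ⊕ Fin d) :
    ‖A.res (n + 1) (A.vec H (n + 1) j) - A.res n (A.vec H n j)‖ ≤
      2 * A.S E * (1 / 4) ^ n := by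
  have hm := A.hm
  have hS := h.S_nonneg
  have hδ := A.δs_pos n
  set v := A.step n (A.ham H n)
  have h0 : A.res n (A.vec H n j) = A.res (n + 1)
      (Ham.restrict (A.gap' n).fst_le (A.gap' n).snd_le (A.vec H n j)) := by
    refine Ham.ext ?_
    rw [Ham.coeff_restrict, Ham.coeff_restrict, Ham.coeff_restrict]
  have h1 : A.vec H (n + 1) j = v j + comp (A.vec H n j).coeff v := rfl
  rw [h0, ← map_sub]
  refine (Ham.norm_restrict_le _ _ _).trans ?_
  rw [← (A.gap' n).comp_zero, h1, add_sub_assoc]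
  have h2 := (A.gap' n).norm_comp_sub_le (A.vec H n j) (u := v) (u' := 0)
    (η := A.S E * (1 / 8) ^ n) (mul_nonneg hS (by positivity)) (h.norm_step_le_half n)
    (fun j => by simpa using (half_pos hδ).le) (fun j => by simpa using h.norm_step_le n j)
  have h3 : 4 / A.δs n * ‖A.vec H n j‖ * (A.S E * (1 / 8) ^ n) ≤ A.S E * (1 / 4) ^ n := by
    calc _ ≤ 4 / A.δs n * (8 / 7 * (A.m / 32)) * (A.S E * (1 / 8) ^ n) := by
          have := (h.norm_vec_le n j).trans (mul_le_mul_of_nonneg_left h.S_le (by norm_num))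
          gcongr
      _ = 4 / 7 * A.S E * ((1 / 8) ^ n * 2 ^ n) := by
          rw [δs, one_div_pow 2]
          field_simp
          ring
      _ ≤ 1 * A.S E * ((1 / 8) ^ n * 2 ^ n) := by gcongr; norm_num
      _ = _ := by rw [← mul_pow]; norm_num
  have h4 : A.S E * (1 / 8) ^ n ≤ A.S E * (1 / 4) ^ n := by gcongr; norm_num
  have h5 := h.norm_step_le n j
  refine (norm_add_le _ _).trans ?_
  linarith

theorem Small.norm_ham_sub_le (h : A.Small H E D) (n : ℕ) :
    ‖A.res n (A.ham H n) - A.res 0 H‖ ≤ 65 / 14 * (‖A.ω‖ / A.σ) * E * (1 - (1 / 8) ^ n) := by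
  induction n with
  | zero => simp [ham]
  | succ n ih =>
    have h0 : A.res n (A.ham H n) = A.res (n + 1)
        (Ham.restrict (A.gap' n).fst_le (A.gap' n).snd_le (A.ham H n)) := by
      refine Ham.ext ?_
      rw [Ham.coeff_restrict, Ham.coeff_restrict, Ham.coeff_restrict]
    have h1 := (h.estimate (h.inv n)).1
    have h2 : ‖A.res (n + 1) (A.ham H (n + 1)) - A.res n (A.ham H n)‖ ≤
        65 / 16 * (‖A.ω‖ / A.σ) * E * (1 / 8) ^ n := by
      rw [h0, ← map_sub]
      exact (Ham.norm_restrict_le _ _ _).trans h1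
    have h3 := norm_add_le (A.res (n + 1) (A.ham H (n + 1)) - A.res n (A.ham H n))
      (A.res n (A.ham H n) - A.res 0 H)
    rw [sub_add_sub_cancel] at h3
    have h4 : 65 / 14 * (‖A.ω‖ / A.σ) * E * (1 - (1 / 8) ^ (n + 1)) =
      65 / 16 * (‖A.ω‖ / A.σ) * E * (1 / 8) ^ n +
        65 / 14 * (‖A.ω‖ / A.σ) * E * (1 - (1 / 8) ^ n) := by ring
    rw [h4]
    linarith

end ElimData

/-! ### Bounds and convergence of derivatives. -/

section DerivBound

variable {d : ℕ} {ρ r ρ₀ r₀ : ℝ} {hr : 0 < r}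

theorem norm_derivTF_apply_le (hr : 0 ≤ r) {c : Idx d → ℂ} (hc : MemG ρ r c) {p : Phase d}
    (hp : p ∈ polydom d ρ r) (v : Phase d) : ‖derivTF c p v‖ ≤ gradA ρ r c * ‖v‖ := by
  obtain ⟨hx, hy⟩ := (memG_iff hr c).1 hc
  rw [← normGrad_eq_gradA hr hc, derivTF_apply, normGrad, add_mul, Finset.sum_mul, Finset.sum_mul]
  refine (norm_add_le _ _).trans (add_le_add ?_ ?_)
  · refine (norm_sum_le _ _).trans (Finset.sum_le_sum fun i _ => ?_)
    rw [norm_mul]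
    exact mul_le_mul (norm_evalTF_le hr (hx i) hp)
      ((norm_le_pi_norm v.1 i).trans (norm_fst_le v)) (norm_nonneg _)
      ((norm_nonneg _).trans (norm_evalTF_le hr (hx i) hp))
  · refine (norm_sum_le _ _).trans (Finset.sum_le_sum fun i _ => ?_)
    rw [norm_mul]
    exact mul_le_mul (norm_evalTF_le hr (hy i) hp)
      ((norm_le_pi_norm v.2 i).trans (norm_snd_le v)) (norm_nonneg _)
      ((norm_nonneg _).trans (norm_evalTF_le hr (hy i) hp))

theorem exists_gap (hρ : ρ₀ < ρ) (hrr : r₀ < r) : ∃ s, Gap ρ r ρ₀ r₀ s := by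
  have hπ := Real.pi_pos
  refine ⟨min ((ρ - ρ₀) / (2 * Real.pi)) (r - r₀),
    lt_min (div_pos (by linarith) (by positivity)) (by linarith), ?_, ?_⟩
  · have := min_le_left ((ρ - ρ₀) / (2 * Real.pi)) (r - r₀)
    rw [le_div_iff₀ (by positivity)] at this
    linarith
  · have := min_le_right ((ρ - ρ₀) / (2 * Real.pi)) (r - r₀)
    linarith

/-- Convergence in norm on a larger domain implies convergence of the gradients on a smaller one, by
Cauchy's estimate for the difference. -/
theorem tendsto_derivTF (hr₀ : 0 < r₀) (hρ : ρ₀ < ρ) (hrr : r₀ < r) {p : Phase d}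
    (hp : p ∈ polydom d ρ₀ r₀) {f : ℕ → Ham d ρ r hr} {a : Ham d ρ r hr}
    (hf : Tendsto f atTop (𝓝 a)) (v : Phase d) :
    Tendsto (fun n => derivTF (f n).coeff p v) atTop (𝓝 (derivTF a.coeff p v)) := by
  obtain ⟨s, g⟩ := exists_gap hρ hrr
  rw [tendsto_iff_norm_sub_tendsto_zero] at hf ⊢
  refine squeeze_zero (fun _ => norm_nonneg _) (fun n => ?_)
    (by simpa using (hf.const_mul (2 / s)).mul_const ‖v‖)
  have hsub : derivTF (f n).coeff p v - derivTF a.coeff p v = derivTF (f n - a).coeff p v := by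
    have h1 := (hasFDerivAt_evalTF hr₀ hρ hrr (f n).mem hp).sub
      (hasFDerivAt_evalTF hr₀ hρ hrr a.mem hp)
    have h2 := hasFDerivAt_evalTF hr₀ hρ hrr (f n - a).mem hp
    have h3 : evalTF (f n - a).coeff =ᶠ[𝓝 p] fun q => evalTF (f n).coeff q - evalTF a.coeff q := by
      filter_upwards [polydom_mem_nhds hρ hrr hp] with q hq
      have := Ham.eval_add (f n - a) a hq
      rw [sub_add_cancel] at this
      rw [eq_sub_iff_add_eq]
      exact this.symm
    rw [h2.unique (h1.congr_of_eventuallyEq h3), sub_apply]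
  have hc := (f n - a).mem.cauchy g.pos hr₀.le g.le_fst g.le_snd
  rw [hsub]
  exact (norm_derivTF_apply_le hr₀.le hc.1 hp v).trans
    (mul_le_mul_of_nonneg_right hc.2 (norm_nonneg v))

end DerivBound

/-! ### The limit transformation and its properties. -/

namespace ElimData

variable {d : ℕ} (A : ElimData d)

/-- The limit of the transformations, minus the identity. -/
noncomputable def lim (H : A.Dom 0) (j : Fin d ⊕ Fin d) : A.Target :=
  limUnder atTop fun n => A.res n (A.vec H n j)

/-- The transformed Hamiltonian. -/
noncomputable def trans (H : A.Dom 0) : A.Target := comp H.coeff (A.lim H)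

variable {A} {H : A.Dom 0} {E D : ℝ}

theorem Small.tendsto_vec (h : A.Small H E D) (j : Fin d ⊕ Fin d) :
    Tendsto (fun n => A.res n (A.vec H n j)) atTop (𝓝 (A.lim H j)) :=
  tendsto_limUnder_of_geometric (by norm_num) fun n => h.norm_vec_sub_le n j

theorem Small.norm_res_vec_le (h : A.Small H E D) (n : ℕ) (j : Fin d ⊕ Fin d) :
    ‖A.res n (A.vec H n j)‖ ≤ A.m / 28 := by
  refine ((Ham.norm_restrict_le _ _ _).trans (h.norm_vec_le n j)).trans ?_
  have := h.S_le
  linarith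

theorem Small.sum_norm_lim_le (h : A.Small H E D) :
    ∑ j, ‖A.lim H j‖ ≤ 8 / 7 * A.S E := by
  refine le_of_tendsto (tendsto_finsetSum _ fun j _ => (h.tendsto_vec j).norm)
    (Eventually.of_forall fun n => ?_)
  refine (Finset.sum_le_sum fun j _ => Ham.norm_restrict_le _ _ _).trans
    ((h.sum_norm_vec_le n).trans ?_)
  have := h.S_nonneg
  exact mul_le_of_le_one_right (by positivity)
    (by have : (0 : ℝ) < (1 / 8) ^ n := by positivity
        linarith)

theorem Small.norm_lim_le (h : A.Small H E D) (j : Fin d ⊕ Fin d) : ‖A.lim H j‖ ≤ A.m / 28 :=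
  le_of_tendsto (h.tendsto_vec j).norm (Eventually.of_forall fun n => h.norm_res_vec_le n j)

theorem Small.norm_lim_le_half (h : A.Small H E D) (j : Fin d ⊕ Fin d) :
    ‖A.lim H j‖ ≤ A.m / 2 / 2 := (h.norm_lim_le j).trans (by have := A.hm; linarith)

theorem Small.shift_step_mem (h : A.Small H E D) (n : ℕ) {p : Phase d}
    (hp : p ∈ polydom d (A.ρs (n + 1)) (A.rs (n + 1))) :
    shift (A.step n (A.ham H n)) p ∈ polydom d (A.ρs n) (A.rs n) :=
  polydom_mono (A.gap' n).half_fst (A.gap' n).half_snd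
    (shift_mem_polydom (h.norm_step_le_half n) le_rfl le_rfl hp)

theorem Small.shift_vec_succ (h : A.Small H E D) (n : ℕ) {p : Phase d}
    (hp : p ∈ polydom d (A.ρs (n + 1)) (A.rs (n + 1))) :
    shift (A.vec H (n + 1)) p = shift (A.vec H n) (shift (A.step n (A.ham H n)) p) := by
  have h1 : ∀ j, (A.vec H (n + 1) j).eval p = (A.step n (A.ham H n) j).eval p +
      (A.vec H n j).eval (shift (A.step n (A.ham H n)) p) := fun j => by
    rw [← (A.gap' n).eval_comp _ (h.norm_step_le_half n) hp, ← Ham.eval_add _ _ hp]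
    rfl
  refine Prod.ext (funext fun j => ?_) (funext fun j => ?_)
  · change p.1 j + _ = p.1 j + _ + _
    rw [h1, add_assoc]
  · change p.2 j + _ = p.2 j + _ + _
    rw [h1, add_assoc]

theorem shift_vec_zero (H : A.Dom 0) (p : Phase d) : shift (A.vec H 0) p = p := by
  have h1 : ∀ j, (A.vec H 0 j).eval p = 0 := fun j => Ham.eval_zero p
  refine Prod.ext (funext fun j => ?_) (funext fun j => ?_)
  · change p.1 j + _ = p.1 j
    rw [h1, add_zero]
  · change p.2 j + _ = p.2 j
    rw [h1, add_zero]

theorem Small.eval_ham (h : A.Small H E D) (n : ℕ) {p : Phase d}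
    (hp : p ∈ polydom d (A.ρs n) (A.rs n)) :
    (A.ham H n).eval p = H.eval (shift (A.vec H n) p) := by
  induction n generalizing p with
  | zero => rw [shift_vec_zero]; rfl
  | succ n ih =>
    rw [h.shift_vec_succ n hp, ← ih (h.shift_step_mem n hp)]
    exact (A.gap' n).eval_comp _ (h.norm_step_le_half n) hp

theorem polydom_target_subset (n : ℕ) : polydom d A.ρf A.rf ⊆ polydom d (A.ρs n) (A.rs n) :=
  polydom_mono (A.ρf_le n) (A.rf_le n)

/-- On the final domain, the n-th Hamiltonian is the original one composed with the product of the
first n maps. Its limit then follows from continuity of the composition in the map. -/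
theorem Small.res_ham (h : A.Small H E D) (n : ℕ) :
    A.res n (A.ham H n) = comp H.coeff fun j => A.res n (A.vec H n j) := by
  refine Ham.ext_eval A.hρf.le fun p hp => ?_
  rw [Ham.eval_restrict, h.eval_ham n (polydom_target_subset n hp), A.gapf.eval_comp H
    (fun j => (h.norm_res_vec_le n j).trans (by have := A.hm; linarith)) hp]
  simp only [shift, Ham.eval_restrict]

theorem Small.tendsto_ham (h : A.Small H E D) :
    Tendsto (fun n => A.res n (A.ham H n)) atTop (𝓝 (A.trans H)) := by
  have hpi : Tendsto (fun n j => A.res n (A.vec H n j)) atTop (𝓝 (A.lim H)) :=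
    tendsto_pi_nhds.2 h.tendsto_vec
  rw [tendsto_iff_norm_sub_tendsto_zero] at hpi ⊢
  refine squeeze_zero (fun _ => norm_nonneg _) (fun n => ?_)
    (by simpa using hpi.const_mul (4 / (A.m / 2) * ‖H‖))
  rw [h.res_ham, trans]
  exact A.gapf.norm_comp_sub_le H (norm_nonneg _)
    (fun j => (h.norm_res_vec_le n j).trans (by have := A.hm; linarith)) h.norm_lim_le_half
    (norm_le_pi_norm ((fun j => A.res n (A.vec H n j)) - A.lim H))

/-- The far part of the n-th Hamiltonian is at most E·8⁻ⁿ, and the projection is continuous. -/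
theorem Small.far_trans (h : A.Small H E D) : farL A.ω A.σ A.τ (A.trans H) = 0 := by
  have h1 : Tendsto (fun n => farL A.ω A.σ A.τ (A.res n (A.ham H n))) atTop
      (𝓝 (farL A.ω A.σ A.τ (A.trans H))) :=
    ((farL A.ω A.σ A.τ).continuous.tendsto _).comp h.tendsto_ham
  refine tendsto_nhds_unique h1 (squeeze_zero_norm (fun n => ?_)
    (a := fun n => E * (1 / 8) ^ n) ?_)
  · rw [← restrict_farL]
    exact (Ham.norm_restrict_le _ _ _).trans (h.inv n).far_le
  · simpa using (tendsto_pow_atTop_nhds_zero_of_lt_one (by norm_num : (0 : ℝ) ≤ 1 / 8)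
      (by norm_num)).const_mul E

theorem Small.norm_trans_sub_le (h : A.Small H E D) :
    ‖A.trans H - A.res 0 H‖ ≤ 65 / 14 * (‖A.ω‖ / A.σ) * E := by
  refine le_of_tendsto (h.tendsto_ham.sub_const _).norm (Eventually.of_forall fun n => ?_)
  refine (h.norm_ham_sub_le n).trans ?_
  have := h.E_nonneg
  have := A.hσ
  exact mul_le_of_le_one_right (by positivity)
    (by have : (0 : ℝ) < (1 / 8) ^ n := by positivity
        linarith)

theorem Small.eval_trans (h : A.Small H E D) {p : Phase d} (hp : p ∈ polydom d A.ρf A.rf) :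
    (A.trans H).eval p = H.eval (shift (A.lim H) p) :=
  A.gapf.eval_comp H h.norm_lim_le_half hp

/-- Chain rule. The domain varies in the induction because a step moves the point into a larger
polydomain. -/
theorem Small.isSympAt_vec (h : A.Small H E D) (n : ℕ) {ρ₀ r₀ : ℝ} (hr₀ : 0 < r₀)
    (hρ : ρ₀ < A.ρs n) (hrr : r₀ < A.rs n) {p : Phase d} (hp : p ∈ polydom d ρ₀ r₀) :
    IsSympAt (shift (A.vec H n)) p := by
  induction n generalizing p ρ₀ r₀ with
  | zero =>
    have hid : shift (A.vec H 0) = id := funext fun q => shift_vec_zero H q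
    rw [hid]
    exact ⟨_, hasFDerivAt_id p, fun v w => rfl⟩
  | succ n ih =>
    have hδ := A.δs_pos n
    have hπ := Real.pi_pos
    refine IsSympAt.congr (f := shift (A.vec H n) ∘ shift (A.step n (A.ham H n))) ?_ ?_
    · refine IsSympAt.comp ?_ (isSympAt_elimStep A.ω A.hσ A.hτ (A.gap' n) A.hQ (A.hσQ' n) _
        ((h.inv n).S_le.trans (h.S_pow_le n)) hr₀ hρ hrr hp)
      refine ih (ρ₀ := ρ₀ + 2 * Real.pi * (A.δs n / 2)) (r₀ := r₀ + A.δs n / 2) (by linarith) ?_ ?_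
        (shift_mem_polydom (h.norm_step_le_half n) hρ.le hrr.le hp)
      · have := (A.gap' n).half_fst; linarith
      · have := (A.gap' n).half_snd; linarith
    · filter_upwards [polydom_mem_nhds hρ hrr hp] with q hq
      exact h.shift_vec_succ n hq

/-- Preserving the symplectic form is a closed condition and the derivatives converge. -/
theorem Small.isSympAt_lim (h : A.Small H E D) {ρ₀ r₀ : ℝ} (hr₀ : 0 < r₀)
    (hρ : ρ₀ < A.ρf) (hrr : r₀ < A.rf) {p : Phase d} (hp : p ∈ polydom d ρ₀ r₀) :
    IsSympAt (shift (A.lim H)) p := by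
  refine ⟨shiftDeriv (A.lim H) p, hasFDerivAt_shift hr₀ hρ hrr _ hp, fun v w => ?_⟩
  have hder : ∀ v j, Tendsto (fun n => derivTF (A.vec H n j).coeff p v) atTop
      (𝓝 (derivTF (A.lim H j).coeff p v)) := fun v j => by
    have := tendsto_derivTF hr₀ hρ hrr hp (h.tendsto_vec j) v
    simpa only [Ham.coeff_restrict] using this
  have h1 : ∀ v j, Tendsto (fun n => (shiftDeriv (A.vec H n) p v).1 j) atTop
      (𝓝 ((shiftDeriv (A.lim H) p v).1 j)) := fun v j => (hder v _).const_add _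
  have h2 : ∀ v j, Tendsto (fun n => (shiftDeriv (A.vec H n) p v).2 j) atTop
      (𝓝 ((shiftDeriv (A.lim H) p v).2 j)) := fun v j => (hder v _).const_add _
  have h3 : Tendsto (fun n => sympForm (shiftDeriv (A.vec H n) p v) (shiftDeriv (A.vec H n) p w))
      atTop (𝓝 (sympForm (shiftDeriv (A.lim H) p v) (shiftDeriv (A.lim H) p w))) :=
    tendsto_finsetSum _ fun j _ => ((h2 v j).mul (h1 w j)).sub ((h1 v j).mul (h2 w j))
  refine tendsto_nhds_unique h3 (tendsto_const_nhds.congr fun n => ?_)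
  have hρn := hρ.trans_le (A.ρf_le n)
  have hrn := hrr.trans_le (A.rf_le n)
  obtain ⟨L, hL, hLs⟩ := h.isSympAt_vec n hr₀ hρn hrn hp
  rw [← (hL.unique (hasFDerivAt_shift hr₀ hρn hrn _ hp)), hLs]

theorem Small.realH_ham (h : A.Small H E D) (hH : RealH H) (hQ : ∀ i j, (A.Q i j).im = 0) (n : ℕ) :
    RealH (A.ham H n) := by
  induction n with
  | zero => exact hH
  | succ n ih =>
    exact ih.comp (A.gap' n) (RealH.elimStep (A.gap' n) A.hQ hQ (A.hσQ' n) ih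
      ((h.inv n).S_le.trans (h.S_pow_le n))) (h.norm_step_le_half n)

theorem Small.realH_vec (h : A.Small H E D) (hH : RealH H) (hQ : ∀ i j, (A.Q i j).im = 0) (n : ℕ)
    (j : Fin d ⊕ Fin d) : RealH (A.vec H n j) := by
  induction n generalizing j with
  | zero => exact RealH.zero
  | succ n ih =>
    have h1 : ∀ j, RealH (A.step n (A.ham H n) j) := RealH.elimStep (A.gap' n) A.hQ hQ (A.hσQ' n)
      (h.realH_ham hH hQ n) ((h.inv n).S_le.trans (h.S_pow_le n))
    exact (h1 j).add (A.hρs _).le ((ih j).comp (A.gap' n) h1 (h.norm_step_le_half n))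

theorem Small.realH_lim (h : A.Small H E D) (hH : RealH H) (hQ : ∀ i j, (A.Q i j).im = 0)
    (j : Fin d ⊕ Fin d) : RealH (A.lim H j) :=
  RealH.lim (h.tendsto_vec j) fun n => (h.realH_vec hH hQ n j).restrict _ _

section Holomorphy

variable {U : Set ℂ} {γ : ℂ → A.Dom 0}

theorem differentiableOn_step (hU : IsOpen U) (h : ∀ z ∈ U, A.Small (γ z) E D) (n : ℕ)
    (hd : DifferentiableOn ℂ (fun z => A.ham (γ z) n) U) (j : Fin d ⊕ Fin d) :
    DifferentiableOn ℂ (fun z => A.step n (A.ham (γ z) n) j) U :=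
  differentiableOn_genStep (A.gap' n) hU
    (fun j => (genDx A.ω A.hσ A.hτ j).differentiable.comp_differentiableOn
      ((solveL A.ω A.Q A.hσ A.hτ).differentiable.comp_differentiableOn hd))
    (fun j => (genDy A.ω A.hσ A.hτ j).differentiable.comp_differentiableOn
      ((solveL A.ω A.Q A.hσ A.hτ).differentiable.comp_differentiableOn hd))
    (fun z hz => norm_genDx_solveL_le A.ω A.hσ A.hτ A.hQ (A.hσQ' n) _
      (((h z hz).inv n).S_le.trans ((h z hz).S_pow_le n))) j

theorem differentiableOn_ham (hU : IsOpen U) (hγ : DifferentiableOn ℂ γ U)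
    (h : ∀ z ∈ U, A.Small (γ z) E D) (n : ℕ) :
    DifferentiableOn ℂ (fun z => A.ham (γ z) n) U := by
  induction n with
  | zero => exact hγ
  | succ n ih =>
    exact differentiableOn_comp (half_pos (A.δs_pos n)).le hU ih (A.gap' n).half_fst
      (A.gap' n).half_snd (differentiableOn_step hU h n ih)
      fun z hz => (h z hz).norm_step_le_half n

theorem differentiableOn_vec (hU : IsOpen U) (hγ : DifferentiableOn ℂ γ U)
    (h : ∀ z ∈ U, A.Small (γ z) E D) (n : ℕ) (j : Fin d ⊕ Fin d) :
    DifferentiableOn ℂ (fun z => A.vec (γ z) n j) U := by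
  induction n generalizing j with
  | zero => exact differentiableOn_const _
  | succ n ih =>
    have h1 := differentiableOn_step hU h n (differentiableOn_ham hU hγ h n)
    exact (h1 j).add (differentiableOn_comp (half_pos (A.δs_pos n)).le hU (ih j)
      (A.gap' n).half_fst (A.gap' n).half_snd h1 fun z hz => (h z hz).norm_step_le_half n)

/-- The bounds E and D are the same for all z, so the geometric convergence is uniform in z. -/
theorem differentiableOn_lim (hU : IsOpen U) (hγ : DifferentiableOn ℂ γ U)
    (h : ∀ z ∈ U, A.Small (γ z) E D) (j : Fin d ⊕ Fin d) :
    DifferentiableOn ℂ (fun z => A.lim (γ z) j) U :=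
  differentiableOn_limUnder_of_geometric (f := fun n z => A.res n (A.vec (γ z) n j))
    (by norm_num) (by norm_num) hU
    (fun n => (A.res n).differentiable.comp_differentiableOn (differentiableOn_vec hU hγ h n j))
    fun z hz n => (h z hz).norm_vec_sub_le n j

theorem differentiableOn_trans (hU : IsOpen U) (hγ : DifferentiableOn ℂ γ U)
    (h : ∀ z ∈ U, A.Small (γ z) E D) : DifferentiableOn ℂ (fun z => A.trans (γ z)) U :=
  differentiableOn_comp (half_pos A.gapf.pos).le hU hγ A.gapf.half_fst A.gapf.half_snd
    (differentiableOn_lim hU hγ h) fun z hz => (h z hz).norm_lim_le_half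

end Holomorphy

end ElimData

/-! ### Injectivity, images of domains, passage from 𝒜' to 𝒜, real parts. -/

section Prelim

variable {d : ℕ} {ρ r ρ₁ r₁ : ℝ} {hr : 0 < r} {hr₁ : 0 < r₁}

theorem convex_polydom (d : ℕ) (ρ r : ℝ) : Convex ℝ (polydom d ρ r) := by
  intro p hp q hq a b ha hb hab j
  constructor
  · have h1 : ((a • p + b • q).1 j).im = a * (p.1 j).im + b * (q.1 j).im := by simp
    rw [h1]
    refine (abs_add_le _ _).trans ?_
    rw [abs_mul, abs_mul, abs_of_nonneg ha, abs_of_nonneg hb]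
    calc _ ≤ a * (ρ / (2 * Real.pi)) + b * (ρ / (2 * Real.pi)) :=
          add_le_add (mul_le_mul_of_nonneg_left (hp j).1 ha)
            (mul_le_mul_of_nonneg_left (hq j).1 hb)
      _ = _ := by rw [← add_mul, hab, one_mul]
  · have h1 : (a • p + b • q).2 j = (a : ℂ) * p.2 j + (b : ℂ) * q.2 j := by simp
    rw [h1]
    refine (norm_add_le _ _).trans ?_
    rw [norm_mul, norm_mul, Complex.norm_real, Complex.norm_real, Real.norm_of_nonneg ha,
      Real.norm_of_nonneg hb]
    calc _ ≤ a * r + b * r :=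
          add_le_add (mul_le_mul_of_nonneg_left (hp j).2 ha)
            (mul_le_mul_of_nonneg_left (hq j).2 hb)
      _ = _ := by rw [← add_mul, hab, one_mul]

/-- A `C¹`-small perturbation of the identity is injective. -/
theorem injOn_shift (hr : 0 < r) (hρ : ρ < ρ₁) (hrr : r < r₁) {u : Fin d ⊕ Fin d → Ham d ρ₁ r₁ hr₁}
    (hu : ∀ j, MemG ρ r (u j).coeff ∧ gradA ρ r (u j).coeff ≤ 1 / 2) :
    InjOn (shift u) (polydom d ρ r) := by
  intro p hp q hq hpq
  have h1 : ∀ j, ‖(u j).eval q - (u j).eval p‖ ≤ 1 / 2 * ‖q - p‖ := fun j =>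
    (convex_polydom d ρ r).norm_image_sub_le_of_norm_hasFDerivWithin_le (𝕜 := ℂ)
      (fun z hz => (hasFDerivAt_evalTF hr hρ hrr (u j).mem hz).hasFDerivWithinAt)
      (fun z hz => ContinuousLinearMap.opNorm_le_bound _ (by norm_num) fun v =>
        (norm_derivTF_apply_le hr.le (hu j).1 hz v).trans
          (mul_le_mul_of_nonneg_right (hu j).2 (norm_nonneg v))) hp hq
  have h2 : ‖p - q‖ ≤ 1 / 2 * ‖q - p‖ := by
    have hc : (0 : ℝ) ≤ 1 / 2 * ‖q - p‖ := by positivity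
    refine norm_prod_le_iff.2 ⟨(pi_norm_le_iff_of_nonneg hc).2 fun j => ?_,
      (pi_norm_le_iff_of_nonneg hc).2 fun j => ?_⟩
    · have h3 : p.1 j + (u (Sum.inl j)).eval p = q.1 j + (u (Sum.inl j)).eval q :=
        congrFun (congrArg Prod.fst hpq) j
      have h4 : (p - q).1 j = (u (Sum.inl j)).eval q - (u (Sum.inl j)).eval p := by
        change p.1 j - q.1 j = _
        linear_combination h3
      rw [h4]
      exact h1 _
    · have h3 : p.2 j + (u (Sum.inr j)).eval p = q.2 j + (u (Sum.inr j)).eval q :=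
        congrFun (congrArg Prod.snd hpq) j
      have h4 : (p - q).2 j = (u (Sum.inr j)).eval q - (u (Sum.inr j)).eval p := by
        change p.2 j - q.2 j = _
        linear_combination h3
      rw [h4]
      exact h1 _
  rw [norm_sub_rev q p] at h2
  have h5 : ‖p - q‖ ≤ 0 := by linarith
  exact sub_eq_zero.1 (norm_le_zero_iff.1 h5)

/-- The domain 𝒟 is defined by sums over the components, so the displacement is measured by the sum
of the norms. -/
theorem shift_mapsTo_dom {s : ℝ} (hρ : ρ ≤ ρ₁) (hrr : r ≤ r₁)
    {u : Fin d ⊕ Fin d → Ham d ρ₁ r₁ hr₁} (hu : ∑ j, ‖u j‖ ≤ s) :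
    MapsTo (shift u) (dom d ρ r) (dom d (ρ + 2 * Real.pi * s) (r + s)) := by
  intro p hp
  have hπ := Real.pi_pos
  have hp' := polydom_mono hρ hrr (dom_subset_polydom ρ r hp)
  have he : ∀ j, ‖(u j).eval p‖ ≤ ‖u j‖ := fun j => Ham.norm_eval_le (u j) hp'
  rw [Fintype.sum_sum_type] at hu
  have h1 : 0 ≤ ∑ j, ‖u (Sum.inl j)‖ := Finset.sum_nonneg fun _ _ => norm_nonneg _
  have h2 : 0 ≤ ∑ j, ‖u (Sum.inr j)‖ := Finset.sum_nonneg fun _ _ => norm_nonneg _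
  constructor
  · have h3 : ∑ j, |((shift u p).1 j).im| ≤ ∑ j, |(p.1 j).im| + ∑ j, ‖u (Sum.inl j)‖ := by
      rw [← Finset.sum_add_distrib]
      refine Finset.sum_le_sum fun j _ => ?_
      rw [shift]
      simp only [Complex.add_im]
      exact (abs_add_le _ _).trans (add_le_add le_rfl ((Complex.abs_im_le_norm _).trans (he _)))
    have h4 : (ρ + 2 * Real.pi * s) / (2 * Real.pi) = ρ / (2 * Real.pi) + s := by field_simp
    have := hp.1
    rw [h4]
    linarith
  · have h3 : ∑ j, ‖(shift u p).2 j‖ ≤ ∑ j, ‖p.2 j‖ + ∑ j, ‖u (Sum.inr j)‖ := by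
      rw [← Finset.sum_add_distrib]
      exact Finset.sum_le_sum fun j _ => (norm_add_le _ _).trans (add_le_add le_rfl (he _))
    have := hp.2
    linarith

theorem analyticOnNhd_shift (hρ : ρ ≤ ρ₁) (hrr : r ≤ r₁) (u : Fin d ⊕ Fin d → Ham d ρ₁ r₁ hr₁) :
    AnalyticOnNhd ℂ (shift u) (dom d ρ r) := by
  intro p hp
  have hπ := Real.pi_pos
  have h : ∀ j, AnalyticAt ℂ (u j).eval p := fun j => by
    refine analyticAt_evalTF hr₁ (u j).mem fun i => ⟨?_, ?_⟩
    · refine ((Finset.single_le_sum (f := fun j => |(p.1 j).im|) (fun _ _ => abs_nonneg _)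
        (Finset.mem_univ i)).trans_lt hp.1).trans_le (by gcongr)
    · exact ((Finset.single_le_sum (f := fun j => ‖p.2 j‖) (fun _ _ => norm_nonneg _)
        (Finset.mem_univ i)).trans_lt hp.2).trans_le hrr
  refine AnalyticAt.prod (analyticAt_pi_iff.2 fun j => ?_) (analyticAt_pi_iff.2 fun j => ?_)
  · exact ((dx j).analyticAt p).add (h _)
  · exact ((dy j).analyticAt p).add (h _)

/-- Restriction of an element of `𝒜'` to a smaller domain, forgetting the derivatives. -/
def HamC1.toHam (hρ : ρ₁ ≤ ρ) (hrr : r₁ ≤ r) (H : HamC1 d ρ r hr) : Ham d ρ₁ r₁ hr₁ :=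
  Ham.mk H.coeff (H.2.1.mono hρ hr₁.le hrr)

theorem HamC1.coeff_toHam (hρ : ρ₁ ≤ ρ) (hrr : r₁ ≤ r) (H : HamC1 d ρ r hr) :
    (H.toHam hρ hrr : Ham d ρ₁ r₁ hr₁).coeff = H.coeff := Ham.coeff_mk _ _

theorem HamC1.toHam_add_smul (hρ : ρ₁ ≤ ρ) (hrr : r₁ ≤ r) (H K : HamC1 d ρ r hr) (z : ℂ) :
    ((H + z • K).toHam hρ hrr : Ham d ρ₁ r₁ hr₁) = H.toHam hρ hrr + z • K.toHam hρ hrr :=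
  rfl

theorem HamC1.normA_le (H : HamC1 d ρ r hr) : normA ρ r H.coeff ≤ ‖H‖ :=
  le_add_of_nonneg_right (normGrad_nonneg hr)

theorem HamC1.memG (H : HamC1 d ρ r hr) : MemG ρ r H.coeff := (memG_iff hr.le _).2 H.2.2

theorem HamC1.gradA_le (H : HamC1 d ρ r hr) : gradA ρ r H.coeff ≤ ‖H‖ := by
  rw [← normGrad_eq_gradA hr.le H.memG]
  exact le_add_of_nonneg_left (normA_nonneg hr)

theorem HamC1.coeff_sub_h0 (H : HamC1 d ρ r hr) (ω : Fin d → ℝ) (Q : Matrix (Fin d) (Fin d) ℂ) :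
    (H - h0 ρ r hr ω Q).coeff = H.coeff - h0Coeff ω Q := rfl

theorem HamC1.IsReal.conjCoeff_eq (hρ : 0 < ρ) {H : HamC1 d ρ r hr} (h : H.IsReal) :
    conjCoeff H.coeff = H.coeff := by
  have hπ := Real.pi_pos
  -- 𝒟 bounds the sum of the |y_j|, while uniqueness is applied on a cube. This cube is small enough
  -- to lie in 𝒟, and a cube of any size determines the coefficients.
  have hs : 0 < r / (d + 1) := by positivity
  refine conjCoeff_eq_of_real hρ.le hs (div_le_self hr.le (by simp)) H.2.1 fun x y hy => ?_
  refine h x y ⟨?_, ?_⟩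
  · simp only [realPoint, Complex.ofReal_im, abs_zero, Finset.sum_const_zero]
    positivity
  · calc ∑ j, ‖(realPoint x y).2 j‖ ≤ ∑ _j : Fin d, r / (d + 1) :=
          Finset.sum_le_sum fun j _ => by simpa [realPoint] using hy j
      _ = d * r / (d + 1) := by simp [mul_div_assoc]
      _ < r := by rw [div_lt_iff₀ (by positivity)]; linarith

theorem gradA_conjCoeff (c : Idx d → ℂ) : gradA ρ r (conjCoeff c) = gradA ρ r c := by
  rw [gradA, gradA, ← (reflect d).tsum_eq]
  refine tsum_congr fun i => ?_
  simp [reflect_apply, conjCoeff, gradWeight, kNorm_neg]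

theorem MemG.conjCoeff {c : Idx d → ℂ} (hc : MemG ρ r c) : MemG ρ r (conjCoeff c) := by
  refine ((reflect d).summable_iff.2 hc).congr fun i => ?_
  simp [reflect_apply, TFHam.conjCoeff, gradWeight, kNorm_neg]

theorem gradA_smul (z : ℂ) (c : Idx d → ℂ) : gradA ρ r (z • c) = ‖z‖ * gradA ρ r c := by
  simp only [gradA, Pi.smul_apply, norm_smul, mul_assoc, tsum_mul_left]

theorem MemG.smul (z : ℂ) {c : Idx d → ℂ} (hc : MemG ρ r c) : MemG ρ r (z • c) := by
  have := Summable.mul_left ‖z‖ hc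
  simpa [MemG, mul_assoc] using this

/-- The real part of a matrix. -/
def reMat (Q : Matrix (Fin d) (Fin d) ℂ) : Matrix (Fin d) (Fin d) ℂ := fun i j => ((Q i j).re : ℂ)

theorem reMat_isSymm {Q : Matrix (Fin d) (Fin d) ℂ} (hQ : Q.IsSymm) : (reMat Q).IsSymm :=
  Matrix.IsSymm.ext fun i j => by rw [reMat, reMat, hQ.apply]

theorem matNorm_reMat_le (Q : Matrix (Fin d) (Fin d) ℂ) : matNorm (reMat Q) ≤ matNorm Q :=
  ciSup_mono (Set.finite_range _).bddAbove fun j => Finset.sum_le_sum fun i _ => by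
    rw [reMat, Complex.norm_real]; exact Complex.abs_re_le_norm _

/-- Conjugation leaves the real vector ω alone and conjugates Q. The identity is checked at real
points, where the left side is a real part. -/
theorem h0Coeff_reMat (ω : Fin d → ℝ) (Q : Matrix (Fin d) (Fin d) ℂ) :
    (1 / 2 : ℂ) • (h0Coeff ω Q + conjCoeff (h0Coeff ω Q)) = h0Coeff ω (reMat Q) := by
  have hm : ∀ Q, MemA 0 1 (h0Coeff ω Q) := fun Q => memA_h0Coeff ω Q
  have hmc := (hm Q).conjCoeff
  refine sub_eq_zero.1 ?_
  rw [sub_eq_add_neg, ← neg_one_smul ℂ (h0Coeff ω (reMat Q))]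
  refine coeff_eq_zero_of_evalTF_real le_rfl one_pos le_rfl
    ((((hm Q).add one_pos hmc).smul _).add one_pos ((hm _).smul _)) fun x y hy => ?_
  have hp := realPoint_mem_polydom (le_refl (0 : ℝ)) (x := x) hy
  rw [evalTF_add zero_le_one (((hm Q).add one_pos hmc).smul _) ((hm _).smul _) hp, evalTF_smul,
    evalTF_smul, evalTF_add zero_le_one (hm Q) hmc hp, evalTF_conjCoeff, Complex.add_conj,
    evalTF_h0Coeff, evalTF_h0Coeff]
  apply Complex.ext
  · simp [realPoint, reMat]
  · simp [realPoint, reMat]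

end Prelim

/-! ### Replacing Q by a real matrix. -/

section QuadraticPart

variable {d : ℕ} {ρ r : ℝ} {hr : 0 < r}

/-- The quadratic part of the integrable Hamiltonian may be replaced by a real one if there is a
real Hamiltonian nearby. -/
theorem exists_quadraticPart (hρ : 0 < ρ) (ω : Fin d → ℝ) {Q : Matrix (Fin d) (Fin d) ℂ}
    (hQ : Q.IsSymm) (ε : ℝ) :
    ∃ Q' : Matrix (Fin d) (Fin d) ℂ, Q'.IsSymm ∧ matNorm Q' ≤ matNorm Q ∧
      ∀ H ∈ Metric.ball (h0 ρ r hr ω Q) ε,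
        (MemG ρ r (H.coeff - h0Coeff ω Q') ∧ gradA ρ r (H.coeff - h0Coeff ω Q') ≤ 2 * ε) ∧
        (H.IsReal → ∀ i j, (Q' i j).im = 0) := by
  -- Reality is claimed for the real members of the ball only. If there are none, Q itself will do.
  by_cases h : ∃ H₀ ∈ Metric.ball (h0 ρ r hr ω Q) ε, H₀.IsReal
  · obtain ⟨H₀, hH₀, hreal⟩ := h
    refine ⟨reMat Q, reMat_isSymm hQ, matNorm_reMat_le Q, fun H hH => ⟨?_, fun _ i j => by
      rw [reMat, Complex.ofReal_im]⟩⟩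
    rw [mem_ball_iff_norm] at hH hH₀
    set X := H₀ - h0 ρ r hr ω Q with hX
    set c := conjCoeff X.coeff - X.coeff with hc
    have hcm : MemG ρ r (conjCoeff X.coeff + (-1 : ℂ) • X.coeff) ∧
        gradA ρ r (conjCoeff X.coeff + (-1 : ℂ) • X.coeff) ≤ 2 * ‖X‖ := by
      have h1 := X.memG
      refine ⟨(h1.conjCoeff.add hr.le (h1.smul _)).1, ?_⟩
      refine (h1.conjCoeff.add hr.le (h1.smul _)).2.trans ?_
      rw [gradA_conjCoeff, gradA_smul, norm_neg, norm_one, one_mul]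
      have := X.gradA_le
      linarith
    have hconj : conjCoeff X.coeff = H₀.coeff - conjCoeff (h0Coeff ω Q) := by
      have h2 : conjCoeff X.coeff = conjCoeff H₀.coeff - conjCoeff (h0Coeff ω Q) := by
        funext i
        simp [hX, HamC1.coeff_sub_h0, conjCoeff]
      rw [h2, hreal.conjCoeff_eq hρ]
    -- The real H₀ drops out of conj X - X, half of which is H⁰ with Q minus H⁰ with Re Q. Since ‖X‖
    -- < ε, this part contributes at most ε to the gradient.
    have hsplit : H.coeff - h0Coeff ω (reMat Q) = (H - h0 ρ r hr ω Q).coeff +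
        (1 / 2 : ℂ) • (conjCoeff X.coeff + (-1 : ℂ) • X.coeff) := by
      rw [hconj, hX, HamC1.coeff_sub_h0, HamC1.coeff_sub_h0, ← h0Coeff_reMat]
      funext i
      simp only [Pi.add_apply, Pi.sub_apply, Pi.smul_apply, smul_eq_mul]
      ring
    have h3 := (H - h0 ρ r hr ω Q).memG.add hr.le (hcm.1.smul (1 / 2))
    rw [hsplit]
    refine ⟨h3.1, h3.2.trans ?_⟩
    rw [gradA_smul]
    have h4 := (H - h0 ρ r hr ω Q).gradA_le
    have h5 : ‖(1 / 2 : ℂ)‖ = 1 / 2 := by norm_num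
    rw [h5]
    linarith [hcm.2]
  · refine ⟨Q, hQ, le_rfl, fun H hH => ⟨⟨(H - h0 ρ r hr ω Q).memG, ?_⟩,
      fun hreal => absurd ⟨H, hH, hreal⟩ h⟩⟩
    have hpos : 0 < ε := (Metric.nonempty_ball.1 ⟨H, hH⟩)
    rw [mem_ball_iff_norm] at hH
    refine (H - h0 ρ r hr ω Q).gradA_le.trans ?_
    linarith

end QuadraticPart

/-! ### The sequence of domains. -/

section MakeData

variable {d : ℕ}

theorem one_sub_half_pow_mem (n : ℕ) : 0 ≤ 1 - (1 / 2 : ℝ) ^ n ∧ 1 - (1 / 2 : ℝ) ^ n ≤ 1 := by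
  have h1 : (0 : ℝ) < (1 / 2) ^ n := by positivity
  have h2 : (1 / 2 : ℝ) ^ n ≤ 1 := pow_le_one₀ (by norm_num) (by norm_num)
  constructor <;> linarith

/-- The iteration on the domain with parameters `R` and `r'`, where a room of size `m` is
available. -/
noncomputable def mkElimData (ω : Fin d → ℝ) {Q : Matrix (Fin d) (Fin d) ℂ} (hQ : Q.IsSymm)
    {σ τ R r' m β : ℝ} (hσ : 0 < σ) (hτ : 0 < τ) (hm : 0 < m) (hR : 2 * Real.pi * m < R)
    (hr' : m < r') (hσQ : 2 * r' * matNorm Q ≤ σ) (hσω : σ ≤ ‖ω‖)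
    (hβ : 1 + 2 * τ / r' ≤ 2 * β) : ElimData d where
  ω := ω
  Q := Q
  σ := σ
  τ := τ
  hσ := hσ
  hτ := hτ
  hQ := hQ
  -- The rooms m/4 · 2⁻ⁿ add up to m/2, which is where the final domain of the iteration lies.
  ρs n := R - 2 * Real.pi * (m / 2 * (1 - (1 / 2) ^ n))
  rs n := r' - m / 2 * (1 - (1 / 2) ^ n)
  hρs n := by
    have h1 := mul_le_mul_of_nonneg_left (one_sub_half_pow_mem n).2 hm.le
    have h2 := mul_le_mul_of_nonneg_left h1 Real.pi_pos.le
    have := mul_pos Real.pi_pos hm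
    linarith
  hrs n := by
    have h1 := mul_le_mul_of_nonneg_left (one_sub_half_pow_mem n).2 hm.le
    linarith
  m := m
  hm := hm
  gap n := ⟨by positivity, le_of_eq (by rw [pow_succ]; ring), le_of_eq (by rw [pow_succ]; ring)⟩
  ρf := R - 2 * Real.pi * (m / 2)
  rf := r' - m / 2
  hρf := by have := mul_pos Real.pi_pos hm; linarith
  hrf := by linarith
  gapf := ⟨by linarith, by simp, by simp⟩
  ρf_le n := by
    have h1 := mul_le_mul_of_nonneg_left (one_sub_half_pow_mem n).2 (half_pos hm).le
    have h2 := mul_le_mul_of_nonneg_left h1 (by have := Real.pi_pos; linarith :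
      0 ≤ 2 * Real.pi)
    linarith
  rf_le n := by
    have h1 := mul_le_mul_of_nonneg_left (one_sub_half_pow_mem n).2 (half_pos hm).le
    linarith
  hσQ := by simpa using hσQ
  hσω := hσω
  b := 2 * β
  hb n := by
    refine le_trans ?_ hβ
    have h1 := mul_le_mul_of_nonneg_left (one_sub_half_pow_mem n).2 (half_pos hm).le
    -- All radii stay above r'/2 because m < r', so that b can be chosen independently of n.
    have h2 : r' / 2 ≤ r' - m / 2 * (1 - (1 / 2) ^ n) := by linarith
    have h3 : 2 * τ / r' = τ / (r' / 2) := by field_simp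
    rw [h3]
    have : 0 < r' / 2 := by linarith
    gcongr

end MakeData

/-! ### The radius ε and the smallness conditions. -/

section Constants

/-- The room available between the two domains. -/
noncomputable def room (ν r r' : ℝ) : ℝ := min 1 (min (ν / (2 * Real.pi)) (r' - r))

/-- The factor `1 + 2π + (τ+1)/r'`. -/
noncomputable def lossFactor (τ r' : ℝ) : ℝ := 1 + 2 * Real.pi + (τ + 1) / r'

theorem room_pos {ν r r' : ℝ} (hν : 0 < ν) (hrr' : r < r') : 0 < room ν r r' := by
  have := Real.pi_pos
  exact lt_min one_pos (lt_min (by positivity) (by linarith))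

theorem room_le_one (ν r r' : ℝ) : room ν r r' ≤ 1 := min_le_left _ _

theorem two_pi_room_le (ν r r' : ℝ) : 2 * Real.pi * room ν r r' ≤ ν := by
  have h := (min_le_right 1 (min (ν / (2 * Real.pi)) (r' - r))).trans (min_le_left _ _)
  have hπ : 0 < 2 * Real.pi := by have := Real.pi_pos; linarith
  rw [le_div_iff₀ hπ] at h
  rw [room]
  linarith

theorem room_le_sub (ν r r' : ℝ) : room ν r r' ≤ r' - r :=
  (min_le_right 1 (min (ν / (2 * Real.pi)) (r' - r))).trans (min_le_right _ _)

theorem seven_le_lossFactor {τ r' : ℝ} (hτ : 0 < τ) (hr' : 0 < r') : 7 ≤ lossFactor τ r' := by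
  have h1 : 0 < (τ + 1) / r' := by positivity
  have := Real.pi_gt_three
  rw [lossFactor]
  linarith

theorem le_two_mul_lossFactor {τ r' : ℝ} (hr' : 0 < r') :
    1 + 2 * τ / r' ≤ 2 * lossFactor τ r' := by
  have h1 : 0 < 1 / r' := by positivity
  have := Real.pi_gt_three
  rw [lossFactor, add_div, mul_div_assoc]
  linarith

variable {d : ℕ} {ω : Fin d → ℝ} {Q : Matrix (Fin d) (Fin d) ℂ} {σ τ ν r r' : ℝ}

/-- The estimate of the radius from which all smallness conditions follow. -/
theorem epsRadius_mul_le (hτ : 0 < τ) (hν : 0 < ν)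
    (hr : 0 < r) (hrr' : r < r') (hω : 0 < ‖ω‖) :
    epsRadius ω Q σ τ ν r r' * ‖ω‖ * (2352 * lossFactor τ r' ^ 2) ≤ σ ^ 2 * room ν r r' := by
  have hr' : 0 < r' := hr.trans hrr'
  have hm := room_pos hν hrr'
  have hβ := seven_le_lossFactor hτ hr'
  have hN := abs_le_normA_h0Coeff ω Q hr'
  -- One of the two factors `room` in ε is traded for ‖ω‖, by m‖ω‖ ≤ r'‖ω‖ ≤ ‖H⁰‖. With (2π+1)² ≥ 49
  -- the constant is 2352 = 48 · 49.
  have hmr : room ν r r' ≤ r' := (room_le_sub ν r r').trans (by linarith)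
  have hN' : room ν r r' * ‖ω‖ ≤ normA 0 r' (h0Coeff ω Q) :=
    (mul_le_mul_of_nonneg_right hmr hω.le).trans hN
  have hmω : 0 < room ν r r' * ‖ω‖ := mul_pos hm hω
  have ha : 49 ≤ (2 * Real.pi + 1) ^ 2 := by nlinarith [Real.pi_gt_three]
  have hβ2 : 0 < lossFactor τ r' ^ 2 := by positivity
  have he : epsRadius ω Q σ τ ν r r' = σ ^ 2 * room ν r r' ^ 2 /
    (48 * normA 0 r' (h0Coeff ω Q) * (2 * Real.pi + 1) ^ 2 * lossFactor τ r' ^ 2) := rfl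
  have hNpos : 0 < normA 0 r' (h0Coeff ω Q) := hmω.trans_le hN'
  rw [he, div_mul_eq_mul_div, div_mul_eq_mul_div, div_le_iff₀ (by positivity)]
  have h1 : room ν r r' * ‖ω‖ * 49 ≤ normA 0 r' (h0Coeff ω Q) * (2 * Real.pi + 1) ^ 2 := by gcongr
  have h2 := mul_le_mul_of_nonneg_left h1
    (by positivity : 0 ≤ 48 * σ ^ 2 * room ν r r' * lossFactor τ r' ^ 2)
  linarith

theorem epsRadius_nonneg (hr' : 0 < r') : 0 ≤ epsRadius ω Q σ τ ν r r' := by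
  have := normA_nonneg (ρ := 0) (a := h0Coeff ω Q) hr'
  unfold epsRadius
  positivity

theorem epsRadius_pos (hσ : 0 < σ) (hτ : 0 < τ) (hν : 0 < ν) (hr' : 0 < r') (hrr' : r < r')
    (hω : 0 < ‖ω‖) : 0 < epsRadius ω Q σ τ ν r r' := by
  have hm := room_pos hν hrr'
  have hN : 0 < normA 0 r' (h0Coeff ω Q) := (mul_pos hr' hω).trans_le
    (abs_le_normA_h0Coeff ω Q hr')
  have hm' : 0 < min 1 (min (ν / (2 * Real.pi)) (r' - r)) := hm
  have := Real.pi_pos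
  unfold epsRadius
  positivity

/-- The smallness conditions of the iteration hold for all `e ≤ ε`. -/
theorem smallness_conditions {e m β w : ℝ} (he : 0 ≤ e) (hm : 0 < m) (hm1 : m ≤ 1) (hσ : 0 < σ)
    (hσω : σ ≤ w) (hβ : 7 ≤ β) (h : e * w * (2352 * β ^ 2) ≤ σ ^ 2 * m) :
    2 / σ * (2 * β) * e ≤ m / 4116 ∧ 448 * w / m * (2 / σ) ^ 2 * e ≤ 1 ∧
      (2 * e + 174 * w * e / (σ * m)) * (2 / σ * (2 * β)) ≤ 1 / 16 ∧
      (w / σ) ^ 2 * e ≤ w * m / 2 := by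
  have hw : 0 < w := hσ.trans_le hσω
  -- All conditions are expressed by `y`, for which the hypothesis reads yβ² ≤ 1/2352. Dividing by β
  -- ≥ 7 once and twice gives 16464 = 7 · 2352 and 115248 = 49 · 2352.
  set y := e * w / (σ ^ 2 * m) with hy
  have hy0 : 0 ≤ y := by positivity
  have hyβ2 : y * β ^ 2 ≤ 1 / 2352 := by
    rw [hy, div_mul_eq_mul_div, div_le_iff₀ (by positivity)]
    linarith
  have hyβ : y * β ≤ 1 / 16464 := by nlinarith
  have hy1 : y ≤ 1 / 115248 := by nlinarith
  have heσ : e / σ ≤ y * m := by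
    have h1 : y * m = e / σ * (w / σ) := by rw [hy]; field_simp
    rw [h1]
    exact le_mul_of_one_le_right (by positivity) ((one_le_div hσ).2 hσω)
  have hβe : e / σ * β ≤ m / 16464 := by
    calc _ ≤ y * m * β := mul_le_mul_of_nonneg_right heσ (by linarith)
      _ = m * (y * β) := by ring
      _ ≤ m * (1 / 16464) := by gcongr
      _ = _ := by ring
  refine ⟨?_, ?_, ?_, ?_⟩
  · have e1 : 2 / σ * (2 * β) * e = 4 * (e / σ * β) := by ring
    rw [e1]
    linarith
  · have e1 : 448 * w / m * (2 / σ) ^ 2 * e = 1792 * y := by rw [hy]; field_simp; ring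
    rw [e1]
    linarith
  · have e1 : (2 * e + 174 * w * e / (σ * m)) * (2 / σ * (2 * β)) =
        8 * (e / σ * β) + 696 * (y * β) := by rw [hy]; field_simp; ring
    rw [e1]
    linarith
  · have e1 : (w / σ) ^ 2 * e = w * m * y := by rw [hy]; field_simp
    rw [e1, div_eq_mul_one_div]
    gcongr
    linarith

end Constants

/-! ### From the smallness conditions to the symplectomorphism. -/

namespace ElimData

variable {d : ℕ} {A : ElimData d} {ρ r R r' E D : ℝ} {hr : 0 < r} {hr' : 0 < r'}

theorem small_toHam (hR : A.ρs 0 ≤ R) (hr0 : A.rs 0 ≤ r') {H : HamC1 d R r' hr'}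
    (hE : normA R r' (projFar A.ω A.σ A.τ H.coeff) ≤ E)
    (hG : MemG R r' (H.coeff - h0Coeff A.ω A.Q))
    (hD : gradA R r' (H.coeff - h0Coeff A.ω A.Q) ≤ D) (hS : A.S E ≤ A.m / 32)
    (hDG : (D + A.G E) * (2 / A.σ * A.b) ≤ 1 / 16)
    (hfar : 448 * ‖A.ω‖ / A.m * (2 / A.σ) ^ 2 * E ≤ 1) :
    A.Small (H.toHam hR hr0) E D where
  far_le := by
    have h1 : MemA R r' (projFar A.ω A.σ A.τ H.coeff) :=
      (H.2.1.of_le (C := 1) hr' fun i => by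
        rw [one_mul]; exact norm_projFar_le A.ω A.σ A.τ H.coeff i).1
    rw [norm_def, coeff_farL, HamC1.coeff_toHam]
    exact (normA_mono h1 hR (A.hrs 0).le hr0).trans hE
  grad_le := by
    have hδ := A.δs_pos 0
    have h1 := (A.gap' 0).half_fst
    have h2 := (A.gap' 0).half_snd
    rw [HamC1.coeff_toHam]
    exact (gradA_mono hG (h1.trans hR) (by have := A.hrs 1; linarith) (h2.trans hr0)).trans hD
  S_le := hS
  grad_small := hDG
  far_small := hfar

/-- The room m/2 between the final domain and the target pays for Cauchy's estimate, with constant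
2/(m/2). -/
theorem normC1_le (g : Gap A.ρf A.rf ρ r (A.m / 2)) (hr : 0 < r) (c : A.Target) :
    MemC1 ρ r c.coeff ∧ normC1 ρ r c.coeff ≤ (1 + 4 / A.m) * ‖c‖ := by
  have hm := A.hm
  have h1 := c.mem.cauchy g.pos hr.le g.le_fst g.le_snd
  have h2 : MemA ρ r c.coeff := c.mem.mono g.fst_le hr.le g.snd_le
  refine ⟨⟨h2, (memG_iff hr.le _).1 h1.1⟩, ?_⟩
  rw [normC1, normGrad_eq_gradA hr.le h1.1, add_mul, one_mul]
  refine add_le_add (normA_mono c.mem g.fst_le hr.le g.snd_le) (h1.2.trans (le_of_eq ?_))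
  rw [norm_def]
  field_simp
  ring

/-- The displacement is at most m/28, so Cauchy's estimate over the room m/2 bounds the derivative
of g - id by 1/7, which gives injectivity. The image stays in the large domain since the
displacement is less than m. -/
theorem Small.isAnalyticSymplecto {H : A.Dom 0} (h : A.Small H E D)
    (g : Gap A.ρf A.rf ρ r (A.m / 2)) (hr : 0 < r)
    (hR : ρ + 2 * Real.pi * A.m ≤ R) (hr' : r + A.m ≤ r') :
    IsAnalyticSymplecto (shift (A.lim H)) (dom d ρ r) (dom d R r') := by
  have hm := A.hm
  have hπ := Real.pi_pos
  have hρf : ρ < A.ρf := by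
    have := g.le_fst
    have := mul_pos hπ g.pos
    linarith
  have hrf : r < A.rf := by
    have := g.le_snd
    have := g.pos
    linarith
  refine ⟨analyticOnNhd_shift hρf.le hrf.le _, fun p hp => ?_, ?_, fun p hp v w => ?_⟩
  · have hs : ∑ j, ‖A.lim H j‖ ≤ A.m := by
      have := h.sum_norm_lim_le
      have := h.S_le
      linarith
    have h1 := shift_mapsTo_dom hρf.le hrf.le hs hp
    refine ⟨h1.1.trans_le ?_, h1.2.trans_le hr'⟩
    gcongr
  · refine (injOn_shift hr hρf hrf fun j => ?_).mono (dom_subset_polydom ρ r)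
    have h1 := (A.lim H j).mem.cauchy g.pos hr.le g.le_fst g.le_snd
    refine ⟨h1.1, h1.2.trans ?_⟩
    have h2 : normA A.ρf A.rf (A.lim H j).coeff ≤ A.m / 28 := h.norm_lim_le j
    calc _ ≤ 2 / (A.m / 2) * (A.m / 28) := by gcongr
      _ = 1 / 7 := by field_simp; norm_num
      _ ≤ _ := by norm_num
  · obtain ⟨L, hL, hLs⟩ := h.isSympAt_lim hr hρf hrf (dom_subset_polydom ρ r hp)
    rw [hL.fderiv, hLs]

end ElimData

/-! ### Analyticity along complex lines, and the case without far modes. -/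

section Main

variable {d : ℕ} {ρ r : ℝ} {hr : 0 < r}

/-- Differentiability is required on the whole open slice of V and not only at 0, because the
uniform limits of the iteration are taken on open sets. -/
theorem isAnalyticMapOn_of_line {E F : Type*} [NormedAddCommGroup E] [NormedSpace ℂ E]
    [NormedAddCommGroup F] [NormedSpace ℂ F] {f : E → F} {V : Set E} (hV : IsOpen V) {C : ℝ}
    (hC : ∀ x ∈ V, ‖f x‖ ≤ C)
    (hd : ∀ x ∈ V, ∀ h : E, DifferentiableOn ℂ (fun z : ℂ => f (x + z • h))
      {z | x + z • h ∈ V}) : IsAnalyticMapOn f V := by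
  refine ⟨fun x hx => ⟨C, Filter.mem_of_superset (hV.mem_nhds hx) fun y hy => hC y hy⟩, fun x hx h => ?_⟩
  have hU : IsOpen {z : ℂ | x + z • h ∈ V} := hV.preimage (by fun_prop)
  exact (hd x hx h).differentiableAt (hU.mem_nhds (by simpa using hx))

theorem shift_zero (p : Phase d) : shift (0 : Fin d ⊕ Fin d → Ham d ρ r hr) p = p := by
  refine Prod.ext (funext fun j => ?_) (funext fun j => ?_)
  · change p.1 j + (0 : Ham d ρ r hr).eval p = p.1 j
    rw [Ham.eval_zero, add_zero]
  · change p.2 j + (0 : Ham d ρ r hr).eval p = p.2 j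
    rw [Ham.eval_zero, add_zero]

end Main

variable {d : ℕ} {ω : Fin d → ℝ} {Q : Matrix (Fin d) (Fin d) ℂ} {σ τ ρ ν r r' : ℝ}

/-- If there are no far from resonance modes, nothing has to be eliminated. -/
theorem exists_elimination_of_empty (hν : 0 < ν) (hr : 0 < r) (hr' : 0 < r')
    (hrr' : r < r') (hfar : farModes ω σ τ = ∅) :
    ∃ (𝔊 : HamC1 d (ρ + ν) r' hr' → HamVec d ρ r hr)
      (𝒰 : HamC1 d (ρ + ν) r' hr' → Ham d ρ r hr),
      IsAnalyticMapOn 𝔊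
        (Metric.ball (h0 (ρ + ν) r' hr' ω Q) (epsRadius ω Q σ τ ν r r')) ∧
      IsAnalyticMapOn 𝒰
        (Metric.ball (h0 (ρ + ν) r' hr' ω Q) (epsRadius ω Q σ τ ν r r')) ∧
      ∀ H ∈ Metric.ball (h0 (ρ + ν) r' hr' ω Q) (epsRadius ω Q σ τ ν r r'),
        IsAnalyticSymplecto (idPlus (𝔊 H)) (dom d ρ r) (dom d (ρ + ν) r') ∧
        (∀ p ∈ dom d ρ r, (𝒰 H).eval p = H.eval (idPlus (𝔊 H) p)) ∧
        projFar ω σ τ (𝒰 H).coeff = 0 ∧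
        (∀ j, MemC1 ρ r (𝔊 H j).coeff) ∧
        ∑ j, normC1 ρ r (𝔊 H j).coeff ≤
          1 / epsRadius ω Q σ τ ν r r' * normA (ρ + ν) r' (projFar ω σ τ H.coeff) ∧
        normA ρ r ((𝒰 H).coeff - h0Coeff ω Q) ≤
          (1 + Real.sqrt (12 * normA 0 r' (h0Coeff ω Q) / epsRadius ω Q σ τ ν r r')) *
            ‖H - h0 (ρ + ν) r' hr' ω Q‖ ∧
        (H.IsReal → ∀ x y : Fin d → ℝ, realPoint x y ∈ dom d ρ r →
          ∃ x₁ y₁ : Fin d → ℝ, idPlus (𝔊 H) (realPoint x y) = realPoint x₁ y₁) := by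
  have hρν : ρ ≤ ρ + ν := by linarith
  have hε := epsRadius_nonneg (ω := ω) (Q := Q) (σ := σ) (τ := τ) (ν := ν) (r := r) hr'
  have hid : idPlus (0 : HamVec d ρ r hr) = id := funext fun p => shift_zero p
  have hcoeff : ∀ j, ((0 : HamVec d ρ r hr) j).coeff = 0 := fun j => rfl
  refine ⟨fun _ => 0, fun H => H.toHam hρν hrr'.le, ?_, ?_, fun H hH => ?_⟩
  · exact isAnalyticMapOn_of_line Metric.isOpen_ball (C := 0) (fun x _ => by simp)
      fun x _ h => differentiableOn_const _
  · refine isAnalyticMapOn_of_line Metric.isOpen_ball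
      (C := epsRadius ω Q σ τ ν r r' + ‖h0 (ρ + ν) r' hr' ω Q‖) (fun x hx => ?_) fun x _ h => ?_
    · rw [mem_ball_iff_norm] at hx
      have h1 : ‖(x.toHam hρν hrr'.le : Ham d ρ r hr)‖ ≤ ‖x‖ :=
        (normA_mono x.2.1 hρν hr.le hrr'.le).trans x.normA_le
      have h2 := norm_le_norm_sub_add x (h0 (ρ + ν) r' hr' ω Q)
      linarith
    · simp only [HamC1.toHam_add_smul]
      fun_prop
  · rw [hid]
    refine ⟨⟨analyticOnNhd_id, fun p hp => ?_, injOn_id _, fun p _ v w => by simp⟩,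
      fun p _ => rfl, ?_, fun j => ?_, ?_, ?_, fun _ x y _ => ⟨x, y, rfl⟩⟩
    · have hπ := Real.pi_pos
      exact ⟨hp.1.trans_le (by gcongr), hp.2.trans hrr'⟩
    · rw [projFar, hfar, indicator_empty]
      rfl
    · rw [hcoeff]
      exact MemC1.of_finite (by simp)
    · have h0 : normC1 ρ r (0 : Idx d → ℂ) = 0 := by
        simpa using normC1_smul (ρ := ρ) (r := r) (a := (0 : Idx d → ℂ)) 0
      simp only [hcoeff, h0, Finset.sum_const_zero]
      exact mul_nonneg (one_div_nonneg.2 hε) (normA_nonneg hr')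
    · have h1 : normA ρ r ((H.toHam hρν hrr'.le : Ham d ρ r hr).coeff - h0Coeff ω Q) ≤
          ‖H - h0 (ρ + ν) r' hr' ω Q‖ :=
        (normA_mono (H - h0 (ρ + ν) r' hr' ω Q).2.1 hρν hr.le hrr'.le).trans (HamC1.normA_le _)
      refine h1.trans (le_mul_of_one_le_left (norm_nonneg _) ?_)
      have := Real.sqrt_nonneg (12 * normA 0 r' (h0Coeff ω Q) / epsRadius ω Q σ τ ν r r')
      linarith


/-! ### The maps 𝔊 and 𝒰. -/

namespace ElimData

variable {d : ℕ} {ρ r R r' E D : ℝ} {hr : 0 < r} {hr' : 0 < r'} (A : ElimData d)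

/-- The eliminating transformation, minus the identity, of a Hamiltonian in `𝒜'`. -/
noncomputable def elimVec (hr : 0 < r) (hR : A.ρs 0 ≤ R) (hr0 : A.rs 0 ≤ r') (hρ : ρ ≤ A.ρf)
    (hrf : r ≤ A.rf) (H : HamC1 d R r' hr') : HamVec d ρ r hr :=
  WithLp.toLp 1 fun j => Ham.restrict hρ hrf (A.lim (H.toHam hR hr0) j)

/-- The transformed Hamiltonian of a Hamiltonian in `𝒜'`. -/
noncomputable def elimHam (hr : 0 < r) (hR : A.ρs 0 ≤ R) (hr0 : A.rs 0 ≤ r') (hρ : ρ ≤ A.ρf)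
    (hrf : r ≤ A.rf) (H : HamC1 d R r' hr') : Ham d ρ r hr :=
  Ham.restrict hρ hrf (A.trans (H.toHam hR hr0))

variable {A} {hR : A.ρs 0 ≤ R} {hr0 : A.rs 0 ≤ r'} {hρ : ρ ≤ A.ρf} {hrf : r ≤ A.rf}

theorem elimVec_apply (H : HamC1 d R r' hr') (j : Fin d ⊕ Fin d) :
    A.elimVec hr hR hr0 hρ hrf H j = Ham.restrict hρ hrf (A.lim (H.toHam hR hr0) j) := rfl

theorem idPlus_elimVec (H : HamC1 d R r' hr') :
    idPlus (A.elimVec hr hR hr0 hρ hrf H) = shift (A.lim (H.toHam hR hr0)) := by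
  funext p
  simp only [idPlus, elimVec_apply, Ham.eval_restrict]
  rfl

variable {V : Set (HamC1 d R r' hr')}

theorem isAnalyticMapOn_elimVec (hV : IsOpen V) (h : ∀ H ∈ V, A.Small (H.toHam hR hr0) E D) :
    IsAnalyticMapOn (A.elimVec hr hR hr0 hρ hrf) V := by
  refine isAnalyticMapOn_of_line hV (C := 8 / 7 * A.S E) (fun H hH => ?_) fun H _ K => ?_
  · rw [PiLp.norm_eq_of_L1]
    refine (Finset.sum_le_sum fun j _ => ?_).trans (h H hH).sum_norm_lim_le
    rw [elimVec_apply]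
    exact Ham.norm_restrict_le _ _ _
  · have hU : IsOpen {z : ℂ | H + z • K ∈ V} := hV.preimage (by fun_prop)
    refine (PiLp.continuousLinearEquiv 1 ℂ
      (fun _ : Fin d ⊕ Fin d => Ham d ρ r hr)).symm.differentiable.comp_differentiableOn
      (f := fun z => fun j => Ham.restrict hρ hrf (A.lim ((H + z • K).toHam hR hr0) j))
      (differentiableOn_pi.2 fun j => ?_)
    refine (Ham.restrict hρ hrf).differentiable.comp_differentiableOn
      (differentiableOn_lim (γ := fun z => (H + z • K).toHam hR hr0) hU ?_ (fun z hz => h _ hz) j)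
    simp only [HamC1.toHam_add_smul]
    fun_prop

/-- The iteration estimates only the change of the Hamiltonian under g, so the quadratic part in H⁰
need not be the one used in the iteration. -/
theorem Small.normA_elimHam_sub_le {H : HamC1 d R r' hr'} (h : A.Small (H.toHam hR hr0) E D)
    (ω : Fin d → ℝ) (Q : Matrix (Fin d) (Fin d) ℂ) :
    normA ρ r ((A.elimHam hr hR hr0 hρ hrf H).coeff - h0Coeff ω Q) ≤
      ‖H - h0 R r' hr' ω Q‖ + 65 / 14 * (‖A.ω‖ / A.σ) * E := by
  set X := A.trans (H.toHam hR hr0) - A.res 0 (H.toHam hR hr0) with hX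
  have h1 : (A.elimHam hr hR hr0 hρ hrf H).coeff - h0Coeff ω Q =
      (H - h0 R r' hr' ω Q).coeff + X.coeff := by
    rw [elimHam, Ham.coeff_restrict, HamC1.coeff_sub_h0, hX, Ham.coeff_sub, Ham.coeff_restrict,
      HamC1.coeff_toHam]
    abel
  have h2 : ρ ≤ R := (hρ.trans (A.ρf_le 0)).trans hR
  have h3 : r ≤ r' := (hrf.trans (A.rf_le 0)).trans hr0
  have h4 := (H - h0 R r' hr' ω Q).2.1
  rw [h1]
  refine (normA_add_le hr (h4.mono h2 hr.le h3) (X.mem.mono hρ hr.le hrf)).trans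
    (add_le_add ((normA_mono h4 h2 hr.le h3).trans (HamC1.normA_le _))
      ((normA_mono X.mem hρ hr.le hrf).trans h.norm_trans_sub_le))

theorem isAnalyticMapOn_elimHam {ω : Fin d → ℝ} {Q : Matrix (Fin d) (Fin d) ℂ} {ε : ℝ}
    (h : ∀ H ∈ Metric.ball (h0 R r' hr' ω Q) ε, A.Small (H.toHam hR hr0) E D) :
    IsAnalyticMapOn (A.elimHam hr hR hr0 hρ hrf) (Metric.ball (h0 R r' hr' ω Q) ε) := by
  have hc := memA_h0Coeff (ρ := ρ) (r := r) ω Q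
  refine isAnalyticMapOn_of_line Metric.isOpen_ball
    (C := ε + 65 / 14 * (‖A.ω‖ / A.σ) * E + normA ρ r (h0Coeff ω Q)) (fun H hH => ?_)
    fun H _ K => ?_
  · have h1 := (h H hH).normA_elimHam_sub_le (hr := hr) (hρ := hρ) (hrf := hrf) ω Q
    rw [mem_ball_iff_norm] at hH
    have h2 := normA_add_le hr
      (memA_sub_h0Coeff (A.elimHam hr hR hr0 hρ hrf H) ω Q) hc
    rw [sub_add_cancel] at h2
    rw [norm_def]
    linarith
  · have hU : IsOpen {z : ℂ | H + z • K ∈ Metric.ball (h0 R r' hr' ω Q) ε} :=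
      Metric.isOpen_ball.preimage (by fun_prop)
    refine (Ham.restrict hρ hrf).differentiable.comp_differentiableOn
      (differentiableOn_trans (γ := fun z => (H + z • K).toHam hR hr0) hU ?_ fun z hz => h _ hz)
    simp only [HamC1.toHam_add_smul]
    fun_prop

theorem Small.projFar_elimHam {H : HamC1 d R r' hr'} (h : A.Small (H.toHam hR hr0) E D) :
    projFar A.ω A.σ A.τ (A.elimHam hr hR hr0 hρ hrf H).coeff = 0 := by
  rw [elimHam, Ham.coeff_restrict, ← coeff_farL, h.far_trans, Ham.coeff_zero]

theorem Small.eval_elimHam {H : HamC1 d R r' hr'} (h : A.Small (H.toHam hR hr0) E D)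
    {p : Phase d} (hp : p ∈ dom d ρ r) : (A.elimHam hr hR hr0 hρ hrf H).eval p =
      H.eval (idPlus (A.elimVec hr hR hr0 hρ hrf H) p) := by
  rw [elimHam, Ham.eval_restrict,
    h.eval_trans (polydom_mono hρ hrf (dom_subset_polydom ρ r hp)), idPlus_elimVec,
    Ham.eval, HamC1.coeff_toHam, HamC1.eval]

theorem Small.exists_realPoint {H : HamC1 d R r' hr'} (h : A.Small (H.toHam hR hr0) E D)
    (hH : H.IsReal) (hQ : ∀ i j, (A.Q i j).im = 0) {x y : Fin d → ℝ}
    (hp : realPoint x y ∈ dom d ρ r) :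
    ∃ x₁ y₁ : Fin d → ℝ, idPlus (A.elimVec hr hR hr0 hρ hrf H) (realPoint x y) =
      realPoint x₁ y₁ := by
  have hc := hH.conjCoeff_eq ((A.hρs 0).trans_le hR)
  have hreal : RealH (H.toHam hR hr0 : A.Dom 0) :=
    realH_of_conjCoeff (by rw [HamC1.coeff_toHam, hc])
  rw [idPlus_elimVec]
  obtain ⟨x₁, y₁, h1, -⟩ := RealH.exists_shift A.hρf.le (x := x) (y := y)
    (h.realH_lim hreal hQ) fun j => by
      have h2 := ((polydom_mono hρ hrf (dom_subset_polydom ρ r hp)) j).2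
      simpa [realPoint] using h2
  exact ⟨x₁, y₁, h1⟩

theorem Small.sum_normC1_le {H : HamC1 d R r' hr'} (h : A.Small (H.toHam hR hr0) E D)
    (g : Gap A.ρf A.rf ρ r (A.m / 2)) :
    (∀ j, MemC1 ρ r (A.elimVec hr hR hr0 hρ hrf H j).coeff) ∧
      ∑ j, normC1 ρ r (A.elimVec hr hR hr0 hρ hrf H j).coeff ≤
        (1 + 4 / A.m) * (8 / 7 * A.S E) := by
  have hm := A.hm
  simp only [elimVec_apply, Ham.coeff_restrict]
  refine ⟨fun j => (normC1_le g hr _).1,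
    (Finset.sum_le_sum fun j _ => (normC1_le g hr _).2).trans ?_⟩
  rw [← Finset.mul_sum]
  exact mul_le_mul_of_nonneg_left h.sum_norm_lim_le (by positivity)

end ElimData

/-! ### The conclusion. -/

theorem exists_elimData {d : ℕ} (ω : Fin d → ℝ) {Q : Matrix (Fin d) (Fin d) ℂ} (hQ : Q.IsSymm)
    {σ τ R r' m β : ℝ} (hσ : 0 < σ) (hτ : 0 < τ) (hm : 0 < m) (hR : 2 * Real.pi * m < R)
    (hr' : m < r') (hσQ : 2 * r' * matNorm Q ≤ σ) (hσω : σ ≤ ‖ω‖)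
    (hβ : 1 + 2 * τ / r' ≤ 2 * β) :
    ∃ A : ElimData d, A.ω = ω ∧ A.Q = Q ∧ A.σ = σ ∧ A.τ = τ ∧ A.m = m ∧ A.b = 2 * β ∧
      A.ρs 0 ≤ R ∧ A.rs 0 ≤ r' ∧ A.ρf = R - 2 * Real.pi * (m / 2) ∧ A.rf = r' - m / 2 :=
  ⟨mkElimData ω hQ hσ hτ hm hR hr' hσQ hσω hβ, rfl, rfl, rfl, rfl, rfl, rfl,
    by simp [mkElimData], by simp [mkElimData], rfl, rfl⟩

/-- H⁰ has only modes with k = 0, none of which is far, so its subtraction does not change the far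
part. -/
theorem normA_projFar_le_norm_sub {d : ℕ} {R r' : ℝ} {hr' : 0 < r'} (ω : Fin d → ℝ)
    (Q : Matrix (Fin d) (Fin d) ℂ) (σ τ : ℝ) (H : HamC1 d R r' hr') :
    normA R r' (projFar ω σ τ H.coeff) ≤ ‖H - h0 R r' hr' ω Q‖ := by
  have h1 : projFar ω σ τ H.coeff = projFar ω σ τ (H - h0 R r' hr' ω Q).coeff := by
    have h2 := projFar_h0Coeff ω ω Q σ τ
    funext i
    have h3 := congrFun h2 i
    rw [HamC1.coeff_sub_h0]
    by_cases hi : i ∈ farModes ω σ τ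
    · simp only [projFar, indicator_of_mem hi, Pi.zero_apply, Pi.sub_apply] at h3 ⊢
      rw [h3, sub_zero]
    · simp only [projFar, indicator_of_notMem hi]
  rw [h1]
  have h4 : normA R r' (projFar ω σ τ (H - h0 R r' hr' ω Q).coeff) ≤
      1 * normA R r' (H - h0 R r' hr' ω Q).coeff :=
    ((H - h0 R r' hr' ω Q).2.1.of_le (C := 1) hr' fun i => by
      rw [one_mul]; exact norm_projFar_le ω σ τ (H - h0 R r' hr' ω Q).coeff i).2
  rw [one_mul] at h4
  exact h4.trans (HamC1.normA_le _)


/-- The elimination of the far from resonance modes, if there are any. -/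
theorem exists_elimination_of_nonempty {d : ℕ} {ω : Fin d → ℝ}
    {Q : Matrix (Fin d) (Fin d) ℂ} (hQ : Q.IsSymm)
    {σ τ ρ ν r r' : ℝ} (hσ : 0 < σ) (hτ : 0 < τ) (hρ : 0 < ρ) (hν : 0 < ν)
    (hr : 0 < r) (hr' : 0 < r') (hrr' : r < r') (hσQ : 2 * r' * matNorm Q < σ)
    (hσω : σ ≤ ‖ω‖) :
    ∃ (𝔊 : HamC1 d (ρ + ν) r' hr' → HamVec d ρ r hr)
      (𝒰 : HamC1 d (ρ + ν) r' hr' → Ham d ρ r hr),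
      IsAnalyticMapOn 𝔊
        (Metric.ball (h0 (ρ + ν) r' hr' ω Q) (epsRadius ω Q σ τ ν r r')) ∧
      IsAnalyticMapOn 𝒰
        (Metric.ball (h0 (ρ + ν) r' hr' ω Q) (epsRadius ω Q σ τ ν r r')) ∧
      ∀ H ∈ Metric.ball (h0 (ρ + ν) r' hr' ω Q) (epsRadius ω Q σ τ ν r r'),
        IsAnalyticSymplecto (idPlus (𝔊 H)) (dom d ρ r) (dom d (ρ + ν) r') ∧
        (∀ p ∈ dom d ρ r, (𝒰 H).eval p = H.eval (idPlus (𝔊 H) p)) ∧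
        projFar ω σ τ (𝒰 H).coeff = 0 ∧
        (∀ j, MemC1 ρ r (𝔊 H j).coeff) ∧
        ∑ j, normC1 ρ r (𝔊 H j).coeff ≤
          1 / epsRadius ω Q σ τ ν r r' * normA (ρ + ν) r' (projFar ω σ τ H.coeff) ∧
        normA ρ r ((𝒰 H).coeff - h0Coeff ω Q) ≤
          (1 + Real.sqrt (12 * normA 0 r' (h0Coeff ω Q) / epsRadius ω Q σ τ ν r r')) *
            ‖H - h0 (ρ + ν) r' hr' ω Q‖ ∧
        (H.IsReal → ∀ x y : Fin d → ℝ, realPoint x y ∈ dom d ρ r →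
          ∃ x₁ y₁ : Fin d → ℝ, idPlus (𝔊 H) (realPoint x y) = realPoint x₁ y₁) := by
  have hω : 0 < ‖ω‖ := hσ.trans_le hσω
  have hε := epsRadius_pos (Q := Q) hσ hτ hν hr' hrr' hω
  have hεle := epsRadius_mul_le (σ := σ) (Q := Q) hτ hν hr hrr' hω
  set ε := epsRadius ω Q σ τ ν r r'
  have hm := room_pos hν hrr'
  have hm1 := room_le_one ν r r'
  have hmν := two_pi_room_le ν r r'
  have hmr := room_le_sub ν r r'
  set m := room ν r r'
  have hβ7 := seven_le_lossFactor hτ hr'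
  have hβ := le_two_mul_lossFactor (τ := τ) hr'
  set β := lossFactor τ r'
  -- The iteration runs with `Q'`, which is real if any real Hamiltonian occurs in the ball. The
  -- final estimates refer to `Q`.
  obtain ⟨Q', hQ', hQ'le, hQ'H⟩ := exists_quadraticPart (ρ := ρ + ν) (r := r') (hr := hr')
    (by linarith) ω hQ ε
  obtain ⟨A, rfl, rfl, rfl, rfl, hAm, hAb, hR, hr0, hρf, hrf⟩ := exists_elimData ω hQ' hσ hτ hm
    (R := ρ + ν) (r' := r') (by linarith) (by linarith)
    ((mul_le_mul_of_nonneg_left hQ'le (by linarith)).trans hσQ.le) hσω hβ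
  have hg : Gap A.ρf A.rf ρ r (A.m / 2) :=
    ⟨by linarith, by rw [hρf, hAm]; linarith, by rw [hrf, hAm]; linarith⟩
  -- E is left free. The value ε, uniform on the ball, serves for analyticity, and the norm of 𝕀⁻H
  -- for the two estimates.
  have hsmall : ∀ H ∈ Metric.ball (h0 (ρ + ν) r' hr' A.ω Q) ε, ∀ E, 0 ≤ E → E ≤ ε →
      normA (ρ + ν) r' (projFar A.ω A.σ A.τ H.coeff) ≤ E →
      A.Small (H.toHam hR hr0) E (2 * ε) := by
    intro H hH E hE0 hE hHE
    obtain ⟨h1, h2, -, -⟩ := smallness_conditions hE0 hm hm1 hσ hσω hβ7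
      (le_trans (by gcongr) hεle)
    obtain ⟨-, -, h3, -⟩ := smallness_conditions hε.le hm hm1 hσ hσω hβ7 hεle
    have hG : A.G E ≤ 174 * ‖A.ω‖ * ε / (A.σ * m) := by
      rw [ElimData.G, hAm]
      gcongr
    refine A.small_toHam hR hr0 hHE (hQ'H H hH).1.1 (hQ'H H hH).1.2 ?_ ?_ ?_
    · rw [ElimData.S, hAb, hAm]
      linarith
    · rw [hAb]
      exact le_trans (by gcongr) h3
    · rwa [hAm]
  have hfar := fun H => normA_projFar_le_norm_sub (R := ρ + ν) (hr' := hr') A.ω Q A.σ A.τ H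
  have hsmallε : ∀ H ∈ Metric.ball (h0 (ρ + ν) r' hr' A.ω Q) ε,
      A.Small (H.toHam hR hr0) ε (2 * ε) := fun H hH =>
    hsmall H hH ε hε.le le_rfl ((hfar H).trans (mem_ball_iff_norm.1 hH).le)
  refine ⟨A.elimVec hr hR hr0 hg.fst_le hg.snd_le, A.elimHam hr hR hr0 hg.fst_le hg.snd_le,
    ElimData.isAnalyticMapOn_elimVec Metric.isOpen_ball hsmallε,
    ElimData.isAnalyticMapOn_elimHam hsmallε, fun H hH => ?_⟩
  have hs := hsmall H hH _ (normA_nonneg hr') ((hfar H).trans (mem_ball_iff_norm.1 hH).le) le_rfl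
  obtain ⟨h1, -, -, h4⟩ := smallness_conditions hε.le hm hm1 hσ hσω hβ7 hεle
  refine ⟨?_, fun p hp => hs.eval_elimHam hp, hs.projFar_elimHam, (hs.sum_normC1_le hg).1,
    (hs.sum_normC1_le hg).2.trans ?_, (hs.normA_elimHam_sub_le A.ω Q).trans ?_,
    fun hreal x y hp => hs.exists_realPoint hreal ((hQ'H H hH).2 hreal) hp⟩
  · rw [ElimData.idPlus_elimVec]
    exact hs.isAnalyticSymplecto hg hr (by rw [hAm]; linarith) (by rw [hAm]; linarith)
  · rw [ElimData.S, hAb, hAm, ← mul_assoc, ← mul_assoc]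
    refine mul_le_mul_of_nonneg_right ?_ (normA_nonneg hr')
    rw [le_div_iff₀ hε]
    calc (1 + 4 / m) * (8 / 7) * (2 / A.σ * (2 * β)) * ε
        = (1 + 4 / m) * (8 / 7) * (2 / A.σ * (2 * β) * ε) := by ring
      _ ≤ (1 + 4 / m) * (8 / 7) * (m / 4116) := by gcongr
      _ = (m + 4) * (8 / 7) / 4116 := by field_simp
      _ ≤ 1 := by linarith
  · have hN := abs_le_normA_h0Coeff A.ω Q hr'
    set N := normA 0 r' (h0Coeff A.ω Q)
    -- By the last smallness condition (‖ω‖/σ)²ε ≤ ‖ω‖m/2 ≤ ‖H⁰‖/2, and (65/14)²/2 is below 12.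
    have h5 : 65 / 14 * (‖A.ω‖ / A.σ) ≤ Real.sqrt (12 * N / ε) := by
      have hmN : ‖A.ω‖ * m ≤ N := le_trans (by rw [mul_comm]; gcongr; linarith) hN
      refine Real.le_sqrt_of_sq_le ((le_div_iff₀ hε).2 ?_)
      calc (65 / 14 * (‖A.ω‖ / A.σ)) ^ 2 * ε
          = (65 / 14) ^ 2 * ((‖A.ω‖ / A.σ) ^ 2 * ε) := by ring
        _ ≤ (65 / 14) ^ 2 * (N / 2) := by
            gcongr
            linarith
        _ ≤ 12 * N := by
            have : 0 ≤ N := normA_nonneg hr'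
            linarith
    rw [add_mul, one_mul]
    have h6 := mul_le_mul h5 (hfar H) (normA_nonneg hr') (Real.sqrt_nonneg _)
    linarith

end TFHam

theorem mainTheorem6 {d : ℕ} (ω : Fin d → ℝ) (hω : ω ≠ 0)
    (Q : Matrix (Fin d) (Fin d) ℂ) (hQ : Q.IsSymm)
    (σ τ ρ ν r r' : ℝ) (hσ : 0 < σ) (hτ : 0 < τ) (hρ : 0 < ρ) (hν : 0 < ν)
    (hr : 0 < r) (hr' : 0 < r') (hrr' : r < r') (hσQ : 2 * r' * matNorm Q < σ) :
    ∃ (𝔊 : HamC1 d (ρ + ν) r' hr' → HamVec d ρ r hr)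
      (𝒰 : HamC1 d (ρ + ν) r' hr' → Ham d ρ r hr),
      IsAnalyticMapOn 𝔊
        (Metric.ball (h0 (ρ + ν) r' hr' ω Q) (epsRadius ω Q σ τ ν r r')) ∧
      IsAnalyticMapOn 𝒰
        (Metric.ball (h0 (ρ + ν) r' hr' ω Q) (epsRadius ω Q σ τ ν r r')) ∧
      ∀ H ∈ Metric.ball (h0 (ρ + ν) r' hr' ω Q) (epsRadius ω Q σ τ ν r r'),
        IsAnalyticSymplecto (idPlus (𝔊 H)) (dom d ρ r) (dom d (ρ + ν) r') ∧
        (∀ p ∈ dom d ρ r, (𝒰 H).eval p = H.eval (idPlus (𝔊 H) p)) ∧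
        projFar ω σ τ (𝒰 H).coeff = 0 ∧
        (∀ j, MemC1 ρ r (𝔊 H j).coeff) ∧
        ∑ j, normC1 ρ r (𝔊 H j).coeff ≤
          1 / epsRadius ω Q σ τ ν r r' * normA (ρ + ν) r' (projFar ω σ τ H.coeff) ∧
        normA ρ r ((𝒰 H).coeff - h0Coeff ω Q) ≤
          (1 + Real.sqrt (12 * normA 0 r' (h0Coeff ω Q) / epsRadius ω Q σ τ ν r r')) *
            ‖H - h0 (ρ + ν) r' hr' ω Q‖ ∧
        (H.IsReal → ∀ x y : Fin d → ℝ, realPoint x y ∈ dom d ρ r →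
          ∃ x₁ y₁ : Fin d → ℝ, idPlus (𝔊 H) (realPoint x y) = realPoint x₁ y₁) := by
  by_cases hfar : farModes ω σ τ = ∅
  · exact exists_elimination_of_empty hν hr hr' hrr' hfar
  -- A far mode supplies σ < ‖ω‖, on which the estimates of the iteration rest.
  · obtain ⟨i, hi⟩ := nonempty_iff_ne_empty.2 hfar
    exact exists_elimination_of_nonempty hQ hσ hτ hρ hν hr hr' hrr' hσQ
      (lt_norm_of_mem_farModes hi).le
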